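/- **Setting.** Let $\mathcal M$ be the set of Borel probability measures on $[0,1]$; a measure is identified with its distribution function $q\mapsto x(q)=x([0,q])$. Let $\mathcal M_a^{<1}\subset\mathcal M$ be the set of measures with exactly $k+1$ atoms and no other mass, for some integer $k\ge 0$, one of the atoms being located at $1$. Such an $x$ is described by the positions $0\le q_1<\dots<q_{k+1}=1$ of its atoms and the values $0<x_1<\dots<x_{k+1}=1$, $x_i=x(q_i)$. For $0<m<1$, a REM($m$) is a Poisson point process on $(0,\infty)$ with intensity measure $m\,s^{-m-1}ds$, its points being enumerated in decreasing order. Given $x\in\mathcal M_a^{<1}$ as above, take independent processes $\zeta^{\beta}$, $\beta\in\mathbb N^{l-1}$, $1\le l\le k$, where $\zeta^{\beta}$ with $\beta\in\mathbb N^{l-1}$ is a REM($x_l$), and put, for $\alpha=(\alpha_1,\dots,\alpha_k)\in\mathbb N^k$ with truncations $\alpha(l)=(\alpha_1,\dots,\alpha_l)$, $$\xi_\alpha=\prod_{l=1}^k\bigl(\zeta^{\alpha(l-1)}\bigr)_{\alpha_l},\qquad q_{\alpha,\alpha'}=\max\{q_{l+1}:\ 0\le l\le k,\ \alpha(l)=\alpha'(l)\}.$$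 Let $g\in C^1([0,1])$ be strictly increasing with $g(0)=0$, and let $(\kappa_\alpha)_{\alpha\in\mathbb N^k}$ be a centered Gaussian process, independent of all the $\zeta^\beta$, with $\mathrm{Cov}(\kappa_\alpha,\kappa_{\alpha'})=g(q_{\alpha,\alpha'})$. Let $\psi\in C^2(\mathbb R)$ be such that $\psi'$ and $\psi''$ are bounded and $E[e^{\psi(Y)}]<\infty$ for every Gaussian variable $Y$. Define $$\mathcal P_{\psi,g}(x)=\mathbb E_x\left[\log\frac{\sum_\alpha \xi_\alpha e^{\psi(\kappa_\alpha)}}{\sum_\alpha\xi_\alpha}\right],\qquad x\in\mathcal M_a^{<1}.$$ **Theorem (Continuity and Monotonicity).** Let $\psi$ and $g$ be as above and assume $|\psi'|\le C$. Then $\mathcal P_{\psi,g}$ is well defined on $\mathcal M_a^{<1}$: the objects above exist, the two sums converge almost surely, the logarithm is integrable, and its expectation depends only on $x$. Moreover: 1. For all $x,y\in\mathcal M_a^{<1}$, $$|\mathcal P_{\psi,g}(x)-\mathcal P_{\psi,g}(y)|\le \frac{C^2}{2}\int_0^1|x(q)-y(q)|\,g'(q)\,dq=\frac{C^2}{2}\|x-y\|_{L^1(g'(q)dq)}.$$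 The topology on $\mathcal M$ induced by the $L^1([0,1],g'(q)dq)$-distance of distribution functions is the weak topology, and $\mathcal P_{\psi,g}$ has a unique extension to $\mathcal M$ that is continuous in this topology. 2. This extension is monotone increasing: if $x,y\in\mathcal M$ and $x(q)\ge y(q)$ for all $q\in[0,1]$, then $\mathcal P_{\psi,g}(x)\ge\mathcal P_{\psi,g}(y)$. -/

import Mathlib

open MeasureTheory ProbabilityTheory Set Topology
open scoped ENNReal NNReal

noncomputable section

namespace RPC

/-! ### Probability measures on the unit interval and their distribution functions -/

/-- The space of Borel probability measures on `[0,1]`; its instance topology is the weak one. -/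
abbrev ProbI : Type := ProbabilityMeasure unitInterval

/-- The distribution function of `μ`: `distFun μ q = μ [0, q]`. -/
def distFun (μ : ProbI) (q : ℝ) : ℝ :=
  (μ : Measure unitInterval).real {t | (t : ℝ) ≤ q}

/-- `x` dominates `y` if the distribution function of `x` is everywhere at least that of `y`. -/
def Dominates (x y : ProbI) : Prop :=
  ∀ q ∈ Icc (0 : ℝ) 1, distFun y q ≤ distFun x q

/-- The measure `g'(q) dq` on `[0,1]`. -/
def weight (g : ℝ → ℝ) : Measure ℝ :=
  (volume.restrict (Icc (0 : ℝ) 1)).withDensity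
    fun q => ENNReal.ofReal (derivWithin g (Icc (0 : ℝ) 1) q)

/-- The `L¹([0,1], g'(q) dq)`-distance of the distribution functions of `μ` and `ν`. -/
def l1Dist (g : ℝ → ℝ) (μ ν : ProbI) : ℝ≥0∞ :=
  eLpNorm (fun q => distFun μ q - distFun ν q) 1 (weight g)

theorem monotone_distFun (μ : ProbI) : Monotone (distFun μ) := fun _ _ h =>
  measureReal_mono fun _ ht => le_trans ht h

theorem l1Dist_triangle (g : ℝ → ℝ) (x y z : ProbI) :
    l1Dist g x z ≤ l1Dist g x y + l1Dist g y z := by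
  have hm : ∀ a b : ProbI,
      AEStronglyMeasurable (fun q => distFun a q - distFun b q) (weight g) := fun a b =>
    ((monotone_distFun a).measurable.sub (monotone_distFun b).measurable).aestronglyMeasurable
  have h := eLpNorm_add_le (hm x y) (hm y z) (le_refl (1 : ℝ≥0∞))
  have e : ((fun q => distFun x q - distFun y q) + fun q => distFun y q - distFun z q)
      = fun q => distFun x q - distFun z q := by
    funext q; simp
  rw [e] at h
  exact h

/-- The (extended pseudo-)metric `l1Dist g` on the space of probability measures on `[0,1]`. -/
abbrev l1Space (g : ℝ → ℝ) : PseudoEMetricSpace ProbI where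
  edist := l1Dist g
  edist_self x := by simp [l1Dist]
  edist_comm x y := eLpNorm_sub_comm (distFun x) (distFun y) 1 (weight g)
  edist_triangle := l1Dist_triangle g

/-- The `L¹`-topology on the space of probability measures on `[0,1]`. -/
abbrev l1Topology (g : ℝ → ℝ) : TopologicalSpace ProbI :=
  (l1Space g).toUniformSpace.toTopologicalSpace

/-! ### Finitely supported measures with an atom at `1` -/

/-- An element of `M_a^{<1}`, i.e. a probability measure on `[0,1]` with exactly `k + 1` atoms,
one of them located at `1`, recorded by the positions `q₁ < ⋯ < q_{k+1} = 1` of its atoms and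
the values `x₁ < ⋯ < x_{k+1} = 1` of its distribution function there. The indices are shifted
by one: `q i` and `x i` with `i : Fin (k + 1)` stand for `q_{i+1}` and `x_{i+1}`. -/
structure Atomic where
  k : ℕ
  q : Fin (k + 1) → ℝ
  x : Fin (k + 1) → ℝ
  q_mono : StrictMono q
  x_mono : StrictMono x
  q_nonneg : 0 ≤ q 0
  x_pos : 0 < x 0
  q_last : q (Fin.last k) = 1
  x_last : x (Fin.last k) = 1

namespace Atomic

variable (a : Atomic)

theorem q_mem (i : Fin (a.k + 1)) : a.q i ∈ unitInterval :=
  ⟨a.q_nonneg.trans (a.q_mono.monotone (Fin.zero_le i)),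
    (a.q_mono.monotone (Fin.le_last i)).trans a.q_last.le⟩

/-- The mass of the `i`-th atom: `x_i - x_{i-1}`, with the convention `x_0 = 0`. -/
def mass (i : Fin (a.k + 1)) : ℝ :=
  a.x i - (Fin.cons 0 a.x : Fin (a.k + 2) → ℝ) i.castSucc

theorem mass_nonneg (i : Fin (a.k + 1)) : 0 ≤ a.mass i := by
  unfold mass
  refine Fin.cases ?_ (fun j => ?_) i
  · simpa using a.x_pos.le
  · have h : (Fin.cons 0 a.x : Fin (a.k + 2) → ℝ) j.succ.castSucc = a.x j.castSucc := by
      rw [← Fin.succ_castSucc, Fin.cons_succ]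
    rw [h, sub_nonneg]
    exact a.x_mono.monotone (Fin.castSucc_lt_succ).le

theorem sum_mass : ∑ i, a.mass i = 1 := by
  have h : ∀ i : Fin (a.k + 1), a.mass i =
      (Fin.cons 0 a.x : Fin (a.k + 2) → ℝ) i.succ
        - (Fin.cons 0 a.x : Fin (a.k + 2) → ℝ) i.castSucc := fun i => by
    simp [mass]
  have key := Fin.sum_univ_succ (Fin.cons 0 a.x : Fin (a.k + 2) → ℝ)
  have key' := Fin.sum_univ_castSucc (Fin.cons 0 a.x : Fin (a.k + 2) → ℝ)
  have hl : (Fin.cons 0 a.x : Fin (a.k + 2) → ℝ) (Fin.last (a.k + 1)) = 1 := by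
    rw [← Fin.succ_last, Fin.cons_succ, a.x_last]
  have h0 : (Fin.cons 0 a.x : Fin (a.k + 2) → ℝ) 0 = 0 := rfl
  rw [Finset.sum_congr rfl fun i _ => h i, Finset.sum_sub_distrib]
  rw [hl] at key'
  rw [h0] at key
  linarith

/-- The probability measure on `[0,1]` described by `a`. -/
def toProbI : ProbI :=
  ⟨∑ i, ENNReal.ofReal (a.mass i) • Measure.dirac (⟨a.q i, a.q_mem i⟩ : unitInterval), ⟨by
    simp only [Measure.coe_finsetSum, Finset.sum_apply, Measure.smul_apply, measure_univ,
      smul_eq_mul, mul_one]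
    rw [← ENNReal.ofReal_sum_of_nonneg fun i _ => a.mass_nonneg i, a.sum_mass,
      ENNReal.ofReal_one]⟩⟩

/-- The overlap `q_{α,α'} = max {q_{l+1} : 0 ≤ l ≤ k, α(l) = α'(l)}`, where `α(l)` is the
truncation `(α₁, …, α_l)`. -/
def overlap (α α' : Fin a.k → ℕ) : ℝ :=
  open Classical in
  (Finset.univ.filter fun l : Fin (a.k + 1) =>
      ∀ i : Fin a.k, (i : ℕ) < (l : ℕ) → α i = α' i).sup'
    ⟨0, by simp⟩ a.q

end Atomic

/-! ### The random energy model and its cascade -/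

/-- The number (with multiplicity, possibly infinite) of points of `ζ` in `A`. -/
def count {Ω : Type} (ζ : ℕ → Ω → ℝ) (A : Set ℝ) (ω : Ω) : ℝ≥0∞ :=
  ∑' j, A.indicator (fun _ => (1 : ℝ≥0∞)) (ζ j ω)

/-- The points `ζ 0, ζ 1, …` form a Poisson point process with (σ-finite) intensity `ν`: for
pairwise disjoint Borel sets of finite intensity the numbers of points in them are independent
Poisson variables with the intensities of the sets as means. -/
structure IsPoissonPointProcess {Ω : Type} [MeasurableSpace Ω] (P : Measure Ω)
    (ν : Measure ℝ) (ζ : ℕ → Ω → ℝ) : Prop where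
  measurable : ∀ j, Measurable (ζ j)
  poisson : ∀ A : Set ℝ, MeasurableSet A → ν A ≠ ∞ →
    P.map (count ζ A) = (poissonMeasure (ν A).toNNReal).map (Nat.cast : ℕ → ℝ≥0∞)
  indep : ∀ (n : ℕ) (A : Fin n → Set ℝ), (∀ i, MeasurableSet (A i)) → (∀ i, ν (A i) ≠ ∞) →
    Pairwise (fun i j => Disjoint (A i) (A j)) → iIndepFun (fun i => count ζ (A i)) P

/-- The measure `x s^{-x-1} ds` on `(0,∞)`. -/
def remIntensity (x : ℝ) : Measure ℝ :=
  (volume.restrict (Ioi (0 : ℝ))).withDensity fun s => ENNReal.ofReal (x * s ^ (-x - 1))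

/-- `ζ 0 > ζ 1 > ⋯ > 0` is the decreasing enumeration of a REM(`x`), the Poisson point process
on `(0,∞)` with intensity measure `x s^{-x-1} ds`. -/
structure IsREM {Ω : Type} [MeasurableSpace Ω] (P : Measure Ω) (x : ℝ)
    (ζ : ℕ → Ω → ℝ) : Prop where
  ppp : IsPoissonPointProcess P (remIntensity x) ζ
  pos : ∀ᵐ ω ∂P, ∀ j, 0 < ζ j ω
  anti : ∀ᵐ ω ∂P, StrictAnti fun j => ζ j ω

/-- The internal vertices of the tree: a vertex at depth `l`, `0 ≤ l < k`, is a word in `ℕˡ`.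
The truncation of `α ∈ ℕᵏ` at depth `l` is `trunc α l`. -/
abbrev Vertex (k : ℕ) : Type := Σ l : Fin k, (Fin (l : ℕ) → ℕ)

/-- The truncation `α(l) = (α₁, …, α_l)`. -/
def trunc {k : ℕ} (α : Fin k → ℕ) (l : Fin k) : Vertex k :=
  ⟨l, fun i => α ⟨i, i.isLt.trans l.isLt⟩⟩

/-- The points `ξ_α = ∏_{l=1}^k (ζ^{α(l-1)})_{α_l}` of the cascade. -/
def cascade {Ω : Type} {k : ℕ} (ζ : Vertex k → ℕ → Ω → ℝ) (α : Fin k → ℕ) (ω : Ω) : ℝ :=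
  ∏ l : Fin k, ζ (trunc α l) (α l) ω

/-- On `(Ω, P)`, the family `ζ` consists of the independent REM's from which the GREM of `a` is
built (REM(`x_l`) at the words of length `l - 1`), and `κ` is, at time `1`, a gaussian field
with covariance function `g` on it: a centered gaussian process with covariance `g(q_{α,α'})`,
independent of `ζ`. -/
structure IsGREM {Ω : Type} [MeasurableSpace Ω] (P : Measure Ω) (a : Atomic) (g : ℝ → ℝ)
    (ζ : Vertex a.k → ℕ → Ω → ℝ) (κ : (Fin a.k → ℕ) → Ω → ℝ) : Prop where
  isProb : IsProbabilityMeasure P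
  rem : ∀ v : Vertex a.k, IsREM P (a.x v.1.castSucc) (ζ v)
  rem_indep : iIndepFun (fun v ω j => ζ v j ω) P
  field_measurable : ∀ α, Measurable (κ α)
  field_gaussian : IsGaussianProcess κ P
  field_mean : ∀ α, ∫ ω, κ α ω ∂P = 0
  field_cov : ∀ α α', covariance (κ α) (κ α') P = g (a.overlap α α')
  field_indep : IndepFun (fun ω v j => ζ v j ω) (fun ω α => κ α ω) P

/-! ### The functional -/

/-- The class of `C²` functions with bounded first and second derivatives, for which `e^ψ` is
integrable against every gaussian law. -/
structure ClassC (ψ : ℝ → ℝ) : Prop where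
  contDiff : ContDiff ℝ 2 ψ
  bdd_deriv : ∃ K, ∀ t, |deriv ψ t| ≤ K
  bdd_deriv2 : ∃ K, ∀ t, |deriv (deriv ψ) t| ≤ K
  integrable_exp : ∀ (m : ℝ) (v : ℝ≥0), Integrable (fun t => Real.exp (ψ t)) (gaussianReal m v)

/-- `log (∑_α ξ_α e^{ψ(κ_α)} / ∑_α ξ_α)`. -/
def logRatio {Ω : Type} {k : ℕ} (ψ : ℝ → ℝ) (ζ : Vertex k → ℕ → Ω → ℝ)
    (κ : (Fin k → ℕ) → Ω → ℝ) (ω : Ω) : ℝ :=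
  Real.log ((∑' α, cascade ζ α ω * Real.exp (ψ (κ α ω))) / ∑' α, cascade ζ α ω)

/-- `p` is the value at `a` of the functional
`x ↦ E_x[log (∑_α ξ_α e^{ψ(κ_α(1))} / ∑_α ξ_α)]`: the GREM of `a` with its gaussian field
exists, and on every realization of it the two sums converge almost surely, the logarithm is
integrable, and its expectation is `p`. -/
def IsValue (ψ g : ℝ → ℝ) (a : Atomic) (p : ℝ) : Prop :=
  (∃ (Ω : Type) (_ : MeasurableSpace Ω) (P : Measure Ω)
      (ζ : Vertex a.k → ℕ → Ω → ℝ) (κ : (Fin a.k → ℕ) → Ω → ℝ), IsGREM P a g ζ κ) ∧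
  ∀ (Ω : Type) [MeasurableSpace Ω] (P : Measure Ω)
      (ζ : Vertex a.k → ℕ → Ω → ℝ) (κ : (Fin a.k → ℕ) → Ω → ℝ), IsGREM P a g ζ κ →
    (∀ᵐ ω ∂P, Summable fun α => cascade ζ α ω) ∧
    (∀ᵐ ω ∂P, Summable fun α => cascade ζ α ω * Real.exp (ψ (κ α ω))) ∧
    Integrable (logRatio ψ ζ κ) P ∧
    ∫ ω, logRatio ψ ζ κ ω ∂P = p

end RPC

end

noncomputable section
namespace RPC

/-! ### The one-step operator of the Parisi recursion -/

/-! The functional is computed explicitly and then studied as a nonlinear backward evolution.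

Computation. Let T be the sum of the ξ_α e^{ψ(κ_α)} and W the sum of the ξ_α. A centered Gaussian
field with covariance g(q_{α,α'}) has the law of a sum of independent increments along the branches
of the tree (`covariance_canonicalField`, `isGaussianProcess_map_eq`), so T satisfies a branching
recursion. Multiplying the points of a REM(m) by independent factors A only multiplies its intensity
by E[A^m]. Induction on the depth and the Laplace functional of a Poisson process therefore give,
when the field starts at y, E e^{-rT} = exp(-c (r e^{φ(y)})^{x_1}), where c does not depend on ψ and
φ arises from ψ by iterating φ ↦ m⁻¹ log E e^{mφ(· + Z)} (`lintegral_expNeg_treeSum`). Hence T has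
the law of e^{φ(η)} W with an independent Gaussian η (`IsGREM.map_leafSum`); log W is integrable
(`log_of_laplace`), its mean cancels, and the functional equals E φ(η), which is `parisi`. All sums
are first taken in [0,∞], so that their convergence is a conclusion.

Comparison. With g(q) as time, the recursion is an evolution whose order at q is x(q); as long as
the order is constant, the operators form a semigroup. As a function of its order m, the operator is
a difference quotient of a cumulant generating function: it increases in m, and its slope is at most
C²/2 times the elapsed variance (`gaussOp_sub_le_sharp`). Running two evolutions backwards over a
common partition gives the L¹ bound (`parisi_lipschitz`) and the monotonicity (`parisi_mono`).

Extension. Weak convergence implies L¹-convergence of distribution functions; compactness makes the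
two topologies equal (`l1Topology_eq`). Atomic measures approximate every measure by a
discretization that respects domination, so the Lipschitz functional and its monotonicity extend
(`exists_extension`). -/

theorem dslope_mem_Icc_of_deriv2_mem {f f' f'' : ℝ → ℝ} {M : ℝ} (h0 : f 0 = 0)
    (hf : ∀ m, HasDerivAt f (f' m) m) (hf' : ∀ m, HasDerivAt f' (f'' m) m)
    (hM : ∀ m ∈ Icc (0 : ℝ) 1, f'' m ∈ Icc 0 M) {m m' : ℝ} (hm : 0 ≤ m) (hmm : m ≤ m')
    (hm' : m' ≤ 1) :
    dslope f 0 m ≤ dslope f 0 m' ∧ dslope f 0 m' - dslope f 0 m ≤ M / 2 * (m' - m) := by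
  -- The quotient f(m)/m has derivative (m f' - f)/m². The numerator vanishes at 0 and has
  -- derivative m f'', which lies in [0, Mm], so it lies in [0, Mm²/2].
  have hk : ∀ m, HasDerivAt (fun m => m * f' m - f m) (m * f'' m) m := fun m => by
    have : HasDerivAt (fun m => m * f' m - f m) (1 * f' m + m * f'' m - f' m) m :=
      ((hasDerivAt_id m).mul (hf' m)).sub (hf m)
    exact this.congr_deriv (by ring)
  have hkc : Continuous fun m => m * f' m - f m :=
    continuous_iff_continuousAt.2 fun m => (hk m).continuousAt
  have hmono : MonotoneOn (fun m => m * f' m - f m) (Icc 0 1) := by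
    refine monotoneOn_of_deriv_nonneg (convex_Icc 0 1) hkc.continuousOn
      (fun m _ => (hk m).differentiableAt.differentiableWithinAt) fun m hm => ?_
    rw [interior_Icc] at hm
    rw [(hk m).deriv]
    exact mul_nonneg hm.1.le (hM m ⟨hm.1.le, hm.2.le⟩).1
  have hk2 : ∀ m, HasDerivAt (fun m => M / 2 * m ^ 2 - (m * f' m - f m))
      (M * m - m * f'' m) m := fun m => by
    exact (((hasDerivAt_pow 2 m).const_mul (M / 2)).sub (hk m)).congr_deriv
      (by push_cast; ring)
  have hmono2 : MonotoneOn (fun m => M / 2 * m ^ 2 - (m * f' m - f m)) (Icc 0 1) := by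
    refine monotoneOn_of_deriv_nonneg (convex_Icc 0 1)
      (continuous_iff_continuousAt.2 fun m => (hk2 m).continuousAt).continuousOn
      (fun m _ => (hk2 m).differentiableAt.differentiableWithinAt) fun m hm => ?_
    rw [interior_Icc] at hm
    rw [(hk2 m).deriv]
    nlinarith [mul_le_mul_of_nonneg_left (hM m ⟨hm.1.le, hm.2.le⟩).2 hm.1.le]
  have hd : ∀ m ∈ Ioo (0 : ℝ) 1, HasDerivAt (dslope f 0) ((m * f' m - f m) / m ^ 2) m :=
      fun m hm => by
    have h1 : HasDerivAt (fun m => f m / m) ((f' m * m - f m * 1) / m ^ 2) m :=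
      (hf m).div (hasDerivAt_id m) hm.1.ne'
    have h2 : dslope f 0 =ᶠ[𝓝 m] fun m => f m / m := by
      filter_upwards [lt_mem_nhds hm.1] with u hu
      rw [dslope_of_ne _ hu.ne', slope_def_field]
      simp [h0]
    exact (h1.congr_of_eventuallyEq h2).congr_deriv (by ring)
  have hc : ContinuousOn (dslope f 0) (Icc 0 1) := by
    intro m _
    refine ContinuousAt.continuousWithinAt ?_
    by_cases h : m = 0
    · subst h
      exact continuousAt_dslope_same.2 (hf 0).differentiableAt
    · exact (continuousAt_dslope_of_ne h).2 (hf m).continuousAt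
  have hb : ∀ m ∈ Ioo (0 : ℝ) 1, 0 ≤ (m * f' m - f m) / m ^ 2 ∧
      (m * f' m - f m) / m ^ 2 ≤ M / 2 := fun m hm => by
    have h1 := hmono (left_mem_Icc.2 zero_le_one) ⟨hm.1.le, hm.2.le⟩ hm.1.le
    have h2 := hmono2 (left_mem_Icc.2 zero_le_one) ⟨hm.1.le, hm.2.le⟩ hm.1.le
    simp only [zero_mul, h0, sub_self] at h1 h2
    refine ⟨div_nonneg h1 (sq_nonneg m), ?_⟩
    rw [div_le_iff₀ (pow_pos hm.1 2)]
    nlinarith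
  have hG : MonotoneOn (dslope f 0) (Icc 0 1) := by
    refine monotoneOn_of_deriv_nonneg (convex_Icc 0 1) hc ?_ ?_ <;> rw [interior_Icc]
    · exact fun m hm => (hd m hm).differentiableAt.differentiableWithinAt
    · intro m hm
      rw [(hd m hm).deriv]
      exact (hb m hm).1
  have hG2 : MonotoneOn (fun m => M / 2 * m - dslope f 0 m) (Icc 0 1) := by
    refine monotoneOn_of_deriv_nonneg (convex_Icc 0 1) (by fun_prop) ?_ ?_ <;> rw [interior_Icc]
    · exact fun m hm =>
        (((hasDerivAt_id m).const_mul (M / 2)).sub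
          (hd m hm)).differentiableAt.differentiableWithinAt
    · intro m hm
      have : HasDerivAt (fun m => M / 2 * m - dslope f 0 m)
          (M / 2 * 1 - (m * f' m - f m) / m ^ 2) m :=
        ((hasDerivAt_id m).const_mul (M / 2)).sub (hd m hm)
      rw [this.deriv]
      simpa using (hb m hm).2
  have i1 : m ∈ Icc (0 : ℝ) 1 := ⟨hm, hmm.trans hm'⟩
  have i2 : m' ∈ Icc (0 : ℝ) 1 := ⟨hm.trans hmm, hm'⟩
  refine ⟨hG i1 i2 hmm, ?_⟩
  have := hG2 i1 i2 hmm
  simp only at this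
  linarith

theorem integrable_exp_mul_abs_gaussianReal (v : ℝ≥0) (c : ℝ) :
    Integrable (fun z => Real.exp (c * |z|)) (gaussianReal 0 v) :=
  integrable_exp_mul_abs (X := fun z : ℝ => z) (integrable_exp_mul_gaussianReal c)
    (integrable_exp_mul_gaussianReal (-c))

theorem integrable_abs_gaussianReal (v : ℝ≥0) :
    Integrable (fun z => |z|) (gaussianReal 0 v) :=
  ((memLp_id_gaussianReal (μ := 0) (v := v) 1).integrable le_rfl).abs

section Operator

variable {C : ℝ≥0} {φ χ : ℝ → ℝ}

theorem _root_.LipschitzWith.abs_sub_le_mul_abs (hφ : LipschitzWith C φ) (y z : ℝ) :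
    |φ (y + z) - φ y| ≤ C * |z| := by
  simpa [Real.dist_eq] using hφ.dist_le_mul (y + z) y

theorem integrable_exp_mul_shift (hφ : LipschitzWith C φ) (v : ℝ≥0) (m y : ℝ) :
    Integrable (fun z => Real.exp (m * φ (y + z))) (gaussianReal 0 v) := by
  refine ((integrable_exp_mul_abs_gaussianReal v (|m| * C)).const_mul
    (Real.exp (m * φ y))).mono' ?_ (ae_of_all _ fun z => ?_)
  · have := hφ.continuous
    exact Continuous.aestronglyMeasurable (by fun_prop)
  · rw [Real.norm_eq_abs, Real.abs_exp, ← Real.exp_add]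
    refine Real.exp_le_exp.2 ?_
    have h := (le_abs_self _).trans (abs_mul m (φ (y + z) - φ y)).le
    have h2 := mul_le_mul_of_nonneg_left (hφ.abs_sub_le_mul_abs y z) (abs_nonneg m)
    linarith

theorem integrable_shift (hφ : LipschitzWith C φ) (v : ℝ≥0) (y : ℝ) :
    Integrable (fun z => φ (y + z)) (gaussianReal 0 v) := by
  refine (((integrable_abs_gaussianReal v).const_mul (C : ℝ)).add
    (integrable_const |φ y|)).mono' ?_ (ae_of_all _ fun z => ?_)
  · have := hφ.continuous
    exact Continuous.aestronglyMeasurable (by fun_prop)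
  · have := hφ.abs_sub_le_mul_abs y z
    have h2 := abs_sub_abs_le_abs_sub (φ (y + z)) (φ y)
    simp only [Pi.add_apply, Real.norm_eq_abs]
    linarith

/-- The operator `φ ↦ m⁻¹ log E[exp(m φ(· + Z))]` with `Z` centered gaussian of variance `v`;
for `m = 0` it is `φ ↦ E[φ(· + Z)]`. -/
def gaussOp (m : ℝ) (v : ℝ≥0) (φ : ℝ → ℝ) (y : ℝ) : ℝ :=
  if m = 0 then ∫ z, φ (y + z) ∂gaussianReal 0 v
  else Real.log (∫ z, Real.exp (m * φ (y + z)) ∂gaussianReal 0 v) / m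

theorem integral_exp_shift_pos (hφ : LipschitzWith C φ) (v : ℝ≥0) (m y : ℝ) :
    0 < ∫ z, Real.exp (m * φ (y + z)) ∂gaussianReal 0 v :=
  integral_exp_pos (integrable_exp_mul_shift hφ v m y)

theorem exp_mul_gaussOp (hφ : LipschitzWith C φ) {m : ℝ} (hm : m ≠ 0) (v : ℝ≥0) (y : ℝ) :
    Real.exp (m * gaussOp m v φ y) = ∫ z, Real.exp (m * φ (y + z)) ∂gaussianReal 0 v := by
  rw [gaussOp, if_neg hm, mul_div_cancel₀ _ hm, Real.exp_log (integral_exp_shift_pos hφ v m y)]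

theorem gaussOp_zero_var (m : ℝ) (φ : ℝ → ℝ) : gaussOp m 0 φ = φ := by
  funext y
  by_cases hm : m = 0
  · simp [gaussOp, hm]
  · simp [gaussOp, hm]

/-- The operator is monotone and commutes with the addition of constants; it is thus a contraction
in the supremum distance. -/
theorem gaussOp_le (hφ : LipschitzWith C φ) (hχ : LipschitzWith C χ) {m : ℝ} (hm : 0 ≤ m)
    (v : ℝ≥0) {d : ℝ} (h : ∀ y, φ y ≤ χ y + d) (y : ℝ) :
    gaussOp m v φ y ≤ gaussOp m v χ y + d := by
  rcases hm.eq_or_lt with rfl | hm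
  · simp only [gaussOp, if_true]
    have h2 : ∫ z, (χ (y + z) + d) ∂gaussianReal 0 v = (∫ z, χ (y + z) ∂gaussianReal 0 v) + d := by
      rw [integral_add (integrable_shift hχ v y) (integrable_const d)]
      simp
    rw [← h2]
    exact integral_mono (integrable_shift hφ v y)
      ((integrable_shift hχ v y).add (integrable_const d)) fun z => h _
  · simp only [gaussOp, if_neg hm.ne']
    rw [div_add' _ _ _ hm.ne']
    refine div_le_div_of_nonneg_right ?_ hm.le
    rw [← Real.log_exp (d * m), ← Real.log_mul (integral_exp_shift_pos hχ v m y).ne'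
      (Real.exp_pos _).ne', ← integral_mul_const]
    refine Real.log_le_log (integral_exp_shift_pos hφ v m y) ?_
    refine integral_mono (integrable_exp_mul_shift hφ v m y)
      ((integrable_exp_mul_shift hχ v m y).mul_const _) fun z => ?_
    simp only [← Real.exp_add]
    refine Real.exp_le_exp.2 ?_
    nlinarith [mul_le_mul_of_nonneg_left (h (y + z)) hm.le]

/-- The operator commutes with translations, and a translate of φ by x - y exceeds φ by at most C|x
- y|. -/
theorem gaussOp_lipschitz (hφ : LipschitzWith C φ) {m : ℝ} (hm : 0 ≤ m) (v : ℝ≥0) :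
    LipschitzWith C (gaussOp m v φ) := by
  refine LipschitzWith.of_le_add_mul C fun x y => ?_
  have ht : LipschitzWith C fun u => φ (u + (x - y)) := by
    refine LipschitzWith.of_dist_le_mul fun a b => ?_
    simpa using hφ.dist_le_mul (a + (x - y)) (b + (x - y))
  have h := gaussOp_le ht hφ hm v (d := C * dist x y) (fun u => by
    have := (le_abs_self _).trans (hφ.abs_sub_le_mul_abs u (x - y))
    rw [Real.dist_eq]
    linarith) y
  refine le_trans (le_of_eq ?_) h
  have e : ∀ z, x + z = y + z + (x - y) := fun z => by ring
  simp only [gaussOp, e]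

theorem gaussianReal_integral_conv {f : ℝ → ℝ} {v w : ℝ≥0}
    (hf : Integrable f (gaussianReal 0 (v + w))) :
    ∫ z, f z ∂gaussianReal 0 (v + w)
      = ∫ z, ∫ u, f (z + u) ∂gaussianReal 0 w ∂gaussianReal 0 v := by
  have h : gaussianReal 0 v ∗ gaussianReal 0 w = gaussianReal 0 (v + w) := by
    simpa using gaussianReal_conv_gaussianReal (m₁ := 0) (m₂ := 0) (v₁ := v) (v₂ := w)
  rw [← h] at hf ⊢
  exact integral_conv hf

/-- Conjugation by φ ↦ e^{mφ} turns the operator into Gaussian convolution, and variances add under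
convolution. -/
theorem gaussOp_gaussOp (hφ : LipschitzWith C φ) {m : ℝ} (hm : 0 ≤ m) (v w : ℝ≥0) :
    gaussOp m v (gaussOp m w φ) = gaussOp m (v + w) φ := by
  funext y
  rcases hm.eq_or_lt with rfl | hm'
  · have := gaussianReal_integral_conv (integrable_shift hφ (v + w) y)
    simp only [gaussOp, if_true, this, add_assoc]
  · have h := gaussianReal_integral_conv (integrable_exp_mul_shift hφ (v + w) m y)
    rw [gaussOp, if_neg hm'.ne']
    simp only [exp_mul_gaussOp hφ hm'.ne']
    simp only [add_assoc] at h ⊢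
    rw [← h, gaussOp, if_neg hm'.ne']

/-- Using `dslope` treats m = 0 together with m ≠ 0: at 0 the slope of the cumulant generating
function is the mean, which is the convention for order zero. -/
theorem gaussOp_eq_dslope (hφ : LipschitzWith C φ) (m : ℝ) (v : ℝ≥0) (y : ℝ) :
    gaussOp m v φ y = φ y + dslope (cgf (fun z => φ (y + z) - φ y) (gaussianReal 0 v)) 0 m := by
  have hφ' : LipschitzWith C fun u => φ u - φ y := by
    refine LipschitzWith.of_dist_le_mul fun a b => ?_
    simpa using hφ.dist_le_mul a b
  have hint : ∀ t, Integrable (fun z => Real.exp (t * (φ (y + z) - φ y))) (gaussianReal 0 v) :=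
    fun t => integrable_exp_mul_shift hφ' v t y
  by_cases hm : m = 0
  · subst hm
    rw [dslope_same, deriv_cgf_zero, integral_sub (integrable_shift hφ v y) (integrable_const _)]
    · simp [gaussOp]
    · have : integrableExpSet (fun z => φ (y + z) - φ y) (gaussianReal 0 v) = univ :=
        eq_univ_of_forall hint
      simp [this]
  · rw [dslope_of_ne _ hm, slope_def_field, cgf_zero, sub_zero, sub_zero, gaussOp, if_neg hm,
      ← mul_div_cancel_left₀ (φ y) hm, ← add_div, cgf, mgf]
    congr 1
    simp only [mul_div_cancel_left₀ (φ y) hm]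
    rw [← Real.log_exp (m * φ y), ← Real.log_mul (Real.exp_pos _).ne'
      (integral_exp_pos (hint m)).ne', ← integral_const_mul]
    simp only [← Real.exp_add]
    congr 3
    funext z
    ring_nf

/-- The second moment factor controlling the dependence of `gaussOp` on its order. -/
def momentRatio (C : ℝ≥0) (r : ℝ) : ℝ :=
  (∫ z, z ^ 2 * Real.exp (C * (r * |z|)) ∂gaussianReal 0 1) /
    ∫ z, Real.exp (-C * (r * |z|)) ∂gaussianReal 0 1

theorem integrable_sq_mul_exp (v : ℝ≥0) (c : ℝ) :
    Integrable (fun z => z ^ 2 * Real.exp (c * |z|)) (gaussianReal 0 v) := by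
  refine ((integrable_exp_mul_abs_gaussianReal v (c + 1)).const_mul 2).mono'
    (Continuous.aestronglyMeasurable (by fun_prop)) (ae_of_all _ fun z => ?_)
  rw [Real.norm_eq_abs, abs_of_nonneg (by positivity), add_mul, Real.exp_add, one_mul]
  have h := Real.quadratic_le_exp_of_nonneg (abs_nonneg z)
  have h2 := sq_abs z
  have h3 : z ^ 2 ≤ 2 * Real.exp |z| := by nlinarith [abs_nonneg z]
  nlinarith [Real.exp_pos (c * |z|)]

theorem tendsto_momentRatio (C : ℝ≥0) : Filter.Tendsto (momentRatio C) (𝓝[≥] 0) (𝓝 1) := by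
  have hle : ∀ᶠ r : ℝ in 𝓝[≥] 0, r ∈ Icc (0 : ℝ) 1 :=
    Icc_mem_nhdsGE zero_lt_one
  have h1 : Filter.Tendsto (fun r => ∫ z, z ^ 2 * Real.exp (C * (r * |z|)) ∂gaussianReal 0 1)
      (𝓝[≥] 0) (𝓝 (∫ z, z ^ 2 * Real.exp (C * (0 * |z|)) ∂gaussianReal 0 1)) := by
    refine tendsto_integral_filter_of_dominated_convergence
      (fun z => z ^ 2 * Real.exp (C * |z|))
      (Filter.Eventually.of_forall fun r => Continuous.aestronglyMeasurable (by fun_prop))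
      ?_ (integrable_sq_mul_exp 1 C) (ae_of_all _ fun z => ?_)
    · filter_upwards [hle] with r hr
      refine ae_of_all _ fun z => ?_
      rw [Real.norm_eq_abs, abs_of_nonneg (by positivity)]
      gcongr
      exact mul_le_of_le_one_left (abs_nonneg z) hr.2
    · have : Continuous fun r : ℝ => z ^ 2 * Real.exp (C * (r * |z|)) := by fun_prop
      exact (this.tendsto 0).mono_left nhdsWithin_le_nhds
  have h2 : Filter.Tendsto (fun r => ∫ z, Real.exp (-C * (r * |z|)) ∂gaussianReal 0 1)
      (𝓝[≥] 0) (𝓝 (∫ z, Real.exp (-C * (0 * |z|)) ∂gaussianReal 0 1)) := by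
    refine tendsto_integral_filter_of_dominated_convergence
      (fun z => 1)
      (Filter.Eventually.of_forall fun r => Continuous.aestronglyMeasurable (by fun_prop))
      ?_ (integrable_const _) (ae_of_all _ fun z => ?_)
    · filter_upwards [hle] with r hr
      refine ae_of_all _ fun z => ?_
      rw [Real.norm_eq_abs, Real.abs_exp]
      refine Real.exp_le_one_iff.2 ?_
      have : 0 ≤ (C : ℝ) * (r * |z|) := mul_nonneg C.2 (mul_nonneg hr.1 (abs_nonneg z))
      linarith
    · have : Continuous fun r : ℝ => Real.exp (-C * (r * |z|)) := by fun_prop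
      exact (this.tendsto 0).mono_left nhdsWithin_le_nhds
  have hsq : ∫ z, z ^ 2 ∂gaussianReal 0 1 = 1 := by
    have := variance_eq_integral (μ := gaussianReal 0 1) (X := fun z : ℝ => z) (by fun_prop)
    rw [variance_fun_id_gaussianReal, integral_id_gaussianReal] at this
    simpa using this.symm
  have := h1.div h2 (by simp)
  simp only [zero_mul, mul_zero, Real.exp_zero, mul_one, hsq, integral_const, probReal_univ,
    smul_eq_mul, div_one] at this
  exact this

theorem integral_gaussianReal_scale (v : ℝ≥0) (f : ℝ → ℝ) (hf : Continuous f) :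
    ∫ z, f z ∂gaussianReal 0 v = ∫ z, f (Real.sqrt v * z) ∂gaussianReal 0 1 := by
  have h := gaussianReal_map_const_mul (μ := 0) (v := 1) (Real.sqrt v)
  have e : (NNReal.mk (Real.sqrt v ^ 2) (sq_nonneg _)) * 1 = v := by
    ext
    simp
  rw [e, mul_zero] at h
  rw [← h, integral_map (by fun_prop) hf.aestronglyMeasurable]

/-- The second derivative of the cumulant generating function is a variance under a tilted law,
hence nonnegative and at most the tilted second moment. That moment is bounded using |φ(y + z) -
φ(y)| ≤ C|z| and a tilt in [0,1]. The constant carries a superfluous factor that tends to 1 for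
small variance. -/
theorem gaussOp_sub_le (hφ : LipschitzWith C φ) {m m' : ℝ} (hm : 0 ≤ m) (hmm : m ≤ m')
    (hm' : m' ≤ 1) (v : ℝ≥0) (y : ℝ) :
    gaussOp m v φ y ≤ gaussOp m' v φ y ∧
    gaussOp m' v φ y - gaussOp m v φ y
      ≤ (C : ℝ) ^ 2 * v * momentRatio C (Real.sqrt v) / 2 * (m' - m) := by
  set X : ℝ → ℝ := fun z => φ (y + z) - φ y with hX
  have hφ' : LipschitzWith C fun u => φ u - φ y := by
    refine LipschitzWith.of_dist_le_mul fun a b => ?_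
    simpa using hφ.dist_le_mul a b
  have hXc : Continuous X := by
    have := hφ.continuous
    fun_prop
  have hint : ∀ t, Integrable (fun z => Real.exp (t * X z)) (gaussianReal 0 v) :=
    fun t => integrable_exp_mul_shift hφ' v t y
  have huniv : integrableExpSet X (gaussianReal 0 v) = univ := eq_univ_of_forall hint
  have hmem : ∀ t, t ∈ interior (integrableExpSet X (gaussianReal 0 v)) := by simp [huniv]
  have han : ∀ t, AnalyticAt ℝ (cgf X (gaussianReal 0 v)) t := fun t => analyticAt_cgf (hmem t)
  rw [gaussOp_eq_dslope hφ m v y, gaussOp_eq_dslope hφ m' v y, add_sub_add_left_eq_sub]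
  simp only [add_le_add_iff_left]
  refine dslope_mem_Icc_of_deriv2_mem (f'' := deriv (deriv (cgf X (gaussianReal 0 v)))) (by simp)
    (fun t => (han t).differentiableAt.hasDerivAt)
    (fun t => (han t).deriv.differentiableAt.hasDerivAt) (fun t ht => ?_) hm hmm hm'
  have e : deriv (deriv (cgf X (gaussianReal 0 v))) t
      = iteratedDeriv 2 (cgf X (gaussianReal 0 v)) t := by
    rw [iteratedDeriv_succ, iteratedDeriv_one]
  rw [e]
  constructor
  · rw [iteratedDeriv_two_cgf_eq_integral (hmem t)]
    exact div_nonneg (integral_nonneg fun z => by positivity) mgf_nonneg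
  · rw [iteratedDeriv_two_cgf (hmem t)]
    refine (sub_le_self _ (sq_nonneg _)).trans ?_
    have hXle : ∀ z, |X z| ≤ C * |z| := fun z => hφ.abs_sub_le_mul_abs y z
    have hnum : ∫ z, X z ^ 2 * Real.exp (t * X z) ∂gaussianReal 0 v ≤
        C ^ 2 * v * ∫ z, z ^ 2 * Real.exp (C * (Real.sqrt v * |z|)) ∂gaussianReal 0 1 := by
      calc ∫ z, X z ^ 2 * Real.exp (t * X z) ∂gaussianReal 0 v
          ≤ ∫ z, C ^ 2 * (z ^ 2 * Real.exp (C * |z|)) ∂gaussianReal 0 v := by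
            refine integral_mono_of_nonneg (ae_of_all _ fun z => by positivity)
              ((integrable_sq_mul_exp v C).const_mul _) (ae_of_all _ fun z => ?_)
            simp only
            rw [← mul_assoc]
            have h1 : X z ^ 2 ≤ C ^ 2 * z ^ 2 := by
              rw [← sq_abs (X z), ← sq_abs z, ← mul_pow]
              exact pow_le_pow_left₀ (abs_nonneg _) (hXle z) 2
            have h2 : t * X z ≤ C * |z| := by
              calc t * X z ≤ t * |X z| := mul_le_mul_of_nonneg_left (le_abs_self _) ht.1
                _ ≤ 1 * |X z| := mul_le_mul_of_nonneg_right ht.2 (abs_nonneg _)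
                _ ≤ C * |z| := by rw [one_mul]; exact hXle z
            gcongr
        _ = _ := by
            rw [integral_const_mul, integral_gaussianReal_scale v _ (by fun_prop), mul_assoc,
              ← integral_const_mul (v : ℝ)]
            congr 2
            funext z
            rw [mul_pow, Real.sq_sqrt v.coe_nonneg, abs_mul, abs_of_nonneg (Real.sqrt_nonneg _), mul_assoc]
    have hden : ∫ z, Real.exp (-C * (Real.sqrt v * |z|)) ∂gaussianReal 0 1 ≤
        mgf X (gaussianReal 0 v) t := by
      have : ∫ z, Real.exp (-C * |z|) ∂gaussianReal 0 v
          = ∫ z, Real.exp (-C * (Real.sqrt v * |z|)) ∂gaussianReal 0 1 := by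
        rw [integral_gaussianReal_scale v _ (by fun_prop)]
        simp only [abs_mul, abs_of_nonneg (Real.sqrt_nonneg _)]
      rw [← this, mgf]
      refine integral_mono (integrable_exp_mul_abs_gaussianReal v (-C)) (hint t) fun z => ?_
      refine Real.exp_le_exp.2 ?_
      have h2 : -(t * X z) ≤ C * |z| := by
        calc -(t * X z) = t * (-X z) := by ring
          _ ≤ t * |X z| := mul_le_mul_of_nonneg_left (neg_le_abs _) ht.1
          _ ≤ 1 * |X z| := mul_le_mul_of_nonneg_right ht.2 (abs_nonneg _)
          _ ≤ C * |z| := by rw [one_mul]; exact hXle z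
      linarith
    have hpos : 0 < ∫ z, Real.exp (-C * (Real.sqrt v * |z|)) ∂gaussianReal 0 1 := by
      refine integral_exp_pos ?_
      have := integrable_exp_mul_abs_gaussianReal 1 (-C * Real.sqrt v)
      simpa only [mul_assoc] using this
    rw [momentRatio, ← mul_div_assoc]
    refine div_le_div₀ ?_ hnum hpos hden
    exact mul_nonneg (by positivity) (integral_nonneg fun z => by positivity)

theorem gaussOp_mono_order (hφ : LipschitzWith C φ) {m m' : ℝ} (hm : 0 ≤ m) (hmm : m ≤ m')
    (hm' : m' ≤ 1) (v : ℝ≥0) (y : ℝ) : gaussOp m v φ y ≤ gaussOp m' v φ y :=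
  (gaussOp_sub_le hφ hm hmm hm' v y).1

theorem gaussOp_iterate (hφ : LipschitzWith C φ) {m : ℝ} (hm : 0 ≤ m) (w : ℝ≥0) (n : ℕ) :
    (gaussOp m w)^[n] φ = gaussOp m (n * w) φ ∧ LipschitzWith C ((gaussOp m w)^[n] φ) := by
  induction n with
  | zero => simpa [gaussOp_zero_var] using hφ
  | succ n ih =>
    rw [Function.iterate_succ_apply', ih.1, gaussOp_gaussOp hφ hm]
    refine ⟨?_, gaussOp_lipschitz hφ hm _⟩
    congr 1
    push_cast
    ring

/-- The factor `momentRatio` is removed by the semigroup property: cut v into n equal pieces, apply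
the crude bound to each, and let n tend to infinity. -/
theorem gaussOp_sub_le_sharp (hφ : LipschitzWith C φ) {m m' : ℝ} (hm : 0 ≤ m) (hmm : m ≤ m')
    (hm' : m' ≤ 1) (v : ℝ≥0) (y : ℝ) :
    gaussOp m' v φ y ≤ gaussOp m v φ y + (C : ℝ) ^ 2 / 2 * (m' - m) * v := by
  have key : ∀ n : ℕ, n ≠ 0 → gaussOp m' v φ y ≤ gaussOp m v φ y +
      (C : ℝ) ^ 2 / 2 * (m' - m) * v * momentRatio C (Real.sqrt (v / n)) := by
    intro n hn
    set w : ℝ≥0 := v / n with hw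
    have hnw : (n : ℝ≥0) * w = v := by
      rw [hw, mul_div_cancel₀]
      exact_mod_cast hn
    -- The cost of changing the order over one piece of variance w = v/n. The n costs add up to C²/2
    -- (m' - m) v times `momentRatio C √(v/n)`.
    set d : ℝ := (C : ℝ) ^ 2 * w * momentRatio C (Real.sqrt w) / 2 * (m' - m) with hd
    have h : ∀ j : ℕ, ∀ y, (gaussOp m' w)^[j] φ y ≤ (gaussOp m w)^[j] φ y + j * d := by
      intro j
      induction j with
      | zero => intro y; simp
      | succ j ih =>
        intro y
        rw [Function.iterate_succ_apply', Function.iterate_succ_apply']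
        have l1 := (gaussOp_iterate hφ (hm.trans hmm) w j).2
        have l2 := (gaussOp_iterate hφ hm w j).2
        -- The accumulated error passes through the operator of order m' without growing; only then
        -- is the order changed in the newest factor.
        have s1 := gaussOp_le l1 l2 (hm.trans hmm) w ih y
        have s2 := (gaussOp_sub_le l2 hm hmm hm' w y).2
        push_cast
        linarith
    have h' := h n y
    rw [(gaussOp_iterate hφ (hm.trans hmm) w n).1, (gaussOp_iterate hφ hm w n).1, hnw] at h'
    refine h'.trans (le_of_eq ?_)
    have hnw' : (n : ℝ) * w = v := by exact_mod_cast hnw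
    have e : (w : ℝ) = v / n := by simp [hw]
    rw [hd, ← e, ← hnw']
    ring
  have hlim : Filter.Tendsto (fun n : ℕ => gaussOp m v φ y +
      (C : ℝ) ^ 2 / 2 * (m' - m) * v * momentRatio C (Real.sqrt (v / n))) Filter.atTop
      (𝓝 (gaussOp m v φ y + (C : ℝ) ^ 2 / 2 * (m' - m) * v * 1)) := by
    refine tendsto_const_nhds.add (tendsto_const_nhds.mul ((tendsto_momentRatio C).comp ?_))
    refine tendsto_nhdsWithin_iff.2 ⟨?_, Filter.Eventually.of_forall fun n => Real.sqrt_nonneg _⟩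
    have := (Real.continuous_sqrt.tendsto 0).comp (tendsto_const_div_atTop_nhds_zero_nat (v : ℝ))
    rwa [Real.sqrt_zero] at this
  rw [mul_one] at hlim
  refine ge_of_tendsto hlim ?_
  filter_upwards [Filter.eventually_ne_atTop 0] with n hn using key n hn

theorem abs_gaussOp_sub_le (hφ : LipschitzWith C φ) (hχ : LipschitzWith C χ) {m m' d : ℝ}
    (hm : m ∈ Icc (0 : ℝ) 1) (hm' : m' ∈ Icc (0 : ℝ) 1) (v : ℝ≥0)
    (h : ∀ y, |φ y - χ y| ≤ d) (y : ℝ) :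
    |gaussOp m v φ y - gaussOp m' v χ y| ≤ d + (C : ℝ) ^ 2 / 2 * (|m - m'| * v) := by
  have a1 := gaussOp_le hφ hχ hm.1 v (fun y => by linarith [(abs_le.1 (h y)).2] :
    ∀ y, φ y ≤ χ y + d) y
  have a2 := gaussOp_le hχ hφ hm.1 v (fun y => by linarith [(abs_le.1 (h y)).1] :
    ∀ y, χ y ≤ φ y + d) y
  have b : |gaussOp m v χ y - gaussOp m' v χ y| ≤ (C : ℝ) ^ 2 / 2 * (|m - m'| * v) := by
    rcases le_total m m' with hmm | hmm
    · have := gaussOp_sub_le_sharp hχ hm.1 hmm hm'.2 v y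
      have := gaussOp_mono_order hχ hm.1 hmm hm'.2 v y
      rw [abs_sub_comm, abs_of_nonneg (by linarith), abs_sub_comm, abs_of_nonneg (by linarith)]
      linarith
    · have := gaussOp_sub_le_sharp hχ hm'.1 hmm hm.2 v y
      have := gaussOp_mono_order hχ hm'.1 hmm hm.2 v y
      rw [abs_of_nonneg (by linarith), abs_of_nonneg (by linarith)]
      linarith
  rw [abs_le] at b ⊢
  constructor <;> linarith [b.1, b.2]

end Operator


/-! ### The Parisi recursion -/

/-- The Parisi recursion started from `ψ`, for the positions `q` and the orders `x`. -/
def recursion (ψ g : ℝ → ℝ) : (k : ℕ) → (Fin (k + 1) → ℝ) → (Fin (k + 1) → ℝ) → ℝ → ℝ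
  | 0, _, _ => ψ
  | k + 1, q, x =>
    gaussOp (x 0) (g (q 1) - g (q 0)).toNNReal (recursion ψ g k (Fin.tail q) (Fin.tail x))

/-- The value of the Parisi functional at an atomic measure. -/
def parisi (ψ g : ℝ → ℝ) (a : Atomic) : ℝ :=
  gaussOp 0 (g (a.q 0) - g 0).toNNReal (recursion ψ g a.k a.q a.x) 0

theorem recursion_lipschitz {ψ : ℝ → ℝ} {C : ℝ≥0} (hψ : LipschitzWith C ψ) (g : ℝ → ℝ) :
    ∀ (k : ℕ) (q x : Fin (k + 1) → ℝ), (∀ i, 0 ≤ x i) → LipschitzWith C (recursion ψ g k q x)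
  | 0, _, _, _ => hψ
  | k + 1, _, _, hx =>
    gaussOp_lipschitz (recursion_lipschitz hψ g k _ _ fun i => hx i.succ) (hx 0) _

/-- `V s` is the solution at time `s` of the Parisi evolution with terminal value `ψ` at time `1`
and orders given by the piecewise constant function `x`. -/
structure IsEvolution (C : ℝ≥0) (ψ g x : ℝ → ℝ) (s₀ : ℝ) (V : ℝ → ℝ → ℝ) : Prop where
  terminal : V 1 = ψ
  lipschitz : ∀ s ∈ Icc s₀ 1, LipschitzWith C (V s)
  step : ∀ s t, s₀ ≤ s → s ≤ t → t ≤ 1 → (∀ u ∈ Ico s t, x u = x s) →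
    V s = gaussOp (x s) (g t - g s).toNNReal (V t)

/-- The recursion only knows the values at the positions q. Interpolating to all times, with a step
rule for every interval on which the order is constant, allows two evolutions with different
positions to be compared on a common partition. Positions may coincide, since 0 will be prepended to
positions that may already contain it. -/
theorem exists_isEvolution {ψ g : ℝ → ℝ} {C : ℝ≥0} (hψ : LipschitzWith C ψ)
    (hg : MonotoneOn g (Icc 0 1)) {x : ℝ → ℝ} :
    ∀ (k : ℕ) (q X : Fin (k + 1) → ℝ), Monotone q → 0 ≤ q 0 → q (Fin.last k) = 1 →
      (∀ i, 0 ≤ X i) →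
      (∀ i : Fin k, ∀ u ∈ Ico (q i.castSucc) (q i.succ), x u = X i.castSucc) →
      ∃ V, IsEvolution C ψ g x (q 0) V ∧ V (q 0) = recursion ψ g k q X := by
  intro k
  induction k with
  | zero =>
    intro q X _ _ hq1 _ _
    have hq1' : q 0 = 1 := hq1
    refine ⟨fun _ => ψ, ⟨rfl, fun _ _ => hψ, fun s t h1 h2 h3 _ => ?_⟩, rfl⟩
    have : s = t := by linarith
    subst this
    rw [sub_self, Real.toNNReal_zero, gaussOp_zero_var]
  | succ k ih =>
    intro q X hq hq0 hq1 hX hx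
    have hq01 : q 0 ≤ q 1 := hq (Fin.zero_le _)
    have hq11 : q 1 ≤ 1 := hq1 ▸ hq (Fin.le_last _)
    obtain ⟨V, hV, hV0⟩ := ih (Fin.tail q) (Fin.tail X) (fun i j h => hq (Fin.succ_le_succ_iff.2 h))
      (hq0.trans hq01) hq1 (fun i => hX i.succ) (fun i => hx i.succ)
    have ht0 : Fin.tail q 0 = q 1 := rfl
    rw [ht0] at hV hV0
    set R := recursion ψ g k (Fin.tail q) (Fin.tail X) with hR
    have hRl : LipschitzWith C R := recursion_lipschitz hψ g _ _ _ fun i => hX i.succ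
    have hadd : ∀ s t u, 0 ≤ s → s ≤ t → t ≤ u → u ≤ 1 →
        (g t - g s).toNNReal + (g u - g t).toNNReal = (g u - g s).toNNReal := by
      intro s t u h1 h2 h3 h4
      rw [← Real.toNNReal_add]
      · congr 1; ring
      · exact sub_nonneg.2 (hg ⟨h1, by linarith⟩ ⟨by linarith, by linarith⟩ h2)
      · exact sub_nonneg.2 (hg ⟨by linarith, by linarith⟩ ⟨by linarith, by linarith⟩ h3)
    have hx0 : ∀ u, q 0 ≤ u → u < q 1 → x u = X 0 := fun u h1 h2 => hx 0 u ⟨h1, h2⟩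
    refine ⟨fun s => if s < q 1 then gaussOp (X 0) (g (q 1) - g s).toNNReal R else V s,
      ⟨?_, ?_, ?_⟩, ?_⟩
    · simp [not_lt.2 hq11, hV.terminal]
    · intro s hs
      split_ifs with h
      · exact gaussOp_lipschitz hRl (hX 0) _
      · exact hV.lipschitz s ⟨not_lt.1 h, hs.2⟩
    · intro s t h1 h2 h3 hc
      by_cases hs : s < q 1
      · simp only [if_pos hs]
        rw [hx0 s h1 hs]
        by_cases ht : t < q 1
        · simp only [if_pos ht]
          rw [gaussOp_gaussOp hRl (hX 0), hadd s t _ (hq0.trans h1) h2 ht.le hq11]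
        · simp only [if_neg ht]
          rw [not_lt] at ht
          -- The interval crosses q 1. If it extends strictly beyond, constancy of the order forces
          -- the value X 0 there too, and the operators before and after q 1 compose.
          have hc' : ∀ u ∈ Ico (q 1) t, x u = X 0 := fun u hu => by
            rw [hc u ⟨hs.le.trans hu.1, hu.2⟩, hx0 s h1 hs]
          rcases ht.eq_or_lt with rfl | ht'
          · rw [hV0]
          · have e1 : x (q 1) = X 0 := hc' _ ⟨le_rfl, ht'⟩
            have := hV.step (q 1) t le_rfl ht h3 fun u hu => by rw [hc' u hu, e1]
            rw [hV0, e1] at this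
            rw [this, gaussOp_gaussOp (hV.lipschitz t ⟨ht, h3⟩) (hX 0),
              hadd s _ t (hq0.trans h1) hs.le ht h3]
      · have hs' := not_lt.1 hs
        simp only [if_neg hs, if_neg (not_lt.2 (hs'.trans h2))]
        exact hV.step s t hs' h2 h3 hc
    · by_cases h : q 0 < q 1
      · simp only [if_pos h]
        rfl
      -- Here q 0 = q 1: the first operator has variance zero and is the identity.
      · simp only [if_neg h]
        have e : q 0 = q 1 := le_antisymm hq01 (not_lt.1 h)
        rw [recursion, e, hV0, sub_self, Real.toNNReal_zero, gaussOp_zero_var]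

/-! ### The weight measure -/

section Weight

variable {g : ℝ → ℝ}

theorem continuousOn_derivWithin_unit (hg : ContDiffOn ℝ 1 g (Icc 0 1)) :
    ContinuousOn (derivWithin g (Icc 0 1)) (Icc 0 1) :=
  hg.continuousOn_derivWithin (uniqueDiffOn_Icc zero_lt_one) le_rfl

theorem derivWithin_unit_nonneg (hm : StrictMonoOn g (Icc 0 1)) (q : ℝ) :
    0 ≤ derivWithin g (Icc 0 1) q :=
  hm.monotoneOn.derivWithin_nonneg

/-- By the fundamental theorem of calculus, the weight of an interval is the Gaussian variance spent
there by the evolution. -/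
theorem weight_Ioc (hg : ContDiffOn ℝ 1 g (Icc 0 1)) (hm : StrictMonoOn g (Icc 0 1))
    {s t : ℝ} (hs : 0 ≤ s) (hst : s ≤ t) (ht : t ≤ 1) :
    weight g (Ioc s t) = ENNReal.ofReal (g t - g s) := by
  have hsub : Icc s t ⊆ Icc 0 1 := Icc_subset_Icc hs ht
  have hcd : ContinuousOn (derivWithin g (Icc 0 1)) (Icc s t) :=
    (continuousOn_derivWithin_unit hg).mono hsub
  have hint : IntervalIntegrable (derivWithin g (Icc 0 1)) volume s t :=
    hcd.intervalIntegrable_of_Icc hst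
  have h1 : ∫ u in s..t, derivWithin g (Icc 0 1) u = g t - g s := by
    refine intervalIntegral.integral_eq_sub_of_hasDerivAt_of_le hst (hg.continuousOn.mono hsub)
      (fun u hu => ?_) hint
    have hu' : u ∈ Ioo (0 : ℝ) 1 := ⟨hs.trans_lt hu.1, hu.2.trans_le ht⟩
    exact ((hg.differentiableOn one_ne_zero) u
      ⟨hu'.1.le, hu'.2.le⟩).hasDerivWithinAt.hasDerivAt (Icc_mem_nhds hu'.1 hu'.2)
  rw [weight, withDensity_apply _ measurableSet_Ioc, Measure.restrict_restrict measurableSet_Ioc,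
    inter_eq_self_of_subset_left (Ioc_subset_Icc_self.trans hsub), ← h1,
    intervalIntegral.integral_of_le hst]
  exact (ofReal_integral_eq_lintegral_ofReal ((intervalIntegrable_iff_integrableOn_Ioc_of_le hst).1
    hint) (ae_of_all _ (derivWithin_unit_nonneg hm))).symm

instance nullSingleton_weight : NullSingletonClass (weight g) := by
  unfold weight; infer_instance

theorem weight_compl : weight g (Ioc 0 1)ᶜ = 0 := by
  have h : weight g (Icc 0 1)ᶜ = 0 := by
    refine withDensity_absolutelyContinuous _ _ ?_
    rw [Measure.restrict_apply measurableSet_Icc.compl]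
    simp
  have h2 : (Ioc (0 : ℝ) 1)ᶜ ⊆ (Icc 0 1)ᶜ ∪ {0} := by
    intro u hu
    by_cases h0 : u = 0
    · exact Or.inr h0
    · refine Or.inl fun h => hu ⟨lt_of_le_of_ne h.1 (Ne.symm h0), h.2⟩
  exact measure_mono_null h2 (measure_union_null h (measure_singleton 0))

theorem restrict_weight : (weight g).restrict (Ioc 0 1) = weight g :=
  Measure.restrict_eq_self_of_ae_mem (mem_ae_iff.2 weight_compl)

theorem isFiniteMeasure_weight (hg : ContDiffOn ℝ 1 g (Icc 0 1))
    (hm : StrictMonoOn g (Icc 0 1)) : IsFiniteMeasure (weight g) := by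
  constructor
  rw [← restrict_weight, Measure.restrict_apply_univ, weight_Ioc hg hm le_rfl zero_le_one le_rfl]
  exact ENNReal.ofReal_lt_top

end Weight

theorem distFun_mem (μ : ProbI) (q : ℝ) : distFun μ q ∈ Icc (0 : ℝ) 1 :=
  ⟨measureReal_nonneg, measureReal_le_one⟩

theorem measurable_distFun (μ : ProbI) : Measurable (distFun μ) :=
  (monotone_distFun μ).measurable

theorem integrable_distFun_sub {m : Measure ℝ} [IsFiniteMeasure m] (μ ν : ProbI) :
    Integrable (fun q => |distFun μ q - distFun ν q|) m := by
  refine Integrable.of_bound (((measurable_distFun μ).sub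
    (measurable_distFun ν)).abs.aestronglyMeasurable) 1 (ae_of_all _ fun q => ?_)
  have h1 := distFun_mem μ q
  have h2 := distFun_mem ν q
  rw [Real.norm_eq_abs, abs_abs, abs_le]
  constructor <;> linarith [h1.1, h1.2, h2.1, h2.2]

theorem l1Dist_eq (g : ℝ → ℝ) (μ ν : ProbI) :
    l1Dist g μ ν = ∫⁻ q, ENNReal.ofReal |distFun μ q - distFun ν q| ∂weight g := by
  rw [l1Dist, eLpNorm_one_eq_lintegral_enorm]
  simp only [Real.enorm_eq_ofReal_abs]

theorem l1Dist_toReal {g : ℝ → ℝ} (μ ν : ProbI) :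
    (l1Dist g μ ν).toReal = ∫ q in (0)..1, |distFun μ q - distFun ν q| ∂weight g := by
  rw [l1Dist_eq, intervalIntegral.integral_of_le zero_le_one, restrict_weight,
    integral_eq_lintegral_of_nonneg_ae (ae_of_all _ fun _ => abs_nonneg _)]
  exact ((measurable_distFun μ).sub (measurable_distFun ν)).abs.aestronglyMeasurable

/-! ### Comparison of two evolutions -/

/-- Backward induction over a finite partition, on the number of breakpoints strictly between s and
1. -/
theorem evolution_induction {Q : Finset ℝ} {p : ℝ → Prop} (h1 : p 1)
    (hstep : ∀ s t, 0 ≤ s → s ≤ t → t ≤ 1 → (∀ u ∈ Q, u ≤ s ∨ t ≤ u) → p t → p s) :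
    ∀ s ∈ Icc (0 : ℝ) 1, p s := by
  have key : ∀ n : ℕ, ∀ s ∈ Icc (0 : ℝ) 1, (Q.filter fun u => s < u ∧ u < 1).card = n → p s := by
    intro n
    induction n using Nat.strong_induction_on with
    | _ n ih =>
      intro s hs hn
      by_cases hne : (Q.filter fun u => s < u ∧ u < 1).Nonempty
      -- The next breakpoint after s; no element of Q lies strictly between s and t, and t has fewer
      -- breakpoints ahead of it.
      · set t := (Q.filter fun u => s < u ∧ u < 1).min' hne with ht
        have htm := Finset.min'_mem _ hne
        rw [← ht, Finset.mem_filter] at htm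
        refine hstep s t hs.1 htm.2.1.le htm.2.2.le (fun u hu => ?_) ?_
        · by_contra! h
          have : t ≤ u := Finset.min'_le _ _ (Finset.mem_filter.2 ⟨hu, h.1, h.2.trans htm.2.2⟩)
          linarith [h.2]
        · refine ih _ ?_ t ⟨hs.1.trans htm.2.1.le, htm.2.2.le⟩ rfl
          rw [← hn]
          refine Finset.card_lt_card (Finset.ssubset_iff_of_subset ?_ |>.2 ⟨t, ?_, ?_⟩)
          · intro u hu
            rw [Finset.mem_filter] at hu ⊢
            exact ⟨hu.1, htm.2.1.trans hu.2.1, hu.2.2⟩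
          · exact Finset.mem_filter.2 htm
          · simp
      · refine hstep s 1 hs.1 hs.2 le_rfl (fun u hu => ?_) h1
        by_contra! h
        exact hne ⟨u, Finset.mem_filter.2 ⟨hu, h⟩⟩
  exact fun s hs => key _ s hs rfl

/-! ### Distribution functions and evolutions of atomic measures -/

section Atomic

variable (a : Atomic)

theorem distFun_toProbI (s : ℝ) :
    distFun a.toProbI s = ∑ i, if a.q i ≤ s then a.mass i else 0 := by
  have hm : MeasurableSet {t : unitInterval | (t : ℝ) ≤ s} :=
    measurableSet_le measurable_subtype_coe measurable_const
  rw [distFun, measureReal_def]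
  change (((∑ i, ENNReal.ofReal (a.mass i) •
    Measure.dirac (⟨a.q i, a.q_mem i⟩ : unitInterval) : Measure unitInterval)) _).toReal = _
  rw [Measure.coe_finsetSum, Finset.sum_apply, ENNReal.toReal_sum]
  · refine Finset.sum_congr rfl fun i _ => ?_
    rw [Measure.smul_apply, Measure.dirac_apply' _ hm, smul_eq_mul]
    by_cases h : a.q i ≤ s
    · simp [h, a.mass_nonneg i]
    · simp [h]
  · intro i _
    rw [Measure.smul_apply, Measure.dirac_apply' _ hm, smul_eq_mul]
    by_cases h : a.q i ≤ s <;> simp [h]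

theorem sum_mass_Iic (i : Fin (a.k + 1)) : ∑ j ∈ Finset.Iic i, a.mass j = a.x i := by
  induction i using Fin.induction with
  | zero =>
    have : Finset.Iic (0 : Fin (a.k + 1)) = {0} := by
      ext j
      simp
    rw [this, Finset.sum_singleton]
    simp [Atomic.mass]
  | succ i ih =>
    have : Finset.Iic i.succ = insert i.succ (Finset.Iic i.castSucc) := by
      ext j
      simp only [Finset.mem_Iic, Finset.mem_insert, Fin.le_def, Fin.ext_iff, Fin.val_succ,
        Fin.val_castSucc]
      omega
    rw [this, Finset.sum_insert (by simp [Fin.le_def]), ih, Atomic.mass, ← Fin.succ_castSucc,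
      Fin.cons_succ]
    ring

theorem distFun_toProbI_of_mem (i : Fin a.k) {s : ℝ}
    (hs : s ∈ Ico (a.q i.castSucc) (a.q i.succ)) : distFun a.toProbI s = a.x i.castSucc := by
  rw [distFun_toProbI, ← sum_mass_Iic, ← Finset.sum_filter]
  congr 1
  ext j
  simp only [Finset.mem_filter, Finset.mem_univ, true_and, Finset.mem_Iic]
  constructor
  · intro h
    have := a.q_mono.lt_iff_lt.1 (h.trans_lt hs.2)
    rw [Fin.lt_def] at this
    rw [Fin.le_def]
    simp at this ⊢
    omega
  · exact fun h => (a.q_mono.monotone h).trans hs.1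

theorem distFun_toProbI_of_lt {s : ℝ} (hs : s < a.q 0) : distFun a.toProbI s = 0 := by
  rw [distFun_toProbI]
  refine Finset.sum_eq_zero fun i _ => if_neg ?_
  exact not_le.2 (hs.trans_le (a.q_mono.monotone (Fin.zero_le i)))

theorem distFun_toProbI_const {s t : ℝ} (h : ∀ i, a.q i ≤ s ∨ t ≤ a.q i) :
    ∀ u ∈ Ico s t, distFun a.toProbI u = distFun a.toProbI s := by
  intro u hu
  rw [distFun_toProbI, distFun_toProbI]
  refine Finset.sum_congr rfl fun i _ => ?_
  rcases h i with h | h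
  · rw [if_pos h, if_pos (h.trans hu.1)]
  · rw [if_neg (not_le.2 (hu.2.trans_le h)), if_neg (not_le.2 ((hu.1.trans_lt hu.2).trans_le h))]

theorem Atomic.x_nonneg (i : Fin (a.k + 1)) : 0 ≤ a.x i :=
  a.x_pos.le.trans (a.x_mono.monotone (Fin.zero_le i))

variable {ψ g : ℝ → ℝ} {C : ℝ≥0}

theorem exists_isEvolution_atomic (hψ : LipschitzWith C ψ) (hg : MonotoneOn g (Icc 0 1)) :
    ∃ V, IsEvolution C ψ g (distFun a.toProbI) 0 V ∧ V 0 0 = parisi ψ g a := by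
  have h1 : Monotone (Fin.cons 0 a.q : Fin (a.k + 1 + 1) → ℝ) := by
    intro i j hij
    induction i using Fin.cases with
    | zero =>
      induction j using Fin.cases with
      | zero => simp
      | succ j => simpa using (a.q_mem j).1
    | succ i =>
      induction j using Fin.cases with
      | zero => simp at hij
      | succ j => simpa using a.q_mono.monotone (Fin.succ_le_succ_iff.1 hij)
  have h2 : (Fin.cons 0 a.q : Fin (a.k + 1 + 1) → ℝ) (Fin.last (a.k + 1)) = 1 := by
    rw [← Fin.succ_last, Fin.cons_succ, a.q_last]
  have h3 : ∀ i, 0 ≤ (Fin.cons 0 a.x : Fin (a.k + 1 + 1) → ℝ) i := by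
    intro i
    induction i using Fin.cases with
    | zero => simp
    | succ i => simpa using a.x_nonneg i
  -- Position 0 with order 0 is prepended: below the first atom the distribution function vanishes,
  -- and the corresponding operator is the plain Gaussian average in `parisi`.
  obtain ⟨V, hV, hV0⟩ := exists_isEvolution hψ hg (x := distFun a.toProbI) (a.k + 1)
    (Fin.cons 0 a.q) (Fin.cons 0 a.x) h1 le_rfl h2 h3 (by
      intro i u hu
      induction i using Fin.cases with
      | zero => exact distFun_toProbI_of_lt a hu.2
      | succ i =>
        rw [← Fin.succ_castSucc, Fin.cons_succ, Fin.cons_succ] at hu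
        rw [← Fin.succ_castSucc, Fin.cons_succ]
        exact distFun_toProbI_of_mem a i hu)
  exact ⟨V, hV, by rw [← Fin.cons_zero (α := fun _ => ℝ) 0 a.q, hV0]; rfl⟩

theorem parisi_lipschitz (hψ : LipschitzWith C ψ) (hg : ContDiffOn ℝ 1 g (Icc 0 1))
    (hm : StrictMonoOn g (Icc 0 1)) (a b : Atomic) :
    |parisi ψ g a - parisi ψ g b| ≤
      (C : ℝ) ^ 2 / 2 * (l1Dist g a.toProbI b.toProbI).toReal := by
  obtain ⟨V, hV, hVa⟩ := exists_isEvolution_atomic a hψ hm.monotoneOn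
  obtain ⟨W, hW, hWb⟩ := exists_isEvolution_atomic b hψ hm.monotoneOn
  have := isFiniteMeasure_weight hg hm
  set x := distFun a.toProbI
  set y := distFun b.toProbI
  have hint : ∀ s t, IntervalIntegrable (fun u => |x u - y u|) (weight g) s t := fun s t =>
    (integrable_distFun_sub _ _).intervalIntegrable
  -- The bound is propagated backwards, uniformly in space, with the L¹-distance restricted to the
  -- times after s. The breakpoints are the atoms of both measures.
  have key := evolution_induction (Q := Finset.univ.image a.q ∪ Finset.univ.image b.q)
    (p := fun s => ∀ z, |V s z - W s z| ≤
      (C : ℝ) ^ 2 / 2 * ∫ u in s..1, |x u - y u| ∂weight g) ?_ ?_ 0 (left_mem_Icc.2 zero_le_one) 0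
  · rwa [hVa, hWb, ← l1Dist_toReal] at key
  · intro z
    simp [hV.terminal, hW.terminal]
  · intro s t hs hst ht hQ ih z
    have cx : ∀ u ∈ Ico s t, x u = x s :=
      distFun_toProbI_const a fun i => hQ _ (Finset.mem_union_left _ (by simp))
    have cy : ∀ u ∈ Ico s t, y u = y s :=
      distFun_toProbI_const b fun i => hQ _ (Finset.mem_union_right _ (by simp))
    rw [hV.step s t hs hst ht cx, hW.step s t hs hst ht cy]
    have ht0 : t ∈ Icc (0 : ℝ) 1 := ⟨hs.trans hst, ht⟩
    have hb := abs_gaussOp_sub_le (hV.lipschitz t ht0) (hW.lipschitz t ht0)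
      (distFun_mem a.toProbI s) (distFun_mem b.toProbI s) (g t - g s).toNNReal ih z
    have hgle : 0 ≤ g t - g s := sub_nonneg.2 (hm.monotoneOn ⟨hs, hst.trans ht⟩ ht0 hst)
    -- Both orders are constant on [s, t), so the error of one step is exactly C²/2 times the
    -- L¹-distance over that interval.
    have hi : ∫ u in s..t, |x u - y u| ∂weight g = |x s - y s| * (g t - g s) := by
      rw [intervalIntegral.integral_of_le hst, ← setIntegral_congr_set Ico_ae_eq_Ioc,
        setIntegral_congr_fun (g := fun _ => |x s - y s|) measurableSet_Ico
          (fun u hu => by simp only; rw [cx u hu, cy u hu]), setIntegral_const,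
        measureReal_def, measure_congr Ico_ae_eq_Ioc, weight_Ioc hg hm hs hst ht,
        ENNReal.toReal_ofReal hgle, smul_eq_mul, mul_comm]
    rw [← intervalIntegral.integral_add_adjacent_intervals (hint s t) (hint t 1), hi]
    refine hb.trans (le_of_eq ?_)
    rw [Real.coe_toNNReal _ hgle]
    ring

theorem parisi_mono (hψ : LipschitzWith C ψ) (hm : StrictMonoOn g (Icc 0 1)) {a b : Atomic}
    (h : Dominates a.toProbI b.toProbI) : parisi ψ g b ≤ parisi ψ g a := by
  obtain ⟨V, hV, hVa⟩ := exists_isEvolution_atomic a hψ hm.monotoneOn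
  obtain ⟨W, hW, hWb⟩ := exists_isEvolution_atomic b hψ hm.monotoneOn
  have key := evolution_induction (Q := Finset.univ.image a.q ∪ Finset.univ.image b.q)
    (p := fun s => ∀ z, W s z ≤ V s z) ?_ ?_ 0 (left_mem_Icc.2 zero_le_one) 0
  · rwa [hVa, hWb] at key
  · intro z
    rw [hV.terminal, hW.terminal]
  · intro s t hs hst ht hQ ih z
    have cx := distFun_toProbI_const a fun i => hQ _ (Finset.mem_union_left _ (by simp))
    have cy := distFun_toProbI_const b fun i => hQ _ (Finset.mem_union_right _ (by simp))
    rw [hV.step s t hs hst ht cx, hW.step s t hs hst ht cy]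
    have ht0 : t ∈ Icc (0 : ℝ) 1 := ⟨hs.trans hst, ht⟩
    -- First the order is raised with the function W fixed, then W is replaced by the larger V.
    have h1 := gaussOp_mono_order (hW.lipschitz t ht0) (distFun_mem b.toProbI s).1
      (h s ⟨hs, hst.trans ht⟩) (distFun_mem a.toProbI s).2 (g t - g s).toNNReal z
    have h2 := gaussOp_le (hW.lipschitz t ht0) (hV.lipschitz t ht0) (distFun_mem a.toProbI s).1
      (g t - g s).toNNReal (d := 0) (fun y => by simpa using ih y) z
    linarith

end Atomic


/-! ### The `L¹`-distance and the weak topology -/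

theorem distFun_eq_cdf (μ : ProbI) (q : ℝ) :
    distFun μ q = cdf ((μ : Measure unitInterval).map ((↑) : unitInterval → ℝ)) q := by
  have : IsProbabilityMeasure ((μ : Measure unitInterval).map ((↑) : unitInterval → ℝ)) :=
    Measure.isProbabilityMeasure_map measurable_subtype_coe.aemeasurable
  rw [cdf_eq_real, distFun, map_measureReal_apply measurable_subtype_coe measurableSet_Iic]
  rfl

theorem distFun_of_one_le (μ : ProbI) {q : ℝ} (hq : 1 ≤ q) : distFun μ q = 1 := by
  have : {t : unitInterval | (t : ℝ) ≤ q} = univ := eq_univ_of_forall fun t => t.2.2.trans hq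
  rw [distFun, this, probReal_univ]

theorem distFun_of_neg (μ : ProbI) {q : ℝ} (hq : q < 0) : distFun μ q = 0 := by
  have : {t : unitInterval | (t : ℝ) ≤ q} = ∅ :=
    eq_empty_of_forall_notMem fun t ht => absurd (t.2.1.trans ht) (not_le.2 hq)
  rw [distFun, this, measureReal_empty]

theorem distFun_injective {μ ν : ProbI} (h : ∀ q ∈ Ico (0 : ℝ) 1, distFun μ q = distFun ν q) :
    μ = ν := by
  have h1 : IsProbabilityMeasure ((μ : Measure unitInterval).map ((↑) : unitInterval → ℝ)) :=
    Measure.isProbabilityMeasure_map measurable_subtype_coe.aemeasurable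
  have h2 : IsProbabilityMeasure ((ν : Measure unitInterval).map ((↑) : unitInterval → ℝ)) :=
    Measure.isProbabilityMeasure_map measurable_subtype_coe.aemeasurable
  have key : (μ : Measure unitInterval).map ((↑) : unitInterval → ℝ)
      = (ν : Measure unitInterval).map ((↑) : unitInterval → ℝ) := by
    refine Measure.eq_of_cdf _ _ ?_
    ext q
    rw [← distFun_eq_cdf, ← distFun_eq_cdf]
    rcases lt_or_ge q 0 with h0 | h0
    · rw [distFun_of_neg μ h0, distFun_of_neg ν h0]
    · rcases lt_or_ge q 1 with h3 | h3
      · exact h q ⟨h0, h3⟩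
      · rw [distFun_of_one_le μ h3, distFun_of_one_le ν h3]
  refine Subtype.ext ?_
  have he : MeasurableEmbedding ((↑) : unitInterval → ℝ) :=
    MeasurableEmbedding.subtype_coe measurableSet_Icc
  exact he.map_injective key

section Topology

variable {g : ℝ → ℝ}

theorem l1Dist_ne_top (hg : ContDiffOn ℝ 1 g (Icc 0 1)) (hm : StrictMonoOn g (Icc 0 1))
    (μ ν : ProbI) : l1Dist g μ ν ≠ ∞ := by
  have := isFiniteMeasure_weight hg hm
  rw [l1Dist_eq]
  exact ((integrable_distFun_sub μ ν).lintegral_lt_top).ne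

/-- Since g is strictly increasing, every interval to the right of q < 1 has positive weight and
contains a point where the two distribution functions agree; right continuity carries the equality
to q. -/
theorem eq_of_l1Dist_eq_zero (hg : ContDiffOn ℝ 1 g (Icc 0 1)) (hm : StrictMonoOn g (Icc 0 1))
    {μ ν : ProbI} (h : l1Dist g μ ν = 0) : μ = ν := by
  rw [l1Dist_eq, lintegral_eq_zero_iff (by
    exact ((measurable_distFun μ).sub (measurable_distFun ν)).abs.ennreal_ofReal)] at h
  refine distFun_injective fun q hq => ?_
  have hfreq : ∃ᶠ u in 𝓝[>] q, distFun μ u = distFun ν u := by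
    rw [Filter.frequently_iff]
    intro U hU
    obtain ⟨t, ht, htU⟩ := mem_nhdsGT_iff_exists_Ioc_subset.1 hU
    have ht' : q < min t 1 := lt_min ht hq.2
    have hpos : weight g (Ioc q (min t 1)) ≠ 0 := by
      rw [weight_Ioc hg hm hq.1 ht'.le (min_le_right _ _)]
      simpa using hm ⟨hq.1, hq.2.le⟩ ⟨hq.1.trans ht'.le, min_le_right _ _⟩ ht'
    have hne : (weight g).restrict (Ioc q (min t 1)) ≠ 0 := by
      rwa [Ne, Measure.restrict_eq_zero]
    have : (ae ((weight g).restrict (Ioc q (min t 1)))).NeBot := ae_neBot.2 hne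
    have hae : ∀ᵐ u ∂(weight g).restrict (Ioc q (min t 1)),
        ENNReal.ofReal |distFun μ u - distFun ν u| = 0 ∧ u ∈ Ioc q (min t 1) :=
      (ae_restrict_of_ae h).and (ae_restrict_mem measurableSet_Ioc)
    obtain ⟨u, hu1, hu2⟩ := hae.exists
    refine ⟨u, htU ⟨hu2.1, hu2.2.trans (min_le_left _ _)⟩, ?_⟩
    simpa [sub_eq_zero] using hu1
  have hrc : ∀ μ : ProbI, Filter.Tendsto (distFun μ) (𝓝[>] q) (𝓝 (distFun μ q)) := fun μ => by
    have := (cdf ((μ : Measure unitInterval).map ((↑) : unitInterval → ℝ))).right_continuous q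
    have h2 := this.tendsto.mono_left (nhdsWithin_mono q Ioi_subset_Ici_self)
    rw [← distFun_eq_cdf] at h2
    exact h2.congr fun u => (distFun_eq_cdf μ u).symm
  by_contra hne
  have hev : ∀ᶠ u in 𝓝[>] q, distFun μ u ≠ distFun ν u :=
    ((hrc μ).prodMk_nhds (hrc ν)).eventually
      ((isClosed_diagonal.isOpen_compl).mem_nhds (by simpa using hne))
  exact hfreq hev

/-- A monotone function has countably many jumps, and the weight has no atoms. -/
theorem ae_continuousAt_distFun (μ : ProbI) : ∀ᵐ q ∂weight g, ContinuousAt (distFun μ) q := by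
  rw [ae_iff]
  exact (monotone_distFun μ).countable_not_continuousAt.measure_zero _

theorem tendsto_l1Dist_of_ae {ι : Type*} {l : Filter ι} [l.IsCountablyGenerated]
    (hg : ContDiffOn ℝ 1 g (Icc 0 1)) (hm : StrictMonoOn g (Icc 0 1)) {ν : ι → ProbI} {μ : ProbI}
    (h : ∀ᵐ q ∂weight g, Filter.Tendsto (fun i => distFun (ν i) q) l (𝓝 (distFun μ q))) :
    Filter.Tendsto (fun i => l1Dist g (ν i) μ) l (𝓝 0) := by
  have := isFiniteMeasure_weight hg hm
  simp only [l1Dist_eq]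
  rw [← lintegral_zero (μ := weight g)]
  refine tendsto_lintegral_filter_of_dominated_convergence (fun _ => 1)
    (Filter.Eventually.of_forall fun i =>
      ((measurable_distFun _).sub (measurable_distFun _)).abs.ennreal_ofReal)
    (Filter.Eventually.of_forall fun i => ae_of_all _ fun q => ?_) ?_ ?_
  · have h1 := distFun_mem (ν i) q
    have h2 := distFun_mem μ q
    rw [ENNReal.ofReal_le_one, abs_le]
    constructor <;> linarith [h1.1, h1.2, h2.1, h2.2]
  · simp
  · filter_upwards [h] with q hq
    have := ENNReal.tendsto_ofReal ((hq.sub_const (distFun μ q)).abs)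
    simpa using this

theorem tendsto_distFun_nhds {μ : ProbI} {q : ℝ} (hq : ContinuousAt (distFun μ) q) :
    Filter.Tendsto (fun ν : ProbI => distFun ν q) (𝓝 μ) (𝓝 (distFun μ q)) := by
  -- The frontier is contained in {q}, whose mass is at most the increment of the distribution
  -- function over (u, q] for every u < q. Continuity makes it zero, as the portmanteau theorem
  -- requires.
  have hnull : (μ : Measure unitInterval) (frontier {t | (t : ℝ) ≤ q}) = 0 := by
    have hsub : frontier {t : unitInterval | (t : ℝ) ≤ q} ⊆ {t | (t : ℝ) = q} :=
      frontier_le_subset_eq continuous_subtype_val continuous_const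
    refine measure_mono_null hsub ?_
    have hle : ∀ u < q, (μ : Measure unitInterval).real {t | (t : ℝ) = q}
        ≤ distFun μ q - distFun μ u := by
      intro u hu
      have hd : Disjoint {t : unitInterval | (t : ℝ) = q} {t | (t : ℝ) ≤ u} := by
        rw [Set.disjoint_left]
        rintro t rfl h
        exact absurd hu (not_lt.2 h)
      rw [le_sub_iff_add_le, distFun, distFun, ← measureReal_union hd
        (measurableSet_le measurable_subtype_coe measurable_const)]
      refine measureReal_mono ?_
      rintro t (ht | ht)
      · exact ht.le
      · exact le_trans ht hu.le
    have hlim : Filter.Tendsto (fun u => distFun μ q - distFun μ u) (𝓝[<] q) (𝓝 0) := by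
      have := (tendsto_const_nhds (x := distFun μ q)).sub (hq.tendsto.mono_left
        (nhdsWithin_le_nhds (s := Iio q)))
      simpa using this
    have h0 : (μ : Measure unitInterval).real {t | (t : ℝ) = q} ≤ 0 :=
      ge_of_tendsto hlim (eventually_nhdsWithin_of_forall hle)
    exact (measureReal_eq_zero_iff).1 (le_antisymm h0 measureReal_nonneg)
  have h := ProbabilityMeasure.tendsto_measure_of_null_frontier_of_tendsto'
    (Filter.tendsto_id (α := ProbI) (x := 𝓝 μ)) hnull
  have h2 := (ENNReal.tendsto_toReal (measure_ne_top _ _)).comp h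
  exact h2

theorem tendsto_l1Dist_nhds (hg : ContDiffOn ℝ 1 g (Icc 0 1)) (hm : StrictMonoOn g (Icc 0 1))
    (μ : ProbI) : Filter.Tendsto (fun ν : ProbI => l1Dist g ν μ) (𝓝 μ) (𝓝 0) := by
  refine tendsto_l1Dist_of_ae hg hm ?_
  filter_upwards [ae_continuousAt_distFun μ] with q hq using tendsto_distFun_nhds hq

/-- The identity from the weak to the L¹-topology is continuous, its source is compact and its
target Hausdorff, so it is closed and hence a homeomorphism. -/
theorem l1Topology_eq (hg : ContDiffOn ℝ 1 g (Icc 0 1)) (hm : StrictMonoOn g (Icc 0 1)) :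
    l1Topology g = (inferInstance : TopologicalSpace (ProbabilityMeasure unitInterval)) := by
  have hc : Continuous[inferInstance, l1Topology g] (id : ProbI → ProbI) := by
    refine @continuous_iff_continuousAt _ _ _ (l1Topology g) _ |>.2 fun μ => ?_
    refine (@EMetric.tendsto_nhds _ _ (l1Space g) _ _ _).2 fun ε hε => ?_
    exact (tendsto_l1Dist_nhds hg hm μ).eventually (gt_mem_nhds hε)
  have ht2 : @T2Space ProbI (l1Topology g) := by
    let e : EMetricSpace ProbI :=
      { l1Space g with eq_of_edist_eq_zero := fun h => eq_of_l1Dist_eq_zero hg hm h }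
    have aux : ∀ (α : Type) [EMetricSpace α], T2Space α := fun α _ => inferInstance
    exact @aux ProbI e
  have hcl := @Continuous.isClosedMap ProbI ProbI inferInstance (l1Topology g) inferInstance ht2
    id hc
  refine TopologicalSpace.ext_isClosed fun s => ⟨fun h => ?_, fun h => ?_⟩
  · exact @IsClosed.preimage _ _ _ (l1Topology g) id hc s h
  · simpa using hcl s h

end Topology

/-! ### Discretization -/

/-- The atomic measure with atoms at `i / (n + 1)` whose distribution function there is a strictly
increasing perturbation of that of `μ`. -/
def discretize (n : ℕ) (μ : ProbI) : Atomic where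
  k := n + 1
  q i := (i : ℝ) / (n + 1)
  -- The admixture of (i + 1)/(n + 2) makes the values strictly increasing and positive at i = 0. At
  -- the last index i = n + 1 both terms are averages of 1, so the value is exactly 1.
  x i := (1 - 1 / (n + 1 : ℝ)) * distFun μ ((i : ℝ) / (n + 1))
    + 1 / (n + 1 : ℝ) * (((i : ℝ) + 1) / (n + 2))
  q_mono i j h := by
    have : (i : ℝ) < j := by exact_mod_cast h
    exact div_lt_div_of_pos_right this (by positivity)
  x_mono i j h := by
    have h1 : (i : ℝ) < j := by exact_mod_cast h
    have h2 : (1 : ℝ) / (n + 1) ≤ 1 := by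
      rw [div_le_one (by positivity)]
      linarith [(Nat.cast_nonneg n : (0 : ℝ) ≤ n)]
    refine add_lt_add_of_le_of_lt (mul_le_mul_of_nonneg_left (monotone_distFun μ ?_)
      (by linarith)) ?_
    · gcongr
    · gcongr
  q_nonneg := by simp
  x_pos := by
    have h2 : (1 : ℝ) / (n + 1) ≤ 1 := by
      rw [div_le_one (by positivity)]
      linarith [(Nat.cast_nonneg n : (0 : ℝ) ≤ n)]
    refine add_pos_of_nonneg_of_pos (mul_nonneg (by linarith) (distFun_mem μ _).1) ?_
    positivity
  q_last := by
    rw [Fin.val_last]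
    push_cast
    exact div_self (by positivity)
  x_last := by
    rw [Fin.val_last]
    push_cast
    rw [div_self (by positivity), distFun_of_one_le μ le_rfl, add_assoc, one_add_one_eq_two,
      div_self (by positivity)]
    ring

theorem distFun_discretize (n : ℕ) (μ : ProbI) {s : ℝ} (hs : s ∈ Ico (0 : ℝ) 1) :
    distFun (discretize n μ).toProbI s =
      (1 - 1 / (n + 1 : ℝ)) * distFun μ ((⌊s * (n + 1)⌋₊ : ℝ) / (n + 1))
        + 1 / (n + 1 : ℝ) * (((⌊s * (n + 1)⌋₊ : ℝ) + 1) / (n + 2)) := by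
  have hn : (0 : ℝ) < n + 1 := by positivity
  have hlt : ⌊s * (n + 1)⌋₊ < n + 1 := by
    rw [Nat.floor_lt (by have := hs.1; positivity)]
    push_cast
    nlinarith [hs.2]
  have h1 := Nat.floor_le (mul_nonneg hs.1 hn.le)
  have h2 := Nat.lt_floor_add_one (s * (n + 1))
  refine (distFun_toProbI_of_mem (discretize n μ) ⟨⌊s * (n + 1)⌋₊, hlt⟩ ⟨?_, ?_⟩).trans ?_
  · change ((⌊s * (n + 1)⌋₊ : ℕ) : ℝ) / (n + 1) ≤ s
    rwa [div_le_iff₀ hn]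
  · change s < ((⌊s * (n + 1)⌋₊ + 1 : ℕ) : ℝ) / (n + 1)
    rw [lt_div_iff₀ hn]
    exact_mod_cast h2
  · rfl

/-- The perturbation in the discretization does not depend on the measure, so the order of the
distribution functions survives; this is what transfers monotonicity to the extension. -/
theorem dominates_discretize {x y : ProbI} (h : Dominates x y) (n : ℕ) :
    Dominates (discretize n x).toProbI (discretize n y).toProbI := by
  intro s hs
  rcases hs.2.eq_or_lt with rfl | hs1
  · rw [distFun_of_one_le _ le_rfl, distFun_of_one_le _ le_rfl]
  · rw [distFun_discretize n x ⟨hs.1, hs1⟩, distFun_discretize n y ⟨hs.1, hs1⟩]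
    have hn : (0 : ℝ) < n + 1 := by positivity
    have h2 : (1 : ℝ) / (n + 1) ≤ 1 := by
      rw [div_le_one (by positivity)]
      linarith [(Nat.cast_nonneg n : (0 : ℝ) ≤ n)]
    have h1 := Nat.floor_le (mul_nonneg hs.1 hn.le)
    have := mul_le_mul_of_nonneg_left (h ((⌊s * (n + 1)⌋₊ : ℝ) / (n + 1))
      ⟨by positivity, by rw [div_le_one hn]; nlinarith⟩) (sub_nonneg.2 h2)
    linarith

theorem tendsto_distFun_discretize {μ : ProbI} {s : ℝ} (hs : s ∈ Ico (0 : ℝ) 1)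
    (hc : ContinuousAt (distFun μ) s) :
    Filter.Tendsto (fun n => distFun (discretize n μ).toProbI s) Filter.atTop
      (𝓝 (distFun μ s)) := by
  simp only [fun n => distFun_discretize n μ hs]
  have h0 : Filter.Tendsto (fun n : ℕ => 1 / (n + 1 : ℝ)) Filter.atTop (𝓝 0) :=
    tendsto_one_div_add_atTop_nhds_zero_nat
  have h1 : Filter.Tendsto (fun n : ℕ => (⌊s * (n + 1)⌋₊ : ℝ) / (n + 1)) Filter.atTop (𝓝 s) := by
    have := (tendsto_nat_floor_mul_div_atTop hs.1).comp
      (Filter.tendsto_atTop_add_const_right Filter.atTop (1 : ℝ) tendsto_natCast_atTop_atTop)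
    exact this
  have h2 : Filter.Tendsto (fun n : ℕ => 1 / (n + 1 : ℝ) * (((⌊s * (n + 1)⌋₊ : ℝ) + 1) / (n + 2)))
      Filter.atTop (𝓝 0) := by
    refine squeeze_zero (fun n => by positivity) (fun n => ?_) h0
    refine mul_le_of_le_one_right (by positivity) ?_
    have hn : (0 : ℝ) < n + 1 := by positivity
    have := Nat.floor_le (mul_nonneg hs.1 hn.le)
    rw [div_le_one (by positivity)]
    nlinarith [hs.2]
  have h3 := (((tendsto_const_nhds (x := (1 : ℝ))).sub h0).mul (hc.tendsto.comp h1)).add h2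
  simpa using h3

theorem tendsto_l1Dist_discretize {g : ℝ → ℝ} (hg : ContDiffOn ℝ 1 g (Icc 0 1))
    (hm : StrictMonoOn g (Icc 0 1)) (μ : ProbI) :
    Filter.Tendsto (fun n => l1Dist g (discretize n μ).toProbI μ) Filter.atTop (𝓝 0) := by
  refine tendsto_l1Dist_of_ae hg hm ?_
  have h1 : ∀ᵐ q ∂weight g, q ≠ (1 : ℝ) := by
    rw [ae_iff]
    simp
  have h2 : ∀ᵐ q ∂weight g, q ∈ Ioc (0 : ℝ) 1 := mem_ae_iff.2 weight_compl
  filter_upwards [ae_continuousAt_distFun μ, h1, h2] with q hq hq1 hq2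
  exact tendsto_distFun_discretize ⟨hq2.1.le, lt_of_le_of_ne hq2.2 hq1⟩ hq

/-! ### Extension of a Lipschitz functional -/

/-- The extension is the limit of F along the discretizations. The Lipschitz bound gives
convergence, continuity and agreement with F; density of atomic measures gives uniqueness;
discretizing x and y simultaneously gives monotonicity. -/
theorem exists_extension {g : ℝ → ℝ} (hg : ContDiffOn ℝ 1 g (Icc 0 1))
    (hm : StrictMonoOn g (Icc 0 1)) {F : Atomic → ℝ} {K : ℝ}
    (hF : ∀ a b, |F a - F b| ≤ K * (l1Dist g a.toProbI b.toProbI).toReal)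
    (hmono : ∀ a b : Atomic, Dominates a.toProbI b.toProbI → F b ≤ F a) :
    ∃ Φ : ProbabilityMeasure unitInterval → ℝ, Continuous Φ ∧
      (∀ a : Atomic, Φ a.toProbI = F a) ∧
      (∀ Φ' : ProbabilityMeasure unitInterval → ℝ, Continuous Φ' →
        (∀ a : Atomic, Φ' a.toProbI = F a) → Φ' = Φ) ∧
      ∀ x y, Dominates x y → Φ y ≤ Φ x := by
  set D : ProbI → ProbI → ℝ := fun x y => (l1Dist g x y).toReal with hD
  have hfin := l1Dist_ne_top hg hm
  have hcomm : ∀ x y, D x y = D y x := fun x y =>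
    congrArg ENNReal.toReal (eLpNorm_sub_comm (distFun x) (distFun y) 1 (weight g))
  have htri : ∀ x y z, D x z ≤ D x y + D y z := fun x y z => by
    rw [hD]
    simp only
    rw [← ENNReal.toReal_add (hfin _ _) (hfin _ _)]
    exact ENNReal.toReal_mono (ENNReal.add_ne_top.2 ⟨hfin _ _, hfin _ _⟩) (l1Dist_triangle g x y z)
  have hdisc : ∀ x, Filter.Tendsto (fun n => D (discretize n x).toProbI x) Filter.atTop (𝓝 0) :=
    fun x => (ENNReal.tendsto_toReal ENNReal.zero_ne_top).comp
        (tendsto_l1Dist_discretize hg hm x)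
  have hnhds : ∀ x, Filter.Tendsto (fun y => D y x) (𝓝 x) (𝓝 0) := fun x =>
    (ENNReal.tendsto_toReal ENNReal.zero_ne_top).comp (tendsto_l1Dist_nhds hg hm x)
  -- The sign of K is not given, so |K| serves as the Lipschitz constant.
  have hF' : ∀ a b : Atomic, |F a - F b| ≤ |K| * D a.toProbI b.toProbI := fun a b =>
    (hF a b).trans (mul_le_mul_of_nonneg_right (le_abs_self K) ENNReal.toReal_nonneg)
  have hex : ∀ x, ∃ L, Filter.Tendsto (fun n => F (discretize n x)) Filter.atTop (𝓝 L) := by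
    intro x
    refine cauchySeq_tendsto_of_complete (Metric.cauchySeq_iff.2 fun ε hε => ?_)
    have hev : ∀ᶠ n in Filter.atTop, |K| * D (discretize n x).toProbI x < ε / 2 := by
      have := (hdisc x).const_mul |K|
      rw [mul_zero] at this
      exact this.eventually (gt_mem_nhds (half_pos hε))
    obtain ⟨N, hN⟩ := Filter.eventually_atTop.1 hev
    refine ⟨N, fun n hn m hm' => ?_⟩
    rw [Real.dist_eq]
    have h1 := hF' (discretize n x) (discretize m x)
    have h2 := mul_le_mul_of_nonneg_left (htri (discretize n x).toProbI x
      (discretize m x).toProbI) (abs_nonneg K)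
    rw [hcomm x] at h2
    linarith [hN n hn, hN m hm']
  choose Φ hΦ using hex
  have hlip : ∀ x y, |Φ x - Φ y| ≤ |K| * D x y := by
    intro x y
    have hl : Filter.Tendsto (fun n => |K| * (D (discretize n x).toProbI x + D x y
        + D (discretize n y).toProbI y)) Filter.atTop (𝓝 (|K| * (0 + D x y + 0))) :=
      (((hdisc x).add_const _).add (hdisc y)).const_mul _
    rw [zero_add, add_zero] at hl
    refine le_of_tendsto_of_tendsto ((hΦ x).sub (hΦ y)).abs hl
      (Filter.Eventually.of_forall fun n => ?_)
    refine (hF' _ _).trans (mul_le_mul_of_nonneg_left ?_ (abs_nonneg K))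
    have h1 := htri (discretize n x).toProbI x (discretize n y).toProbI
    have h2 := htri x y (discretize n y).toProbI
    rw [hcomm y] at h2
    linarith
  have hat : ∀ a : Atomic, Φ a.toProbI = F a := by
    intro a
    refine tendsto_nhds_unique (hΦ a.toProbI) (tendsto_iff_dist_tendsto_zero.2 ?_)
    have := (hdisc a.toProbI).const_mul |K|
    rw [mul_zero] at this
    exact squeeze_zero (fun n => dist_nonneg) (fun n => hF' _ a) this
  refine ⟨Φ, ?_, hat, ?_, ?_⟩
  · refine continuous_iff_continuousAt.2 fun x => tendsto_iff_dist_tendsto_zero.2 ?_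
    have := (hnhds x).const_mul |K|
    rw [mul_zero] at this
    exact squeeze_zero (fun n => dist_nonneg) (fun y => hlip y x) this
  · intro Φ' hc hΦ'
    funext x
    have hx : Filter.Tendsto (fun n => (discretize n x).toProbI) Filter.atTop (𝓝 x) := by
      have h1 := (@EMetric.tendsto_nhds _ _ (l1Space g) Filter.atTop
        (fun n => (discretize n x).toProbI) x).2 fun ε hε =>
          (tendsto_l1Dist_discretize hg hm x).eventually (gt_mem_nhds hε)
      have e := l1Topology_eq hg hm
      change Filter.Tendsto _ _ (@nhds ProbI (l1Topology g) x) at h1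
      rwa [e] at h1
    have h2 := (hc.tendsto x).comp hx
    refine tendsto_nhds_unique h2 ((hΦ x).congr fun n => (hΦ' _).symm)
  · intro x y h
    exact le_of_tendsto_of_tendsto' (hΦ y) (hΦ x) fun n => hmono _ _ (dominates_discretize h n)


/-! ### The function `exp (-t)` on `[0,∞]` -/

/-- The function `t ↦ exp (-t)` on `[0,∞]`. -/
def expNeg (t : ℝ≥0∞) : ℝ≥0∞ := EReal.exp (-(t : EReal))

@[simp] theorem expNeg_zero : expNeg 0 = 1 := by simp [expNeg]

@[simp] theorem expNeg_top : expNeg ∞ = 0 := by simp [expNeg]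

theorem expNeg_ofReal {r : ℝ} (hr : 0 ≤ r) :
    expNeg (ENNReal.ofReal r) = ENNReal.ofReal (Real.exp (-r)) := by
  rw [expNeg, EReal.coe_ennreal_ofReal, max_eq_left hr, ← EReal.coe_neg, EReal.exp_coe]

theorem expNeg_strictAnti : StrictAnti expNeg := fun a b h => by
  rw [expNeg, expNeg, EReal.exp_lt_exp_iff, EReal.neg_lt_neg_iff]
  exact EReal.coe_ennreal_strictMono h

theorem expNeg_antitone : Antitone expNeg := expNeg_strictAnti.antitone

theorem expNeg_le_one (t : ℝ≥0∞) : expNeg t ≤ 1 :=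
  expNeg_zero ▸ expNeg_antitone (zero_le (a := t))

theorem expNeg_ne_top (t : ℝ≥0∞) : expNeg t ≠ ∞ :=
  ((expNeg_le_one t).trans_lt ENNReal.one_lt_top).ne

theorem expNeg_add (a b : ℝ≥0∞) : expNeg (a + b) = expNeg a * expNeg b := by
  rw [expNeg, expNeg, expNeg, ← EReal.exp_add, EReal.coe_ennreal_add, EReal.neg_add]
  · rw [sub_eq_add_neg]
  · exact Or.inl (EReal.coe_ennreal_ne_bot _)
  · exact Or.inr (EReal.coe_ennreal_ne_bot _)

theorem continuous_expNeg : Continuous expNeg := by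
  have : Continuous EReal.exp := EReal.expHomeomorph.continuous
  exact this.comp (continuous_neg.comp continuous_coe_ennreal_ereal)

@[fun_prop]
theorem measurable_expNeg : Measurable expNeg := continuous_expNeg.measurable

theorem expNeg_sum {ι : Type*} (s : Finset ι) (f : ι → ℝ≥0∞) :
    expNeg (∑ i ∈ s, f i) = ∏ i ∈ s, expNeg (f i) := by
  classical
  induction s using Finset.induction_on with
  | empty => simp
  | insert i s hi ih => rw [Finset.sum_insert hi, Finset.prod_insert hi, expNeg_add, ih]

theorem expNeg_natCast_mul (n : ℕ) (t : ℝ≥0∞) : expNeg (n * t) = expNeg t ^ n := by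
  have := expNeg_sum (Finset.range n) fun _ => t
  simpa using this

theorem one_sub_expNeg_le (t : ℝ≥0∞) : 1 - expNeg t ≤ t := by
  induction t with
  | top => simp
  | coe t =>
    rw [← ENNReal.ofReal_coe_nnreal, expNeg_ofReal t.coe_nonneg, ← ENNReal.ofReal_one,
      ← ENNReal.ofReal_sub _ (Real.exp_pos _).le]
    exact ENNReal.ofReal_le_ofReal (by linarith [Real.add_one_le_exp (-(t : ℝ))])

theorem tendsto_prod_expNeg (f : ℕ → ℝ≥0∞) :
    Filter.Tendsto (fun n => ∏ i ∈ Finset.range n, expNeg (f i)) Filter.atTop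
      (𝓝 (expNeg (∑' i, f i))) := by
  simp only [← expNeg_sum]
  exact (continuous_expNeg.tendsto _).comp ENNReal.summable.hasSum.tendsto_sum_nat

/-! ### Uniqueness of Laplace transforms -/

/-- A finite measure on `[0,∞]^ι` is determined by its Laplace transform at integer points. -/
theorem ext_of_lintegral_expNeg_pi {ι : Type*} [Fintype ι] {μ ν : Measure (ι → ℝ≥0∞)}
    [IsFiniteMeasure μ] [IsFiniteMeasure ν]
    (h : ∀ n : ι → ℕ, ∫⁻ t, expNeg (∑ i, n i * t i) ∂μ = ∫⁻ t, expNeg (∑ i, n i * t i) ∂ν) :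
    μ = ν := by
  classical
  have hcont : ∀ i, Continuous fun t : ι → ℝ≥0∞ => (expNeg (t i)).toReal := fun i =>
    ENNReal.continuousOn_toReal.comp_continuous (continuous_expNeg.comp (continuous_apply i))
      fun t => expNeg_ne_top _
  let f : ι → BoundedContinuousFunction (ι → ℝ≥0∞) ℝ := fun i =>
    BoundedContinuousFunction.ofNormedAddCommGroup (fun t => (expNeg (t i)).toReal) (hcont i) 1
      fun t => by
        rw [Real.norm_of_nonneg ENNReal.toReal_nonneg]
        simpa using ENNReal.toReal_mono ENNReal.one_ne_top (expNeg_le_one (t i))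
  -- The functions e^{-t_i} separate points of the Polish space [0,∞]^ι, so the algebra they
  -- generate determines a finite measure. Its monomials are e^{-Σ n_i t_i}, whose integrals are the
  -- Laplace transforms at integer points.
  let A : StarSubalgebra ℝ (BoundedContinuousFunction (ι → ℝ≥0∞) ℝ) :=
    { Algebra.adjoin ℝ (Set.range f) with
      star_mem' := fun {a} ha => by
        have : star a = a := by ext; simp
        rwa [this] }
  refine ext_of_forall_mem_subalgebra_integral_eq_of_polish (𝕜 := ℝ) (A := A) ?_ ?_
  · intro x y hxy
    obtain ⟨i, hi⟩ := Function.ne_iff.1 hxy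
    refine ⟨fun t => (expNeg (t i)).toReal, ⟨_, ⟨f i, Algebra.subset_adjoin ⟨i, rfl⟩, rfl⟩, rfl⟩,
      fun he => hi ?_⟩
    exact expNeg_strictAnti.injective
      ((ENNReal.toReal_eq_toReal_iff' (expNeg_ne_top _) (expNeg_ne_top _)).1 he)
  · intro g hg
    have hg' : g ∈ Submodule.span ℝ (Submonoid.closure (Set.range f) :
        Set (BoundedContinuousFunction (ι → ℝ≥0∞) ℝ)) := by
      rw [← Algebra.adjoin_eq_span]
      exact hg
    clear hg
    induction hg' using Submodule.span_induction with
    | zero => simp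
    | add a b _ _ ha hb =>
      simp only [BoundedContinuousFunction.coe_add, Pi.add_apply]
      rw [integral_add (a.integrable μ) (b.integrable μ),
        integral_add (a.integrable ν) (b.integrable ν), ha, hb]
    | smul c a _ ha =>
      simp only [BoundedContinuousFunction.coe_smul]
      rw [integral_smul, integral_smul, ha]
    | mem g hg =>
      have hmon : ∃ n : ι → ℕ, ∀ t, g t = (expNeg (∑ i, n i * t i)).toReal := by
        induction hg using Submonoid.closure_induction with
        | mem g hg =>
          obtain ⟨i, rfl⟩ := hg
          refine ⟨Pi.single i 1, fun t => ?_⟩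
          rw [Finset.sum_eq_single i]
          · simp [f]
          · intro j _ hj
            simp [hj]
          · simp
        | one => exact ⟨0, fun t => by simp⟩
        | mul a b _ _ ha hb =>
          obtain ⟨n, hn⟩ := ha
          obtain ⟨m, hm⟩ := hb
          refine ⟨n + m, fun t => ?_⟩
          simp only [BoundedContinuousFunction.coe_mul, Pi.mul_apply, hn, hm, Pi.add_apply,
            Nat.cast_add, add_mul, Finset.sum_add_distrib, expNeg_add, ENNReal.toReal_mul]
      obtain ⟨n, hn⟩ := hmon
      have hmeas : Measurable fun t : ι → ℝ≥0∞ => expNeg (∑ i, n i * t i) := by fun_prop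
      simp only [hn]
      rw [integral_toReal hmeas.aemeasurable (ae_of_all _ fun t => (expNeg_ne_top _).lt_top),
        integral_toReal hmeas.aemeasurable (ae_of_all _ fun t => (expNeg_ne_top _).lt_top), h n]

/-- A finite measure on `[0,∞]` is determined by its Laplace transform at integer points. -/
theorem ext_of_lintegral_expNeg {μ ν : Measure ℝ≥0∞} [IsFiniteMeasure μ] [IsFiniteMeasure ν]
    (h : ∀ n : ℕ, ∫⁻ t, expNeg (n * t) ∂μ = ∫⁻ t, expNeg (n * t) ∂ν) : μ = ν := by
  have key : μ.map (fun t (_ : Unit) => t) = ν.map fun t _ => t := by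
    refine ext_of_lintegral_expNeg_pi fun n => ?_
    rw [lintegral_map (by fun_prop) (by fun_prop), lintegral_map (by fun_prop) (by fun_prop)]
    simpa using h (n ())
  have h2 := congrArg (Measure.map fun t : Unit → ℝ≥0∞ => t ()) key
  rw [Measure.map_map (by fun_prop) (by fun_prop), Measure.map_map (by fun_prop) (by fun_prop)]
    at h2
  simpa [Function.comp_def] using h2

/-! ### The Laplace functional of a Poisson point process -/

/-- The generating function of the Poisson law at α = e^{-c}, summed by the exponential series; c =
∞ is the case α = 0. -/
theorem lintegral_expNeg_poisson (r : ℝ≥0) (c : ℝ≥0∞) :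
    ∫⁻ t, expNeg (c * t) ∂(poissonMeasure r).map (Nat.cast : ℕ → ℝ≥0∞)
      = expNeg (r * (1 - expNeg c)) := by
  obtain ⟨α, hα⟩ : ∃ α : ℝ≥0, expNeg c = α := ⟨_, (ENNReal.coe_toNNReal (expNeg_ne_top c)).symm⟩
  have hα1 : α ≤ 1 := by
    have := expNeg_le_one c
    rw [hα] at this
    exact_mod_cast this
  rw [lintegral_map (by fun_prop) (by fun_prop), lintegral_countable']
  have e : ∀ n : ℕ, expNeg (c * n) * (poissonMeasure r) {n}
      = ENNReal.ofReal (Real.exp (-r) * ((r * α) ^ n / (n.factorial))) := fun n => by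
    rw [mul_comm c, expNeg_natCast_mul, hα, poissonMeasure_singleton,
      ← ENNReal.ofReal_coe_nnreal, ← ENNReal.ofReal_pow α.coe_nonneg, ← ENNReal.ofReal_mul (by positivity)]
    congr 1
    rw [mul_pow]
    ring
  have hs := (NormedSpace.expSeries_div_hasSum_exp ((r : ℝ) * α)).mul_left (Real.exp (-r))
  rw [← Real.exp_eq_exp_ℝ, ← Real.exp_add] at hs
  simp only [e]
  rw [← ENNReal.ofReal_tsum_of_nonneg (fun n => by positivity) hs.summable, hs.tsum_eq, hα]
  have e2 : (r : ℝ≥0∞) * (1 - α) = ENNReal.ofReal (r * (1 - α)) := by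
    rw [ENNReal.ofReal_mul r.coe_nonneg, ENNReal.ofReal_sub _ α.coe_nonneg]
    simp
  have hα1' : (α : ℝ) ≤ 1 := by exact_mod_cast hα1
  rw [e2, expNeg_ofReal (mul_nonneg r.coe_nonneg (sub_nonneg.2 hα1'))]
  congr 2
  ring

variable {Ω : Type} [MeasurableSpace Ω] {P : Measure Ω}

theorem measurable_count {ζ : ℕ → Ω → ℝ} (hζ : ∀ j, Measurable (ζ j)) {A : Set ℝ}
    (hA : MeasurableSet A) : Measurable (count ζ A) :=
  Measurable.tsum fun j => (measurable_const.indicator hA).comp (hζ j)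

theorem lintegral_expNeg_sum_count [IsProbabilityMeasure P] {ν : Measure ℝ} {ζ : ℕ → Ω → ℝ}
    (h : IsPoissonPointProcess P ν ζ) {n : ℕ} {A : Fin n → Set ℝ} (hA : ∀ i, MeasurableSet (A i))
    (hν : ∀ i, ν (A i) ≠ ∞) (hd : Pairwise fun i j => Disjoint (A i) (A j)) (c : Fin n → ℝ≥0∞) :
    ∫⁻ ω, expNeg (∑ i, c i * count ζ (A i) ω) ∂P
      = expNeg (∑ i, ν (A i) * (1 - expNeg (c i))) := by
  have hm := fun i => measurable_count h.measurable (hA i)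
  have hind : iIndepFun (fun i ω => expNeg (c i * count ζ (A i) ω)) P :=
    (h.indep n A hA hν hd).comp (fun i t => expNeg (c i * t)) (fun i => by fun_prop)
  simp only [expNeg_sum]
  rw [lintegral_prod_eq_prod_lintegral_of_indepFun Finset.univ _ hind
    (fun i => by have := hm i; fun_prop)]
  refine Finset.prod_congr rfl fun i _ => ?_
  have := lintegral_expNeg_poisson (ν (A i)).toNNReal (c i)
  rw [← h.poisson (A i) (hA i) (hν i), lintegral_map (by fun_prop) (hm i),
    ENNReal.coe_toNNReal (hν i)] at this
  exact this

theorem tendsto_tsum_of_monotone {F : ℕ → ℕ → ℝ≥0∞} {f : ℕ → ℝ≥0∞} (hm : ∀ j, Monotone (F · j))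
    (hl : ∀ j, Filter.Tendsto (F · j) Filter.atTop (𝓝 (f j))) :
    Filter.Tendsto (fun n => ∑' j, F n j) Filter.atTop (𝓝 (∑' j, f j)) := by
  simp only [← lintegral_count]
  exact lintegral_tendsto_of_tendsto_of_monotone (fun n => Measurable.of_discrete.aemeasurable)
    (ae_of_all _ hm) (ae_of_all _ hl)

theorem lintegral_expNeg_tsum_simpleFunc [IsProbabilityMeasure P] {ν : Measure ℝ} {ζ : ℕ → Ω → ℝ}
    (h : IsPoissonPointProcess P ν ζ) (f : SimpleFunc ℝ ℝ≥0∞)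
    (hf : ∀ c ≠ 0, ν (f ⁻¹' {c}) ≠ ∞) :
    ∫⁻ ω, expNeg (∑' j, f (ζ j ω)) ∂P = expNeg (∫⁻ s, (1 - expNeg (f s)) ∂ν) := by
  classical
  set e := f.range.equivFin with he
  set c : Fin f.range.card → ℝ≥0∞ := fun i => (e.symm i : ℝ≥0∞) with hc
  have hcinj : Function.Injective c := Subtype.val_injective.comp e.symm.injective
  -- The zero level set may have infinite intensity but contributes nothing, so it is replaced by
  -- the empty set.
  set A : Fin f.range.card → Set ℝ := fun i => if c i = 0 then ∅ else f ⁻¹' {c i} with hAdef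
  have hA : ∀ i, MeasurableSet (A i) := fun i => by
    simp only [hAdef]
    split_ifs
    · exact MeasurableSet.empty
    · exact f.measurableSet_preimage _
  have hν : ∀ i, ν (A i) ≠ ∞ := fun i => by
    simp only [hAdef]
    split_ifs with h0
    · simp
    · exact hf _ h0
  have hAsub : ∀ i, A i ⊆ f ⁻¹' {c i} := fun i => by
    simp only [hAdef]
    split_ifs
    · exact empty_subset _
    · exact subset_rfl
  have hd : Pairwise fun i j => Disjoint (A i) (A j) := fun i j hij => by
    refine Set.disjoint_left.2 fun s hs hs' => hij (hcinj ?_)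
    rw [← hAsub i hs, ← hAsub j hs']
  have hdecomp : ∀ (G : ℝ≥0∞ → ℝ≥0∞), G 0 = 0 → ∀ s,
      G (f s) = ∑ i, G (c i) * (A i).indicator (fun _ => (1 : ℝ≥0∞)) s := by
    intro G hG s
    set i₀ := e ⟨f s, SimpleFunc.mem_range_self f s⟩ with hi₀
    have hci : c i₀ = f s := by simp [hc, hi₀]
    rw [Finset.sum_eq_single i₀]
    · by_cases h0 : c i₀ = 0
      · rw [← hci, h0, hG, zero_mul]
      · have : s ∈ A i₀ := by
          simp only [hAdef, if_neg h0]
          exact hci.symm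
        rw [indicator_of_mem this, mul_one, hci]
    · intro i _ hi
      have : s ∉ A i := fun hs => hi (hcinj (by rw [hci]; exact (hAsub i hs).symm))
      rw [indicator_of_notMem this, mul_zero]
    · simp
  have h1 : ∀ ω, ∑' j, f (ζ j ω) = ∑ i, c i * count ζ (A i) ω := fun ω => by
    simp only [count, ← ENNReal.tsum_mul_left]
    rw [← Summable.tsum_finsetSum fun i _ => ENNReal.summable]
    exact tsum_congr fun j => hdecomp id rfl _
  have h2 : ∫⁻ s, (1 - expNeg (f s)) ∂ν = ∑ i, ν (A i) * (1 - expNeg (c i)) := by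
    simp only [hdecomp (fun t => 1 - expNeg t) (by simp)]
    rw [lintegral_finsetSum _ fun i _ =>
      (measurable_const.indicator (hA i)).const_mul _]
    refine Finset.sum_congr rfl fun i _ => ?_
    rw [lintegral_const_mul _ (measurable_const.indicator (hA i)), lintegral_indicator (hA i)]
    simp [mul_comm]
  simp only [h1]
  rw [h2, lintegral_expNeg_sum_count h hA hν hd]

/-- The Laplace functional of a Poisson point process. -/
theorem lintegral_expNeg_tsum [IsProbabilityMeasure P] {ν : Measure ℝ} [SigmaFinite ν]
    {ζ : ℕ → Ω → ℝ} (h : IsPoissonPointProcess P ν ζ) {f : ℝ → ℝ≥0∞} (hf : Measurable f) :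
    ∫⁻ ω, expNeg (∑' j, f (ζ j ω)) ∂P = expNeg (∫⁻ s, (1 - expNeg (f s)) ∂ν) := by
  -- Restricting to the n-th spanning set gives every nonzero level finite intensity while keeping
  -- the approximation monotone.
  set F : ℕ → SimpleFunc ℝ ℝ≥0∞ := fun n => (SimpleFunc.eapprox f n).restrict (spanningSets ν n)
  have hFval : ∀ n s, F n s = (spanningSets ν n).indicator (SimpleFunc.eapprox f n) s := fun n s =>
    SimpleFunc.restrict_apply _ (measurableSet_spanningSets ν n) s
  have hmono : ∀ s, Monotone fun n => F n s := fun s n m hnm => by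
    simp only [hFval]
    refine (indicator_le_indicator_of_subset (monotone_spanningSets ν hnm)
      (fun _ => zero_le) s).trans (indicator_le_indicator ?_)
    exact SimpleFunc.monotone_eapprox f hnm s
  have hlim : ∀ s, Filter.Tendsto (fun n => F n s) Filter.atTop (𝓝 (f s)) := fun s => by
    have h1 : Filter.Tendsto (fun n => SimpleFunc.eapprox f n s) Filter.atTop (𝓝 (f s)) := by
      rw [← SimpleFunc.iSup_eapprox_apply hf]
      exact tendsto_atTop_iSup fun n m hnm => SimpleFunc.monotone_eapprox f hnm s
    refine h1.congr' ?_
    filter_upwards [Filter.eventually_ge_atTop (spanningSetsIndex ν s)] with n hn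
    rw [hFval, indicator_of_mem]
    exact monotone_spanningSets ν hn (mem_spanningSetsIndex ν s)
  have hfin : ∀ n, ∀ c ≠ 0, ν (F n ⁻¹' {c}) ≠ ∞ := fun n c hc => by
    refine ne_top_of_le_ne_top (measure_spanningSets_lt_top ν n).ne (measure_mono fun s hs => ?_)
    by_contra hns
    refine hc ?_
    rw [← (hs : F n s = c), hFval, indicator_of_notMem hns]
  have hζ : ∀ j, Measurable (ζ j) := h.measurable
  have key := fun n => lintegral_expNeg_tsum_simpleFunc h (F n) (hfin n)
  have hL : Filter.Tendsto (fun n => ∫⁻ ω, expNeg (∑' j, F n (ζ j ω)) ∂P) Filter.atTop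
      (𝓝 (∫⁻ ω, expNeg (∑' j, f (ζ j ω)) ∂P)) := by
    refine tendsto_lintegral_of_dominated_convergence (fun _ => 1) (fun n => ?_)
      (fun n => ae_of_all _ fun ω => expNeg_le_one _) (by simp) (ae_of_all _ fun ω => ?_)
    · exact measurable_expNeg.comp
        (Measurable.tsum fun j => (F n).measurable.comp (hζ j))
    · exact (continuous_expNeg.tendsto _).comp
        (tendsto_tsum_of_monotone (fun j => hmono _) fun j => hlim _)
  have hR : Filter.Tendsto (fun n => expNeg (∫⁻ s, (1 - expNeg (F n s)) ∂ν)) Filter.atTop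
      (𝓝 (expNeg (∫⁻ s, (1 - expNeg (f s)) ∂ν))) := by
    refine (continuous_expNeg.tendsto _).comp (lintegral_tendsto_of_tendsto_of_monotone
      (fun n => ?_) (ae_of_all _ fun s n m hnm => ?_) (ae_of_all _ fun s => ?_))
    · exact (measurable_const.sub (measurable_expNeg.comp (F n).measurable)).aemeasurable
    · exact tsub_le_tsub_left (expNeg_antitone (hmono s hnm)) 1
    · exact ENNReal.Tendsto.sub tendsto_const_nhds
        ((continuous_expNeg.tendsto _).comp (hlim s)) (Or.inl ENNReal.one_ne_top)
  exact tendsto_nhds_unique hL (by simpa only [key] using hR)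


/-! ### Splitting a product measure -/

theorem infinitePi_map_prodMk {ι κ κ' : Type*} {X : ι → Type*} [∀ i, MeasurableSpace (X i)]
    (μ : ∀ i, Measure (X i)) [∀ i, IsProbabilityMeasure (μ i)] {f : κ → ι} {g : κ' → ι}
    (hf : Function.Injective f) (hg : Function.Injective g) (hfg : ∀ a b, f a ≠ g b) :
    (Measure.infinitePi μ).map (fun ω => (fun a => ω (f a), fun b => ω (g b)))
      = (Measure.infinitePi fun a => μ (f a)).prod (Measure.infinitePi fun b => μ (g b)) := by
  classical
  have hind : IndepFun (fun (ω : ∀ i, X i) a => ω (f a)) (fun ω b => ω (g b))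
      (Measure.infinitePi μ) := by
    refine IndepFun.process_indepFun_process (fun a => by fun_prop) (fun b => by fun_prop)
      fun I J => ?_
    have h := (iIndepFun_infinitePi (P := μ) (X := fun i x => x)
      (fun i => measurable_id)).indepFun_finset (I.image f) (J.image g) (by
        rw [Finset.disjoint_left]
        intro i hi hj
        obtain ⟨a, _, rfl⟩ := Finset.mem_image.1 hi
        obtain ⟨b, _, hb⟩ := Finset.mem_image.1 hj
        exact hfg a b hb.symm) (fun i => by fun_prop)
    exact h.comp
      (φ := fun z (a : I) => z ⟨f a, Finset.mem_image_of_mem f a.2⟩)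
      (ψ := fun z (b : J) => z ⟨g b, Finset.mem_image_of_mem g b.2⟩)
      (by fun_prop) (by fun_prop)
  rw [(indepFun_iff_map_prod_eq_prod_map_map (Measurable.aemeasurable (by fun_prop))
    (Measurable.aemeasurable (by fun_prop))).1 hind,
    Measure.map_infinitePi_infinitePi_of_inj hf, Measure.map_infinitePi_infinitePi_of_inj hg]

theorem infinitePi_map_prodMk_eval {ι κ' : Type*} {X : ι → Type*} [∀ i, MeasurableSpace (X i)]
    (μ : ∀ i, Measure (X i)) [∀ i, IsProbabilityMeasure (μ i)] (i : ι) {g : κ' → ι}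
    (hg : Function.Injective g) (hfg : ∀ b, i ≠ g b) :
    (Measure.infinitePi μ).map (fun ω => (ω i, fun b => ω (g b)))
      = (μ i).prod (Measure.infinitePi fun b => μ (g b)) := by
  have h := infinitePi_map_prodMk μ (f := fun _ : Unit => i) (Function.injective_of_subsingleton _)
    hg fun _ b => hfg b
  have h2 := congrArg (Measure.map (Prod.map (fun x : Unit → X i => x ()) id)) h
  rw [Measure.map_map (by fun_prop) (by fun_prop),
    ← Measure.map_prod_map _ _ (by fun_prop) (by fun_prop), Measure.infinitePi_map_eval,
    Measure.map_id] at h2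
  exact h2

/-! ### The standard Poisson process on the half line -/

/-- Since p is only measurable, the exponential of minus its primitive is differentiable merely
almost everywhere. It is Lipschitz, hence absolutely continuous, so the fundamental theorem of
calculus still applies. -/
theorem integral_mul_exp_neg_primitive {p : ℝ → ℝ} (hp : Measurable p)
    (hp01 : ∀ s, p s ∈ Icc (0 : ℝ) 1) {S : ℝ} (hS : 0 ≤ S) :
    ∫ s in (0)..S, p s * Real.exp (-∫ r in (0)..s, p r) = 1 - Real.exp (-∫ r in (0)..S, p r) := by
  have hloc : LocallyIntegrable p volume := by
    refine (locallyIntegrable_const (1 : ℝ)).mono hp.aestronglyMeasurable (ae_of_all _ fun s => ?_)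
    rw [Real.norm_of_nonneg (hp01 s).1, norm_one]
    exact (hp01 s).2
  have hint : ∀ a b, IntervalIntegrable p volume a b := fun a b =>
    (hloc.integrableOn_isCompact isCompact_uIcc).intervalIntegrable
  set f : ℝ → ℝ := fun s => Real.exp (-∫ r in (0)..s, p r) with hf
  have hmono : ∀ a b, a ≤ b → (∫ r in (0)..b, p r) - ∫ r in (0)..a, p r ∈ Icc 0 (b - a) := by
    intro a b hab
    rw [intervalIntegral.integral_interval_sub_left (hint _ _) (hint _ _)]
    refine ⟨intervalIntegral.integral_nonneg hab fun s _ => (hp01 s).1, ?_⟩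
    have := intervalIntegral.integral_mono_on hab (hint a b)
      (intervalIntegrable_const (c := (1 : ℝ))) fun s _ => (hp01 s).2
    simpa using this
  have hlip : LipschitzOnWith 1 f (uIcc 0 S) := by
    rw [uIcc_of_le hS]
    refine LipschitzOnWith.of_le_add_mul 1 fun a ha b hb => ?_
    have h0a := (hmono 0 a ha.1).1
    have h0b := (hmono 0 b hb.1).1
    simp only [intervalIntegral.integral_same, sub_zero] at h0a h0b
    rw [NNReal.coe_one, one_mul, Real.dist_eq]
    rcases le_total a b with hab | hab
    · have h := hmono a b hab
      have h1 : f a - f b ≤ (∫ r in (0)..b, p r) - ∫ r in (0)..a, p r := by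
        have e1 := Real.add_one_le_exp ((∫ r in (0)..a, p r) - ∫ r in (0)..b, p r)
        have e2 : f b = f a * Real.exp ((∫ r in (0)..a, p r) - ∫ r in (0)..b, p r) := by
          rw [hf]
          simp only
          rw [← Real.exp_add]
          ring_nf
        have e3 : f a ≤ 1 := Real.exp_le_one_iff.2 (by linarith)
        have e4 : 0 < f a := Real.exp_pos _
        rw [e2]
        nlinarith [h.1]
      rw [abs_sub_comm, abs_of_nonneg (by linarith)]
      linarith [h.2]
    · have h := hmono b a hab
      have : f a ≤ f b := Real.exp_le_exp.2 (by linarith [h.1])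
      linarith [abs_nonneg (a - b)]
  have hac := hlip.absolutelyContinuousOnInterval
  have hft := hac.integral_deriv_eq_sub
  have hd : ∀ᵐ s, deriv f s = -(p s * f s) := by
    filter_upwards [LocallyIntegrable.ae_hasDerivAt_integral hloc] with s hs
    have : HasDerivAt f (Real.exp (-∫ r in (0)..s, p r) * -p s) s := (hs 0).neg.exp
    rw [this.deriv, hf]
    ring
  rw [intervalIntegral.integral_congr_ae (hd.mono fun s hs _ => hs), intervalIntegral.integral_neg]
    at hft
  have h0 : f 0 = 1 := by simp [hf]
  rw [h0] at hft
  linarith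

theorem lintegral_mul_exp_neg_primitive {p : ℝ → ℝ} (hp : Measurable p)
    (hp01 : ∀ s, p s ∈ Icc (0 : ℝ) 1)
    (hlim : Filter.Tendsto (fun S => ∫ r in (0)..S, p r) Filter.atTop Filter.atTop) :
    ∫⁻ s in Ioi 0, ENNReal.ofReal (p s * Real.exp (-∫ r in (0)..s, p r)) = 1 := by
  set F : ℝ → ℝ := fun s => p s * Real.exp (-∫ r in (0)..s, p r) with hF
  have hF0 : ∀ s, 0 ≤ F s := fun s => mul_nonneg (hp01 s).1 (Real.exp_pos _).le
  have hloc : LocallyIntegrable p volume := by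
    refine (locallyIntegrable_const (1 : ℝ)).mono hp.aestronglyMeasurable (ae_of_all _ fun s => ?_)
    rw [Real.norm_of_nonneg (hp01 s).1, norm_one]
    exact (hp01 s).2
  have hcont : Continuous fun s => Real.exp (-∫ r in (0)..s, p r) := by
    have := intervalIntegral.continuous_primitive (fun a b =>
      (hloc.integrableOn_isCompact isCompact_uIcc).intervalIntegrable) (0 : ℝ)
      (f := p) (μ := volume)
    fun_prop
  have hFi : ∀ b, IntegrableOn F (Ioc 0 b) := fun b =>
    ((hloc.integrableOn_isCompact isCompact_Icc).mul_continuousOn hcont.continuousOn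
      isCompact_Icc).mono_set Ioc_subset_Icc_self
  have hT : Filter.Tendsto (fun S => ∫ s in (0)..S, F s) Filter.atTop (𝓝 1) := by
    have h1 : Filter.Tendsto (fun S => 1 - Real.exp (-∫ r in (0)..S, p r)) Filter.atTop
        (𝓝 (1 - 0)) :=
      tendsto_const_nhds.sub (Real.tendsto_exp_neg_atTop_nhds_zero.comp hlim)
    rw [sub_zero] at h1
    refine h1.congr' ?_
    filter_upwards [Filter.eventually_ge_atTop 0] with S hS
    exact (integral_mul_exp_neg_primitive hp hp01 hS).symm
  have hI : IntegrableOn F (Ioi 0) := by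
    refine integrableOn_Ioi_of_intervalIntegral_norm_tendsto 1 0 hFi Filter.tendsto_id ?_
    simpa only [Real.norm_of_nonneg (hF0 _)] using hT
  have := tendsto_nhds_unique (intervalIntegral_tendsto_integral_Ioi 0 hI Filter.tendsto_id) hT
  rw [← ofReal_integral_eq_lintegral_ofReal hI (ae_of_all _ hF0), this, ENNReal.ofReal_one]

/-- The standard exponential distribution. -/
def stdExp : Measure ℝ :=
  (volume.restrict (Ioi (0 : ℝ))).withDensity fun s => ENNReal.ofReal (Real.exp (-s))

theorem lintegral_stdExp (f : ℝ → ℝ≥0∞) (hf : Measurable f) :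
    ∫⁻ s, f s ∂stdExp = ∫⁻ s in Ioi 0, ENNReal.ofReal (Real.exp (-s)) * f s := by
  rw [stdExp, lintegral_withDensity_eq_lintegral_mul _ (by fun_prop) hf]
  rfl

theorem lintegral_exp_neg_mul {c : ℝ} (hc : 0 < c) :
    ∫⁻ s in Ioi 0, ENNReal.ofReal (Real.exp (-(c * s))) = ENNReal.ofReal c⁻¹ := by
  have h := integral_exp_mul_Ioi (neg_lt_zero.2 hc) 0
  have hi := integrableOn_exp_mul_Ioi (neg_lt_zero.2 hc) 0
  simp only [neg_mul] at h hi
  rw [← ofReal_integral_eq_lintegral_ofReal hi (ae_of_all _ fun s => (Real.exp_pos _).le), h]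
  simp [neg_div_neg_eq]

instance : IsProbabilityMeasure stdExp := by
  constructor
  have := lintegral_stdExp (fun _ => 1) measurable_const
  have h2 := lintegral_exp_neg_mul one_pos
  simp only [one_mul, inv_one, ENNReal.ofReal_one] at h2
  simpa [h2] using this

theorem ae_pos_stdExp : ∀ᵐ s ∂stdExp, 0 < s :=
  (withDensity_absolutelyContinuous _ _).ae_le (ae_restrict_mem measurableSet_Ioi)


/-- The tail integral of `h`. -/
def tailIntegral (h : ℝ → ℝ) (t : ℝ) : ℝ := ∫ r in Ioi t, h r

theorem measurable_tailIntegral {h : ℝ → ℝ} (h0 : ∀ s, 0 ≤ h s) (hi : Integrable h) :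
    Measurable (tailIntegral h) :=
  Antitone.measurable fun _ _ hab => setIntegral_mono_set hi.integrableOn
    (ae_of_all _ h0) (ae_of_all _ (Ioi_subset_Ioi hab))

/-- Write H for the tail integral and p = 1 - h(t + ·). Then e^{-s} e^{-H(t+s)} = e^{-H(t)} e^{-∫₀ˢ
p}, and p e^{-∫p} has total integral 1 because the integral of p diverges. -/
theorem lintegral_stdExp_step {h : ℝ → ℝ} (hm : Measurable h) (h01 : ∀ s, h s ∈ Icc (0 : ℝ) 1)
    (hi : Integrable h) (t : ℝ) :
    ∫⁻ s, ENNReal.ofReal ((1 - h (t + s)) * Real.exp (-tailIntegral h (t + s))) ∂stdExp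
      = ENNReal.ofReal (Real.exp (-tailIntegral h t)) := by
  have hmeasw := measurable_tailIntegral (fun s => (h01 s).1) hi
  rw [lintegral_stdExp _ (by fun_prop)]
  have hprim : ∀ S, 0 ≤ S → ∫ r in (0)..S, (1 - h (t + r))
      = S - ((tailIntegral h t) - tailIntegral h (t + S)) := by
    intro S hS
    rw [tailIntegral, tailIntegral, intervalIntegral.integral_Ioi_sub_Ioi hi.integrableOn (by linarith),
      intervalIntegral.integral_sub (by simp) ((hi.comp_add_left t).intervalIntegrable),
      intervalIntegral.integral_comp_add_left]
    simp
  have hlim : Filter.Tendsto (fun S => ∫ r in (0)..S, (1 - h (t + r))) Filter.atTop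
      Filter.atTop := by
    refine Filter.tendsto_atTop_mono' _ ?_
      (Filter.tendsto_atTop_add_const_right _ (-tailIntegral h t) Filter.tendsto_id)
    filter_upwards [Filter.eventually_ge_atTop 0] with S hS
    rw [hprim S hS]
    have : 0 ≤ tailIntegral h (t + S) := integral_nonneg fun s => (h01 s).1
    simp only [id]
    linarith
  have key := lintegral_mul_exp_neg_primitive (p := fun s => 1 - h (t + s)) (by fun_prop)
    (fun s => ⟨by linarith [(h01 (t + s)).2], by linarith [(h01 (t + s)).1]⟩) hlim
  calc _ = ∫⁻ s in Ioi 0, ENNReal.ofReal (Real.exp (-tailIntegral h t)) *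
        ENNReal.ofReal ((1 - h (t + s)) * Real.exp (-∫ r in (0)..s, (1 - h (t + r)))) := by
        refine setLIntegral_congr_fun measurableSet_Ioi fun s hs => ?_
        rw [hprim s (le_of_lt hs), ← ENNReal.ofReal_mul (Real.exp_pos _).le,
          ← ENNReal.ofReal_mul (Real.exp_pos _).le]
        congr 1
        rw [mul_left_comm, ← Real.exp_add, mul_left_comm, ← Real.exp_add]
        ring_nf
    _ = _ := by
        rw [lintegral_const_mul' _ _ ENNReal.ofReal_ne_top, key, mul_one]

/-- The law of a sequence of independent standard exponential variables. -/
abbrev expSeq : Measure (ℕ → ℝ) := Measure.infinitePi fun _ => stdExp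

theorem lintegral_expSeq (F : ℝ → (ℕ → ℝ) → ℝ≥0∞) (hF : Measurable (Function.uncurry F)) :
    ∫⁻ ω, F (ω 0) (fun n => ω (n + 1)) ∂expSeq = ∫⁻ s, ∫⁻ ω, F s ω ∂expSeq ∂stdExp := by
  have h := infinitePi_map_prodMk_eval (fun _ : ℕ => stdExp) 0 (g := Nat.succ)
    Nat.succ_injective fun b => (Nat.succ_ne_zero b).symm
  have h2 := lintegral_prod (μ := stdExp) (ν := expSeq) _ hF.aemeasurable
  rw [← h, lintegral_map hF (by fun_prop)] at h2
  exact h2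

/-- The `n`-th arrival time is `arrival (n + 1)`. -/
def arrival (n : ℕ) (ω : ℕ → ℝ) : ℝ := ∑ i ∈ Finset.range n, ω i

@[fun_prop]
theorem measurable_arrival (n : ℕ) : Measurable (arrival n) := by unfold arrival; fun_prop

theorem arrival_succ' (n : ℕ) (ω : ℕ → ℝ) :
    arrival (n + 1) ω = ω 0 + arrival n fun n => ω (n + 1) := by
  rw [arrival, Finset.sum_range_succ', add_comm, arrival]

/-- A martingale identity: the integrand has the same mean for all n, by conditioning on the first
waiting time and restarting at t + s. For this the induction must be uniform in t. -/
theorem lintegral_prod_arrival {h : ℝ → ℝ} (hm : Measurable h) (h01 : ∀ s, h s ∈ Icc (0 : ℝ) 1)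
    (hi : Integrable h) (n : ℕ) : ∀ t : ℝ,
    ∫⁻ ω, (∏ j ∈ Finset.range n, ENNReal.ofReal (1 - h (t + arrival (j + 1) ω)))
        * ENNReal.ofReal (Real.exp (-tailIntegral h (t + arrival n ω))) ∂expSeq
      = ENNReal.ofReal (Real.exp (-tailIntegral h t)) := by
  have hmeasw := measurable_tailIntegral (fun s => (h01 s).1) hi
  induction n with
  | zero => intro t; simp [arrival]
  | succ n ih =>
    intro t
    have e := lintegral_expSeq (fun s ω => ENNReal.ofReal (1 - h (t + s)) *
      ((∏ j ∈ Finset.range n, ENNReal.ofReal (1 - h (t + s + arrival (j + 1) ω)))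
        * ENNReal.ofReal (Real.exp (-tailIntegral h (t + s + arrival n ω)))))
      (by unfold Function.uncurry; fun_prop)
    rw [← lintegral_stdExp_step hm h01 hi t]
    calc _ = _ := ?_
      _ = _ := e
      _ = _ := ?_
    · refine lintegral_congr fun ω => ?_
      have e1 : arrival (0 + 1) ω = ω 0 := by simp [arrival]
      rw [Finset.prod_range_succ', e1, arrival_succ' n ω, ← add_assoc,
        mul_comm _ (ENNReal.ofReal (1 - h (t + ω 0))), mul_assoc]
      congr 2
      refine Finset.prod_congr rfl fun j _ => ?_
      rw [arrival_succ' (j + 1) ω, ← add_assoc]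
    · refine lintegral_congr fun s => ?_
      rw [lintegral_const_mul' _ _ ENNReal.ofReal_ne_top, ih, ENNReal.ofReal_mul]
      linarith [(h01 (t + s)).2]

theorem ae_expSeq_pos : ∀ᵐ ω ∂expSeq, ∀ n, 0 < ω n := by
  rw [ae_all_iff]
  intro n
  have h := Measure.infinitePi_map_eval (fun _ : ℕ => stdExp) n
  have h2 := ae_pos_stdExp
  rw [← h] at h2
  exact ae_of_ae_map (measurable_pi_apply n).aemeasurable h2

theorem lintegral_exp_neg_arrival (n : ℕ) :
    ∫⁻ ω, ENNReal.ofReal (Real.exp (-arrival n ω)) ∂expSeq = 2⁻¹ ^ n := by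
  induction n with
  | zero => simp [arrival]
  | succ n ih =>
    have e := lintegral_expSeq (fun s ω => ENNReal.ofReal (Real.exp (-s)) *
      ENNReal.ofReal (Real.exp (-arrival n ω))) (by unfold Function.uncurry; fun_prop)
    calc _ = _ := ?_
      _ = _ := e
      _ = _ := ?_
    · refine lintegral_congr fun ω => ?_
      rw [arrival_succ', neg_add, Real.exp_add, ENNReal.ofReal_mul (Real.exp_pos _).le]
    · have h2 := lintegral_exp_neg_mul two_pos
      simp_rw [lintegral_const_mul' _ _ ENNReal.ofReal_ne_top, ih]
      rw [lintegral_mul_const _ (by fun_prop), lintegral_stdExp _ (by fun_prop), pow_succ', 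
        ENNReal.ofReal_inv_of_pos two_pos, ENNReal.ofReal_ofNat] at *
      rw [← h2]
      congr 1
      refine lintegral_congr fun s => ?_
      rw [← ENNReal.ofReal_mul (Real.exp_pos _).le, ← Real.exp_add]
      ring_nf

/-- The means of e^{-arrival} are the summable powers 2^{-n}; hence these exponentials are almost
surely summable and tend to 0. -/
theorem ae_tendsto_arrival :
    ∀ᵐ ω ∂expSeq, Filter.Tendsto (fun n => arrival n ω) Filter.atTop Filter.atTop := by
  have h : ∫⁻ ω, ∑' n, ENNReal.ofReal (Real.exp (-arrival n ω)) ∂expSeq ≠ ∞ := by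
    rw [lintegral_tsum fun n => by fun_prop]
    simp only [lintegral_exp_neg_arrival, ENNReal.tsum_geometric]
    simp
  have hm : Measurable fun ω => ∑' n, ENNReal.ofReal (Real.exp (-arrival n ω)) :=
    Measurable.tsum fun n => by fun_prop
  filter_upwards [ae_lt_top hm h] with ω hω
  have h0 := ENNReal.tendsto_atTop_zero_of_tsum_ne_top hω.ne
  have h1 : Filter.Tendsto (fun n => Real.exp (-arrival n ω)) Filter.atTop (𝓝 0) := by
    have := (ENNReal.tendsto_toReal ENNReal.zero_ne_top).comp h0
    simpa [Function.comp_def, ENNReal.toReal_ofReal (Real.exp_pos _).le] using this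
  rw [Real.tendsto_exp_comp_nhds_zero] at h1
  exact Filter.tendsto_neg_atBot_iff.1 h1

theorem lintegral_expNeg_tsum_arrival {f : ℝ → ℝ≥0∞} (hf : Measurable f)
    (hfin : ∫⁻ s in Ioi 0, (1 - expNeg (f s)) ≠ ∞) :
    ∫⁻ ω, expNeg (∑' j, f (arrival (j + 1) ω)) ∂expSeq
      = expNeg (∫⁻ s in Ioi 0, (1 - expNeg (f s))) := by
  -- With this h the product in `lintegral_prod_arrival` at t = 0 is that of the e^{-f} at the
  -- arrival times. As n grows the tail factor tends to 1, since the arrival times diverge, and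
  -- dominated convergence applies.
  set h : ℝ → ℝ := (Ioi 0).indicator fun s => (1 - expNeg (f s)).toReal with hh
  have hle : ∀ s, 1 - expNeg (f s) ≤ 1 := fun s => tsub_le_self
  have hm : Measurable h := by
    refine Measurable.indicator ?_ measurableSet_Ioi
    fun_prop
  have h01 : ∀ s, h s ∈ Icc (0 : ℝ) 1 := by
    intro s
    by_cases hs : s ∈ Ioi (0 : ℝ)
    · simp only [hh, indicator_of_mem hs]
      exact ⟨ENNReal.toReal_nonneg, ENNReal.toReal_le_of_le_ofReal zero_le_one (by simp)⟩
    · simp [hh, indicator_of_notMem hs]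
  have hi : Integrable h := by
    rw [hh, integrable_indicator_iff measurableSet_Ioi]
    exact integrable_toReal_of_lintegral_ne_top (by fun_prop) hfin
  have hval : ∀ s, 0 < s → ENNReal.ofReal (1 - h s) = expNeg (f s) := by
    intro s hs
    rw [hh, indicator_of_mem (show s ∈ Ioi (0 : ℝ) from hs),
      ENNReal.toReal_sub_of_le (expNeg_le_one _) ENNReal.one_ne_top, ENNReal.toReal_one,
      sub_sub_cancel, ENNReal.ofReal_toReal (expNeg_ne_top _)]
  have hw : Real.exp (-tailIntegral h 0)
      = Real.exp (-(∫⁻ s in Ioi 0, (1 - expNeg (f s))).toReal) := by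
    congr 2
    rw [tailIntegral, setIntegral_indicator measurableSet_Ioi, inter_self, integral_toReal (by fun_prop)
      (ae_of_all _ fun s => (hle s).trans_lt ENNReal.one_lt_top)]
  have hlim : Filter.Tendsto (fun n => ∫⁻ ω,
      (∏ j ∈ Finset.range n, ENNReal.ofReal (1 - h (0 + arrival (j + 1) ω)))
        * ENNReal.ofReal (Real.exp (-tailIntegral h (0 + arrival n ω))) ∂expSeq) Filter.atTop
      (𝓝 (∫⁻ ω, expNeg (∑' j, f (arrival (j + 1) ω)) ∂expSeq)) := by
    have hmeasw := measurable_tailIntegral (fun s => (h01 s).1) hi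
    refine tendsto_lintegral_of_dominated_convergence (fun _ => 1) (fun n => by fun_prop)
      (fun n => ae_of_all _ fun ω => ?_) (by simp) ?_
    · refine mul_le_one' (Finset.prod_le_one' fun j _ => ?_) ?_
      · exact ENNReal.ofReal_le_one.2 (by linarith [(h01 (0 + arrival (j + 1) ω)).1])
      · refine ENNReal.ofReal_le_one.2 (Real.exp_le_one_iff.2 (neg_nonpos.2 ?_))
        exact integral_nonneg fun s => (h01 s).1
    · filter_upwards [ae_expSeq_pos, ae_tendsto_arrival] with ω hpos hω
      have hω1 : ∀ n, 0 < arrival (n + 1) ω := fun n =>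
        Finset.sum_pos (fun i _ => hpos i) (by simp)
      have e1 := tendsto_prod_expNeg fun j => f (arrival (j + 1) ω)
      have e2 : Filter.Tendsto (fun n => tailIntegral h (arrival n ω)) Filter.atTop (𝓝 0) :=
        tendsto_integral_Ioi_zero hω
      have e3 : Filter.Tendsto (fun n => ENNReal.ofReal
          (Real.exp (-tailIntegral h (arrival n ω)))) Filter.atTop (𝓝 1) := by
        have := ENNReal.tendsto_ofReal (e2.neg.rexp)
        simpa using this
      have e4 := ENNReal.Tendsto.mul e1 (Or.inr ENNReal.one_ne_top) e3
        (Or.inr (expNeg_ne_top _))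
      rw [mul_one] at e4
      simpa only [zero_add, hval _ (hω1 _)] using e4
  simp_rw [lintegral_prod_arrival hm h01 hi] at hlim
  rw [tendsto_nhds_unique hlim tendsto_const_nhds, hw, ← expNeg_ofReal ENNReal.toReal_nonneg,
    ENNReal.ofReal_toReal hfin]


/-! ### Recognizing Poisson processes by their Laplace functional -/

section
variable {Ω : Type} [MeasurableSpace Ω] {P : Measure Ω}

theorem tsum_sum_indicator {Ω : Type} {n : ℕ} (A : Fin n → Set ℝ) (c : Fin n → ℝ≥0∞) (ζ : ℕ → Ω → ℝ) (ω : Ω) :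
    ∑' j, ∑ i, c i * (A i).indicator (fun _ => 1) (ζ j ω) = ∑ i, c i * count ζ (A i) ω := by
  rw [Summable.tsum_finsetSum fun _ _ => ENNReal.summable]
  simp only [ENNReal.tsum_mul_left, count]

/-- By disjointness at most one indicator is nonzero at s, so t ↦ 1 - e^{-t} can be applied
termwise. -/
theorem one_sub_expNeg_sum_indicator {n : ℕ} {A : Fin n → Set ℝ}
    (hd : Pairwise fun i j => Disjoint (A i) (A j)) (c : Fin n → ℝ≥0∞) (s : ℝ) :
    1 - expNeg (∑ i, c i * (A i).indicator (fun _ => 1) s)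
      = ∑ i, (1 - expNeg (c i)) * (A i).indicator (fun _ => 1) s := by
  by_cases h : ∃ i, s ∈ A i
  · obtain ⟨i, hi⟩ := h
    have h0 : ∀ j, j ≠ i → (A j).indicator (fun _ => (1 : ℝ≥0∞)) s = 0 := fun j hj =>
      indicator_of_notMem (fun hs => Set.disjoint_left.1 (hd hj) hs hi) _
    rw [Finset.sum_eq_single i (fun j _ hj => by rw [h0 j hj, mul_zero]) (by simp),
      Finset.sum_eq_single i (fun j _ hj => by rw [h0 j hj, mul_zero]) (by simp),
      indicator_of_mem hi, mul_one, mul_one]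
  · push Not at h
    simp [indicator_of_notMem (h _)]

theorem lintegral_one_sub_expNeg_sum_indicator {ν : Measure ℝ} {n : ℕ} {A : Fin n → Set ℝ}
    (hA : ∀ i, MeasurableSet (A i)) (hd : Pairwise fun i j => Disjoint (A i) (A j))
    (c : Fin n → ℝ≥0∞) :
    ∫⁻ s, (1 - expNeg (∑ i, c i * (A i).indicator (fun _ => 1) s)) ∂ν
      = ∑ i, ν (A i) * (1 - expNeg (c i)) := by
  simp only [one_sub_expNeg_sum_indicator hd]
  rw [lintegral_finsetSum _ fun i _ => (measurable_const.indicator (hA i)).const_mul _]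
  refine Finset.sum_congr rfl fun i _ => ?_
  rw [lintegral_const_mul _ (measurable_const.indicator (hA i)),
    lintegral_indicator_const (hA i), one_mul, mul_comm]

instance (r : ℝ≥0) : IsProbabilityMeasure ((poissonMeasure r).map (Nat.cast : ℕ → ℝ≥0∞)) :=
  Measure.isProbabilityMeasure_map Measurable.of_discrete.aemeasurable

/-- A point process with the Laplace functional of a Poisson point process is one. -/
theorem isPoissonPointProcess_of_lintegral_expNeg [IsProbabilityMeasure P] {ν : Measure ℝ}
    {ζ : ℕ → Ω → ℝ} (hζ : ∀ j, Measurable (ζ j))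
    (h : ∀ f : ℝ → ℝ≥0∞, Measurable f → ∫⁻ s, (1 - expNeg (f s)) ∂ν ≠ ∞ →
      ∫⁻ ω, expNeg (∑' j, f (ζ j ω)) ∂P = expNeg (∫⁻ s, (1 - expNeg (f s)) ∂ν)) :
    IsPoissonPointProcess P ν ζ := by
  have key : ∀ (n : ℕ) (A : Fin n → Set ℝ), (∀ i, MeasurableSet (A i)) → (∀ i, ν (A i) ≠ ∞) →
      Pairwise (fun i j => Disjoint (A i) (A j)) →
      P.map (fun ω i => count ζ (A i) ω) = Measure.pi fun i =>
        (poissonMeasure (ν (A i)).toNNReal).map (Nat.cast : ℕ → ℝ≥0∞) := by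
    intro n A hA hν hd
    have hm : Measurable fun ω i => count ζ (A i) ω :=
      measurable_pi_lambda _ fun i => measurable_count hζ (hA i)
    have := Measure.isProbabilityMeasure_map (μ := P) hm.aemeasurable
    -- Test functions with integer values on disjoint sets yield the joint Laplace transform of the
    -- counts, which factorizes into Poisson transforms. The marginal laws and the independence
    -- follow together.
    refine ext_of_lintegral_expNeg_pi fun c => ?_
    rw [lintegral_map (by fun_prop) hm]
    simp only [← tsum_sum_indicator A (fun i => (c i : ℝ≥0∞)) ζ]
    have hI := lintegral_one_sub_expNeg_sum_indicator (ν := ν) hA hd fun i => (c i : ℝ≥0∞)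
    rw [h (fun s => ∑ i, (c i : ℝ≥0∞) * (A i).indicator (fun _ => 1) s)
      (Finset.measurable_sum _ fun i _ => (measurable_const.indicator (hA i)).const_mul _)
      (by
        rw [hI]
        exact ENNReal.sum_ne_top.2 fun i _ => ENNReal.mul_ne_top (hν i)
          (tsub_le_self.trans_lt ENNReal.one_lt_top).ne), hI, expNeg_sum]
    simp only [expNeg_sum]
    have hind : iIndepFun (fun (i : Fin n) (t : Fin n → ℝ≥0∞) => expNeg (c i * t i))
        (Measure.pi fun i => (poissonMeasure (ν (A i)).toNNReal).map (Nat.cast : ℕ → ℝ≥0∞)) :=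
      iIndepFun_pi (X := fun i t => expNeg (c i * t)) fun i => by fun_prop
    rw [lintegral_prod_eq_prod_lintegral_of_indepFun Finset.univ _ hind (fun i => by fun_prop)]
    refine Finset.prod_congr rfl fun i _ => ?_
    have := lintegral_expNeg_poisson (ν (A i)).toNNReal (c i)
    rw [ENNReal.coe_toNNReal (hν i)] at this
    rw [← this, ← lintegral_map (f := fun t => expNeg (c i * t)) (g := fun t : Fin n → ℝ≥0∞ => t i)
      (by fun_prop) (by fun_prop), (measurePreserving_eval _ i).map_eq]
  have hpois : ∀ A : Set ℝ, MeasurableSet A → ν A ≠ ∞ →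
      P.map (count ζ A) = (poissonMeasure (ν A).toNNReal).map (Nat.cast : ℕ → ℝ≥0∞) := by
    intro A hA hν
    have h1 := congrArg (Measure.map fun t : Fin 1 → ℝ≥0∞ => t 0)
      (key 1 (fun _ => A) (fun _ => hA) (fun _ => hν) Subsingleton.pairwise)
    rw [Measure.map_map (by fun_prop)
      (measurable_pi_lambda _ fun i => measurable_count hζ hA),
      (measurePreserving_eval (fun _ : Fin 1 => (poissonMeasure (ν A).toNNReal).map
        (Nat.cast : ℕ → ℝ≥0∞)) 0).map_eq] at h1
    exact h1
  refine ⟨hζ, hpois, fun n A hA hν hd => ?_⟩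
  rw [iIndepFun_iff_map_fun_eq_pi_map fun i => (measurable_count hζ (hA i)).aemeasurable,
    key n A hA hν hd]
  congr 1
  funext i
  exact (hpois (A i) (hA i) (hν i)).symm

end

/-! ### The intensity measure of a random energy model -/

theorem lintegral_remIntensity (m : ℝ) {F : ℝ → ℝ≥0∞} (hF : Measurable F) :
    ∫⁻ s, F s ∂remIntensity m
      = ∫⁻ s in Ioi 0, ENNReal.ofReal (m * s ^ (-m - 1)) * F s := by
  rw [remIntensity, lintegral_withDensity_eq_lintegral_mul _ (by fun_prop) hF]
  rfl

instance (m : ℝ) : SigmaFinite (remIntensity m) := SigmaFinite.withDensity_ofReal _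

/-- The substitution t = s^{-m} carries the intensity to Lebesgue measure on the half line; thus
powers -1/m of the standard arrival times form a REM(m). -/
theorem lintegral_remIntensity_rpow {m : ℝ} (hm : 0 < m) {F : ℝ → ℝ≥0∞} (hF : Measurable F) :
    ∫⁻ s, F s ∂remIntensity m = ∫⁻ t in Ioi 0, F (t ^ (-m⁻¹)) := by
  have himg : (fun s : ℝ => s ^ (-m)) '' Ioi 0 = Ioi 0 := by
    ext t
    constructor
    · rintro ⟨s, hs, rfl⟩
      exact Real.rpow_pos_of_pos hs _
    · intro ht
      refine ⟨t ^ (-m⁻¹), Real.rpow_pos_of_pos ht _, ?_⟩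
      simp only
      rw [← Real.rpow_mul (le_of_lt ht), neg_mul_neg, inv_mul_cancel₀ hm.ne', Real.rpow_one]
  have hinv : ∀ s ∈ Ioi (0 : ℝ), (s ^ (-m)) ^ (-m⁻¹) = s := fun s hs => by
    rw [← Real.rpow_mul (le_of_lt hs), neg_mul_neg, mul_inv_cancel₀ hm.ne', Real.rpow_one]
  have hinj : InjOn (fun s : ℝ => s ^ (-m)) (Ioi 0) := fun s hs t ht h => by
    rw [← hinv s hs, ← hinv t ht]
    simp only at h
    rw [h]
  have key := lintegral_image_eq_lintegral_abs_deriv_mul measurableSet_Ioi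
    (fun s hs => (Real.hasDerivAt_rpow_const (p := -m) (Or.inl (ne_of_gt hs))).hasDerivWithinAt)
    hinj fun t => F (t ^ (-m⁻¹))
  rw [himg] at key
  rw [key, lintegral_remIntensity m hF]
  refine setLIntegral_congr_fun measurableSet_Ioi fun s hs => ?_
  rw [hinv s hs, abs_mul, abs_neg, abs_of_pos hm, abs_of_pos (Real.rpow_pos_of_pos hs _)]

/-- The scaling property behind the whole computation: multiplying the points by A multiplies the
intensity by A^m, so independent random factors enter only through their m-th moment. -/
theorem lintegral_remIntensity_mul (m : ℝ) {F : ℝ → ℝ≥0∞} (hF : Measurable F) {A : ℝ} (hA : 0 < A) :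
    ∫⁻ s, F (A * s) ∂remIntensity m = ENNReal.ofReal (A ^ m) * ∫⁻ s, F s ∂remIntensity m := by
  have himg : (fun s : ℝ => A * s) '' Ioi 0 = Ioi 0 := by
    rw [image_mul_left_Ioi hA, mul_zero]
  have key := lintegral_image_eq_lintegral_abs_deriv_mul measurableSet_Ioi (s := Ioi (0 : ℝ))
    (f := fun s => A * s) (f' := fun _ => A)
    (fun s _ => by simpa using ((hasDerivAt_id s).const_mul A).hasDerivWithinAt)
    (fun s _ t _ h => mul_left_cancel₀ hA.ne' h)
    fun s => ENNReal.ofReal (A ^ m) * (ENNReal.ofReal (m * s ^ (-m - 1)) * F s)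
  rw [himg] at key
  rw [lintegral_remIntensity m hF, lintegral_remIntensity m (F := fun s => F (A * s)) (by fun_prop),
    ← lintegral_const_mul' _ _ ENNReal.ofReal_ne_top, key]
  refine setLIntegral_congr_fun measurableSet_Ioi fun s hs => ?_
  have hs : 0 < s := hs
  simp only [← mul_assoc]
  congr 1
  rw [← ENNReal.ofReal_mul (abs_nonneg _), ← ENNReal.ofReal_mul (by positivity), abs_of_pos hA]
  congr 1
  rw [Real.mul_rpow hA.le hs.le]
  have : A ^ (-m - 1) = (A ^ m)⁻¹ * A⁻¹ := by
    rw [Real.rpow_sub hA, Real.rpow_neg hA.le, Real.rpow_one]; rfl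
  rw [this]
  have := (Real.rpow_pos_of_pos hA m).ne'
  field_simp

/-- The exponent of the stable law obtained by summing the `p`-th powers of a REM(`m`), each
weighted so as to have Laplace exponent `c`. -/
def stableConst (m p : ℝ) (c : ℝ≥0∞) : ℝ≥0∞ :=
  ∫⁻ s, (1 - expNeg (c * ENNReal.ofReal s ^ p)) ∂remIntensity m

theorem lintegral_one_sub_expNeg_mul_rpow {m p : ℝ} (c : ℝ≥0∞) {A : ℝ} (hA : 0 < A) :
    ∫⁻ s, (1 - expNeg (c * ENNReal.ofReal (A * s) ^ p)) ∂remIntensity m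
      = ENNReal.ofReal (A ^ m) * stableConst m p c :=
  lintegral_remIntensity_mul m (F := fun s => 1 - expNeg (c * ENNReal.ofReal s ^ p))
    (by fun_prop) hA

/-- In the variable t = s^{-m} the integrand is at most 1 on (0,1] and at most c t^{-p/m} beyond,
which is integrable as m < p. This is where the strict increase of the orders x_l makes the cascade
summable. -/
theorem stableConst_ne_top {m p : ℝ} (hm : 0 < m) (hp : m < p) {c : ℝ≥0∞} (hc : c ≠ ∞) :
    stableConst m p c ≠ ∞ := by
  have h1 : ∫⁻ t in Ioi (0 : ℝ), ((Iic (1 : ℝ)).indicator (fun _ => 1) t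
      + (Ioi (1 : ℝ)).indicator (fun t => c * ENNReal.ofReal (t ^ (-(p / m)))) t) ≠ ∞ := by
    rw [lintegral_add_left (measurable_const.indicator measurableSet_Iic)]
    refine ENNReal.add_ne_top.2 ⟨?_, ?_⟩
    · rw [lintegral_indicator_const measurableSet_Iic, Measure.restrict_apply measurableSet_Iic,
        inter_comm, Ioi_inter_Iic]
      simp
    · rw [lintegral_indicator measurableSet_Ioi, Measure.restrict_restrict measurableSet_Ioi,
        Ioi_inter_Ioi, max_eq_left zero_le_one, lintegral_const_mul' _ _ hc]
      refine ENNReal.mul_ne_top hc ?_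
      have hI : IntegrableOn (fun t : ℝ => t ^ (-(p / m))) (Ioi 1) :=
        integrableOn_Ioi_rpow_of_lt (by
          have := (one_lt_div hm).2 hp
          linarith) one_pos
      rw [← ofReal_integral_eq_lintegral_ofReal hI]
      · exact ENNReal.ofReal_ne_top
      · filter_upwards [ae_restrict_mem measurableSet_Ioi] with t ht
        exact Real.rpow_nonneg (zero_le_one.trans (le_of_lt ht)) _
  refine ne_top_of_le_ne_top h1 ?_
  rw [stableConst, lintegral_remIntensity_rpow hm (by fun_prop)]
  refine setLIntegral_mono' measurableSet_Ioi fun t ht => ?_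
  have ht : 0 < t := ht
  by_cases h : t ≤ 1
  · rw [indicator_of_mem (show t ∈ Iic (1 : ℝ) from h)]
    exact tsub_le_self.trans le_self_add
  · rw [indicator_of_mem (show t ∈ Ioi (1 : ℝ) from not_le.1 h)]
    refine (one_sub_expNeg_le _).trans (le_add_left (le_of_eq ?_))
    rw [ENNReal.ofReal_rpow_of_pos (Real.rpow_pos_of_pos ht _), ← Real.rpow_mul ht.le]
    congr 3
    field_simp

theorem stableConst_pos {m p : ℝ} (hm : 0 < m) (hp : 0 < p) {c : ℝ≥0∞} (hc : c ≠ 0) :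
    stableConst m p c ≠ 0 := by
  rw [stableConst, lintegral_remIntensity_rpow hm (by fun_prop), Ne,
    setLIntegral_eq_zero_iff measurableSet_Ioi (by fun_prop)]
  intro h
  have h2 : ∀ᵐ t : ℝ, t ∉ Ioi (0 : ℝ) := by
    filter_upwards [h] with t ht ht0
    have h3 := ht ht0
    rw [tsub_eq_zero_iff_le, ← expNeg_zero, expNeg_strictAnti.le_iff_ge] at h3
    have h4 := le_zero_iff.1 h3
    rw [mul_eq_zero, ENNReal.rpow_eq_zero_iff_of_pos hp, ENNReal.ofReal_eq_zero] at h4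
    rcases h4 with h4 | h4
    · exact hc h4
    · exact absurd (Real.rpow_pos_of_pos ht0 (-m⁻¹)) (not_lt.2 h4)
  rw [← measure_eq_zero_iff_ae_notMem] at h2
  simp at h2

/-! ### Existence of the random energy model -/

theorem exists_isREM {m : ℝ} (hm : 0 < m) :
    IsREM expSeq m fun j ω => arrival (j + 1) ω ^ (-m⁻¹) := by
  have hpos : ∀ᵐ ω ∂expSeq, ∀ j, 0 < arrival (j + 1) ω := by
    filter_upwards [ae_expSeq_pos] with ω hω j
    exact Finset.sum_pos (fun i _ => hω i) (by simp)
  refine ⟨isPoissonPointProcess_of_lintegral_expNeg (fun j => by fun_prop) fun f hf hfin => ?_,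
    ?_, ?_⟩
  · have hfm : Measurable fun t : ℝ => f (t ^ (-m⁻¹)) := by fun_prop
    rw [lintegral_remIntensity_rpow hm (by fun_prop)] at hfin ⊢
    exact lintegral_expNeg_tsum_arrival hfm hfin
  · filter_upwards [hpos] with ω hω j
    exact Real.rpow_pos_of_pos (hω j) _
  · filter_upwards [ae_expSeq_pos, hpos] with ω hω hω1
    refine strictAnti_nat_of_succ_lt fun j => ?_
    refine Real.rpow_lt_rpow_of_neg (hω1 j) ?_ (neg_lt_zero.2 (inv_pos.2 hm))
    rw [arrival, arrival, Finset.sum_range_succ _ (j + 1)]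
    linarith [hω (j + 1)]


/-! ### Products of independent factors -/

/-- The inverse of `expNeg` on `[0,1]`. -/
def negLog (t : ℝ≥0∞) : ℝ≥0∞ := (-(ENNReal.log t)).toENNReal

theorem expNeg_negLog {t : ℝ≥0∞} (ht : t ≤ 1) : expNeg (negLog t) = t := by
  have h : 0 ≤ -ENNReal.log t := by
    rw [EReal.le_neg, neg_zero, ← ENNReal.log_one]
    exact ENNReal.log_monotone ht
  rw [expNeg, negLog, EReal.coe_toENNReal h, neg_neg, ENNReal.exp_log]

@[fun_prop]
theorem measurable_negLog : Measurable negLog := by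
  unfold negLog
  exact (ENNReal.measurable_log.neg).ereal_toENNReal

/-- Laplace transforms of independent terms multiply. Writing each as e^{-u_j} turns the infinite
product into a sum in the exponent, with no convergence assumption. -/
theorem lintegral_expNeg_tsum_infinitePi {Y : Type*} [MeasurableSpace Y] (ν : ℕ → Measure Y)
    [∀ j, IsProbabilityMeasure (ν j)] {h : ℕ → Y → ℝ≥0∞} (hm : ∀ j, Measurable (h j))
    {u : ℕ → ℝ≥0∞} (hu : ∀ j, ∫⁻ y, expNeg (h j y) ∂ν j = expNeg (u j)) :
    ∫⁻ ω, expNeg (∑' j, h j (ω j)) ∂Measure.infinitePi ν = expNeg (∑' j, u j) := by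
  refine tendsto_nhds_unique ?_ (tendsto_prod_expNeg u)
  have hind : iIndepFun (fun j (ω : ℕ → Y) => expNeg (h j (ω j))) (Measure.infinitePi ν) :=
    iIndepFun_infinitePi (X := fun j y => expNeg (h j y)) fun j => by have := hm j; fun_prop
  have e : ∀ n, ∏ j ∈ Finset.range n, expNeg (u j)
      = ∫⁻ ω, ∏ j ∈ Finset.range n, expNeg (h j (ω j)) ∂Measure.infinitePi ν := by
    intro n
    rw [lintegral_prod_eq_prod_lintegral_of_indepFun _ _ hind
      (fun j => by have := hm j; fun_prop)]
    refine Finset.prod_congr rfl fun j _ => ?_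
    rw [← hu j, ← lintegral_map (f := fun y => expNeg (h j y)) (g := fun ω : ℕ → Y => ω j)
      (by have := hm j; fun_prop) (by fun_prop), Measure.infinitePi_map_eval]
  simp only [e]
  refine tendsto_lintegral_of_dominated_convergence (fun _ => 1)
    (fun n => Finset.measurable_prod _ fun j _ => by have := hm j; fun_prop)
    (fun n => ae_of_all _ fun ω => Finset.prod_le_one' fun j _ => expNeg_le_one _) (by simp)
    (ae_of_all _ fun ω => tendsto_prod_expNeg _)

theorem infinitePi_prod_map_zip {ι X : Type*} [MeasurableSpace X] (μ ρ : ι → Measure X)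
    [∀ i, IsProbabilityMeasure (μ i)] [∀ i, IsProbabilityMeasure (ρ i)] :
    ((Measure.infinitePi μ).prod (Measure.infinitePi ρ)).map (fun p i => (p.1 i, p.2 i))
      = Measure.infinitePi fun i => (μ i).prod (ρ i) := by
  -- Both families are put into one product over ι × Bool, which can be split either by the Boolean
  -- or by the index i.
  let m : ι → Bool → Measure X := fun i b => if b then μ i else ρ i
  have : ∀ i b, IsProbabilityMeasure (m i b) := fun i b => by
    cases b <;> simp only [m] <;> infer_instance
  have h1 := infinitePi_map_prodMk (fun p : ι × Bool => m p.1 p.2) (f := fun i => (i, true))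
    (g := fun i => (i, false)) (fun i j h => by simpa using h) (fun i j h => by simpa using h)
    (fun i j h => by simp at h)
  have h2 := Measure.infinitePi_map_curry (fun i b => m i b)
  have h3 : ∀ i, (Measure.infinitePi fun b => m i b).map (fun z => (z true, z false))
      = (μ i).prod (ρ i) := fun i => by
    have h4 := infinitePi_map_prodMk_eval (fun b => m i b) true (g := fun _ : Unit => false)
      (Function.injective_of_subsingleton _) (by simp)
    have h5 := congrArg (Measure.map (Prod.map id (fun x : Unit → X => x ()))) h4
    rw [Measure.map_map (by fun_prop) (by fun_prop),
      ← Measure.map_prod_map _ _ (by fun_prop) (by fun_prop), Measure.infinitePi_map_eval,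
      Measure.map_id] at h5
    exact h5
  have h6 := Measure.infinitePi_map_pi (μ := fun i => Measure.infinitePi fun b => m i b)
    (f := fun _ (z : Bool → X) => (z true, z false)) (fun i => by fun_prop)
  simp only [h3] at h6
  rw [← h6, ← h2, Measure.map_map (by fun_prop) (by fun_prop)]
  change Measure.map _ ((Measure.infinitePi fun a => m a true).prod
    (Measure.infinitePi fun a => m a false)) = _
  rw [← h1, Measure.map_map (by fun_prop) (by fun_prop)]
  rfl

/-! ### The tree -/

/-- The root of the tree. -/
def root (k : ℕ) : Vertex (k + 1) := ⟨0, fun i => Fin.elim0 i⟩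

/-- The vertex `v` of the subtree above the `j`-th child of the root. -/
def child {k : ℕ} (j : ℕ) (v : Vertex k) : Vertex (k + 1) :=
  ⟨v.1.succ, (Fin.cons j v.2 : Fin ((v.1 : ℕ) + 1) → ℕ)⟩

theorem root_ne_child {k : ℕ} (j : ℕ) (v : Vertex k) : root k ≠ child j v := fun h =>
  (Fin.succ_ne_zero v.1).symm (congrArg Sigma.fst h)

theorem child_injective {k : ℕ} :
    Function.Injective fun p : ℕ × Vertex k => child p.1 p.2 := by
  rintro ⟨j, l, w⟩ ⟨j', l', w'⟩ h
  simp only [child, Sigma.mk.injEq, Fin.succ_inj] at h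
  obtain ⟨rfl, h⟩ := h
  have h := eq_of_heq h
  rw [Fin.cons_inj] at h
  rw [h.1, h.2]

/-- The branching property: the data at the root and in the subtrees above its children are all
independent. -/
theorem lintegral_vertex_succ {X : Type*} [MeasurableSpace X] {k : ℕ}
    (D : Vertex (k + 1) → Measure X) [∀ v, IsProbabilityMeasure (D v)]
    {F : X → (ℕ → Vertex k → X) → ℝ≥0∞} (hF : Measurable (Function.uncurry F)) :
    ∫⁻ ω, F (ω (root k)) (fun j v => ω (child j v)) ∂Measure.infinitePi D
      = ∫⁻ d, ∫⁻ θ, F d θ ∂(Measure.infinitePi fun j => Measure.infinitePi fun v => D (child j v))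
          ∂D (root k) := by
  have h1 := infinitePi_map_prodMk_eval D (root k) child_injective fun p => root_ne_child p.1 p.2
  have h2 := Measure.infinitePi_map_curry (fun (j : ℕ) (v : Vertex k) => D (child j v))
  have h0 := lintegral_prod (μ := D (root k)) (ν := Measure.infinitePi fun j =>
    Measure.infinitePi fun v => D (child j v)) _ hF.aemeasurable
  rw [← h2] at h0 ⊢
  have h3 := congrArg (Measure.map (Prod.map (id : X → X) (MeasurableEquiv.curry ℕ (Vertex k) X))) h1
  rw [← Measure.map_prod_map _ _ (by fun_prop) (by fun_prop), Measure.map_id,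
    Measure.map_map (by fun_prop) (by fun_prop)] at h3
  rw [← h3, lintegral_map hF (by fun_prop)] at h0
  exact h0

/-- The sum over the leaves of the tree, given the points and the increments of the field at its
vertices, when the field starts at `y`. -/
def treeSum (ψ : ℝ → ℝ) : (k : ℕ) → (Vertex k → (ℕ → ℝ) × (ℕ → ℝ)) → ℝ → ℝ≥0∞
  | 0, _, y => ENNReal.ofReal (Real.exp (ψ y))
  | k + 1, ω, y => ∑' j, ENNReal.ofReal ((ω (root k)).1 j)
      * treeSum ψ k (fun v => ω (child j v)) (y + (ω (root k)).2 j)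

theorem measurable_treeSum {ψ : ℝ → ℝ} (hψ : Measurable ψ) (k : ℕ) :
    Measurable fun p : (Vertex k → (ℕ → ℝ) × (ℕ → ℝ)) × ℝ => treeSum ψ k p.1 p.2 := by
  induction k with
  | zero => simp only [treeSum]; fun_prop
  | succ k ih =>
    simp only [treeSum]
    refine Measurable.tsum fun j => Measurable.mul (by fun_prop) ?_
    exact ih.comp (g := fun p : (Vertex k → (ℕ → ℝ) × (ℕ → ℝ)) × ℝ => treeSum ψ k p.1 p.2)
      (f := fun p : (Vertex (k + 1) → (ℕ → ℝ) × (ℕ → ℝ)) × ℝ =>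
        ((fun v => p.1 (child j v)), p.2 + (p.1 (root k)).2 j)) (by fun_prop)

/-- The constant in the Laplace exponent of the total mass of the cascade. -/
def cascadeConst : (k : ℕ) → (Fin (k + 1) → ℝ) → ℝ≥0∞
  | 0, _ => 1
  | k + 1, x => stableConst (x 0) (x 1) (cascadeConst k (Fin.tail x))

theorem cascadeConst_ne_top (k : ℕ) : ∀ x : Fin (k + 1) → ℝ, 0 < x 0 → StrictMono x →
    cascadeConst k x ≠ ∞ := by
  induction k with
  | zero => intro x _ _; simp [cascadeConst]
  | succ k ih =>
    intro x h0 hx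
    have h01 : x 0 < x 1 := hx Fin.zero_lt_one
    exact stableConst_ne_top h0 h01
      (ih (Fin.tail x) (h0.trans h01) fun i j h => hx (Fin.succ_lt_succ_iff.2 h))

theorem cascadeConst_ne_zero (k : ℕ) : ∀ x : Fin (k + 1) → ℝ, 0 < x 0 → StrictMono x →
    cascadeConst k x ≠ 0 := by
  induction k with
  | zero => intro x _ _; simp [cascadeConst]
  | succ k ih =>
    intro x h0 hx
    have h01 : x 0 < x 1 := hx Fin.zero_lt_one
    exact stableConst_pos h0 (h0.trans h01)
      (ih (Fin.tail x) (h0.trans h01) fun i j h => hx (Fin.succ_lt_succ_iff.2 h))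

/-- The law of the data at the vertices, given the laws of the points and the order parameter. -/
abbrev vertexLaw (g : ℝ → ℝ) {k : ℕ} (q : Fin (k + 1) → ℝ) (μ : Vertex k → Measure (ℕ → ℝ))
    (v : Vertex k) : Measure ((ℕ → ℝ) × (ℕ → ℝ)) :=
  (μ v).prod (Measure.infinitePi fun _ : ℕ =>
    gaussianReal 0 (g (q v.1.succ) - g (q v.1.castSucc)).toNNReal)

/-- Given the root data (s_j, η_j), the subtrees contribute c (r s_j e^{φ(y + η_j)})^{x_2} to the
exponent by induction. Averaging over the η_j leaves a Laplace functional of the REM(x_1), and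
scaling reduces it to E e^{x_1 φ(y + η)}, which is e^{x_1 times the next function of the recursion}.
-/
theorem lintegral_expNeg_treeSum {ψ : ℝ → ℝ} {C : ℝ≥0} (hψ : LipschitzWith C ψ) (g : ℝ → ℝ)
    (k : ℕ) : ∀ (q x : Fin (k + 1) → ℝ), 0 < x 0 → StrictMono x → x (Fin.last k) = 1 →
    ∀ (μ : Vertex k → Measure (ℕ → ℝ)) [∀ v, IsProbabilityMeasure (μ v)],
    (∀ v (f : ℝ → ℝ≥0∞), Measurable f → ∫⁻ z, expNeg (∑' j, f (z j)) ∂μ v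
      = expNeg (∫⁻ s, (1 - expNeg (f s)) ∂remIntensity (x v.1.castSucc))) →
    ∀ (y : ℝ) (r : ℝ≥0),
    ∫⁻ ω, expNeg (r * treeSum ψ k ω y) ∂Measure.infinitePi (vertexLaw g q μ)
      = expNeg (cascadeConst k x
          * (r * ENNReal.ofReal (Real.exp (recursion ψ g k q x y))) ^ x 0) := by
  induction k with
  | zero =>
    intro q x h0 hx hl μ _ hμ y r
    -- At a leaf the order is 1, which matches the linear exponent r e^{ψ(y)}.
    have hl : x 0 = 1 := hl
    simp only [treeSum, cascadeConst, recursion, hl, ENNReal.rpow_one, one_mul, lintegral_const,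
      measure_univ, mul_one]
  | succ k ih =>
    intro q x h0 hx hl μ _ hμ y r
    -- The scaling identity needs a positive factor, so r = 0 is treated separately.
    rcases eq_or_ne r 0 with rfl | hr
    · simp [h0]
    have h01 : x 0 < x 1 := hx Fin.zero_lt_one
    have h1 : 0 < x 1 := h0.trans h01
    set φ := recursion ψ g k (Fin.tail q) (Fin.tail x) with hφdef
    have hxt : StrictMono (Fin.tail x) := fun i j h => hx (Fin.succ_lt_succ_iff.2 h)
    have hφ : LipschitzWith C φ := recursion_lipschitz hψ g k _ _ (fun i => by
      have := hxt.monotone (Fin.zero_le i)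
      exact h1.le.trans this)
    have hφm : Measurable φ := hφ.continuous.measurable
    set c := cascadeConst k (Fin.tail x) with hc
    set v₁ := (g (q 1) - g (q 0)).toNNReal with hv₁
    set γ := gaussianReal 0 v₁ with hγ
    have hT := measurable_treeSum hψ.continuous.measurable k
    have ih' := fun j => ih (Fin.tail q) (Fin.tail x) h1 hxt hl (fun v => μ (child j v))
      (fun v f hf => hμ (child j v) f hf)
    -- integrate over the subtrees
    have s1 := lintegral_vertex_succ (vertexLaw g q μ)
      (F := fun d θ => expNeg (r * ∑' j, ENNReal.ofReal (d.1 j) * treeSum ψ k (θ j) (y + d.2 j)))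
      (by
        refine measurable_expNeg.comp (Measurable.const_mul (Measurable.tsum fun j =>
          Measurable.mul (by fun_prop) ?_) _)
        exact hT.comp (g := fun p : (Vertex k → (ℕ → ℝ) × (ℕ → ℝ)) × ℝ => treeSum ψ k p.1 p.2)
          (f := fun p : ((ℕ → ℝ) × (ℕ → ℝ)) × (ℕ → Vertex k → (ℕ → ℝ) × (ℕ → ℝ)) =>
            (p.2 j, y + p.1.2 j)) (by fun_prop))
    have s2 : ∀ d : (ℕ → ℝ) × (ℕ → ℝ), ∫⁻ θ, expNeg (r * ∑' j, ENNReal.ofReal (d.1 j)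
          * treeSum ψ k (θ j) (y + d.2 j))
          ∂(Measure.infinitePi fun j => Measure.infinitePi fun v => vertexLaw g q μ (child j v))
        = expNeg (∑' j, c * (((r * (d.1 j).toNNReal : ℝ≥0) : ℝ≥0∞)
            * ENNReal.ofReal (Real.exp (φ (y + d.2 j)))) ^ x 1) := by
      intro d
      have key := lintegral_expNeg_tsum_infinitePi
        (fun j => Measure.infinitePi fun v => vertexLaw g q μ (child j v))
        (h := fun j θ => ((r * (d.1 j).toNNReal : ℝ≥0) : ℝ≥0∞) * treeSum ψ k θ (y + d.2 j))
        (fun j => (hT.comp (measurable_id.prodMk measurable_const)).const_mul _)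
        (fun j => ih' j (y + d.2 j) (r * (d.1 j).toNNReal))
      refine Eq.trans (lintegral_congr fun θ => ?_) key
      rw [← ENNReal.tsum_mul_left]
      simp only [ENNReal.coe_mul, ← mul_assoc]
      rfl
    -- integrate over the increments
    set G : ℝ → ℝ≥0∞ := fun s => ∫⁻ η, expNeg (c * (((r * s.toNNReal : ℝ≥0) : ℝ≥0∞)
      * ENNReal.ofReal (Real.exp (φ (y + η)))) ^ x 1) ∂γ with hG
    have hjoint : Measurable fun p : ℝ × ℝ => expNeg (c * (((r * p.1.toNNReal : ℝ≥0) : ℝ≥0∞)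
      * ENNReal.ofReal (Real.exp (φ (y + p.2)))) ^ x 1) := by fun_prop
    have hGm : Measurable G := hjoint.lintegral_prod_right'
    have hG1 : ∀ s, G s ≤ 1 := fun s =>
      (lintegral_mono fun η => expNeg_le_one _).trans (by simp)
    have s3 : ∫⁻ d, expNeg (∑' j, c * (((r * (d.1 j).toNNReal : ℝ≥0) : ℝ≥0∞)
            * ENNReal.ofReal (Real.exp (φ (y + d.2 j)))) ^ x 1) ∂vertexLaw g q μ (root k)
        = ∫⁻ z, expNeg (∑' j, negLog (G (z j))) ∂μ (root k) := by
      have hm : Measurable fun d : (ℕ → ℝ) × (ℕ → ℝ) =>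
          expNeg (∑' j, c * (((r * (d.1 j).toNNReal : ℝ≥0) : ℝ≥0∞)
            * ENNReal.ofReal (Real.exp (φ (y + d.2 j)))) ^ x 1) :=
        measurable_expNeg.comp (Measurable.tsum fun j => by fun_prop)
      rw [lintegral_prod _ hm.aemeasurable]
      refine lintegral_congr fun z => ?_
      exact lintegral_expNeg_tsum_infinitePi (fun _ => γ)
        (h := fun j η => c * (((r * (z j).toNNReal : ℝ≥0) : ℝ≥0∞)
            * ENNReal.ofReal (Real.exp (φ (y + η)))) ^ x 1) (fun j => by fun_prop)
        (fun j => (expNeg_negLog (hG1 (z j))).symm)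
    -- integrate over the points
    have s4 : ∫⁻ s, (1 - expNeg (negLog (G s))) ∂remIntensity (x 0)
        = stableConst (x 0) (x 1) c
          * (r * ENNReal.ofReal (Real.exp (recursion ψ g (k + 1) q x y))) ^ x 0 := by
      have e1 : ∀ s, 1 - expNeg (negLog (G s)) = ∫⁻ η, (1 - expNeg (c *
          (((r * s.toNNReal : ℝ≥0) : ℝ≥0∞)
            * ENNReal.ofReal (Real.exp (φ (y + η)))) ^ x 1)) ∂γ := fun s => by
        rw [expNeg_negLog (hG1 s), lintegral_sub (by fun_prop)
          ((hG1 s).trans_lt ENNReal.one_lt_top).ne (ae_of_all _ fun η => expNeg_le_one _)]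
        simp [hG]
      simp only [e1]
      rw [lintegral_lintegral_swap (by fun_prop)]
      have e2 : ∀ η, ∫⁻ s, (1 - expNeg (c * (((r * s.toNNReal : ℝ≥0) : ℝ≥0∞)
            * ENNReal.ofReal (Real.exp (φ (y + η)))) ^ x 1)) ∂remIntensity (x 0)
          = (r : ℝ≥0∞) ^ x 0 * stableConst (x 0) (x 1) c
            * ENNReal.ofReal (Real.exp (x 0 * φ (y + η))) := fun η => by
        have hr' : 0 < (r : ℝ) := NNReal.coe_pos.2 (pos_iff_ne_zero.2 hr)
        have := lintegral_one_sub_expNeg_mul_rpow (m := x 0) (p := x 1) c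
          (A := r * Real.exp (φ (y + η))) (by positivity)
        rw [Real.mul_rpow hr'.le (Real.exp_pos _).le, ENNReal.ofReal_mul (by positivity),
          ← ENNReal.ofReal_rpow_of_pos hr', ENNReal.ofReal_coe_nnreal, ← Real.exp_mul,
          mul_comm (φ (y + η)), mul_assoc, mul_comm (ENNReal.ofReal _), ← mul_assoc] at this
        rw [← this]
        refine lintegral_congr fun s => ?_
        rw [ENNReal.ofReal_mul (by positivity), ENNReal.ofReal_mul hr'.le,
          ENNReal.ofReal_coe_nnreal, ENNReal.coe_mul]
        simp only [ENNReal.ofReal]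
        ring_nf
      simp only [e2]
      rw [lintegral_const_mul _ (by fun_prop), ← ofReal_integral_eq_lintegral_ofReal
        (integrable_exp_mul_shift hφ _ _ _) (ae_of_all _ fun _ => (Real.exp_pos _).le),
        ← exp_mul_gaussOp hφ h0.ne', ENNReal.mul_rpow_of_nonneg _ _ h0.le,
        ENNReal.ofReal_rpow_of_pos (Real.exp_pos _), ← Real.exp_mul, mul_comm (recursion _ _ _ _ _ _)]
      simp only [recursion]
      ring
    calc _ = _ := s1
      _ = _ := lintegral_congr s2
      _ = _ := s3
      _ = _ := hμ (root k) (fun s => negLog (G s)) (by fun_prop)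
      _ = _ := congrArg expNeg s4


/-! ### Gaussian processes are determined by mean and covariance -/

/-- The characteristic function of a finite family depends only on means and variances of linear
combinations; finite families determine the law on the product space. -/
theorem isGaussianProcess_map_eq {ι Ω Ω' : Type*} [MeasurableSpace Ω] [MeasurableSpace Ω']
    {P : Measure Ω} {P' : Measure Ω'} {X : ι → Ω → ℝ} {Y : ι → Ω' → ℝ}
    (hXm : ∀ i, Measurable (X i)) (hYm : ∀ i, Measurable (Y i))
    (hX : IsGaussianProcess X P) (hY : IsGaussianProcess Y P')
    (hmean : ∀ i, ∫ ω, X i ω ∂P = ∫ ω, Y i ω ∂P')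
    (hcov : ∀ i j, covariance (X i) (X j) P = covariance (Y i) (Y j) P') :
    P.map (fun ω i => X i ω) = P'.map fun ω i => Y i ω := by
  classical
  have := hX.isProbabilityMeasure
  have := hY.isProbabilityMeasure
  have hX2 : ∀ i, MemLp (X i) 2 P := fun i => (hX.hasGaussianLaw_eval i).memLp_two
  have hY2 : ∀ i, MemLp (Y i) 2 P' := fun i => (hY.hasGaussianLaw_eval i).memLp_two
  have hfin : ∀ I : Finset ι, P.map (fun ω => I.restrict (X · ω))
      = P'.map fun ω => I.restrict (Y · ω) := by
    intro I
    have hm1 : Measurable fun ω => I.restrict (X · ω) :=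
      measurable_pi_lambda _ fun i => hXm i
    have hm2 : Measurable fun ω => I.restrict (Y · ω) :=
      measurable_pi_lambda _ fun i => hYm i
    have := Measure.isProbabilityMeasure_map (μ := P) hm1.aemeasurable
    have := Measure.isProbabilityMeasure_map (μ := P') hm2.aemeasurable
    refine Measure.ext_of_charFunDual (funext fun L => ?_)
    rw [HasGaussianLaw.charFunDual_map_eq_fun L (hX.hasGaussianLaw I),
      HasGaussianLaw.charFunDual_map_eq_fun L (hY.hasGaussianLaw I)]
    obtain ⟨b, hL⟩ : ∃ b : I → ℝ, ∀ x : I → ℝ, L x = ∑ i, b i * x i := by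
      refine ⟨fun i => L (Pi.single i 1), fun x => ?_⟩
      conv_lhs => rw [pi_eq_sum_univ' x, map_sum]
      refine Finset.sum_congr rfl fun i _ => ?_
      rw [map_smul, smul_eq_mul, mul_comm]
    simp only [hL, Finset.restrict]
    have h1 : ∫ ω, ∑ i : I, b i * X i ω ∂P
        = ∫ ω, ∑ i : I, b i * Y i ω ∂P' := by
      rw [integral_finsetSum _ fun (i : I) _ => ((hX2 i).integrable one_le_two).const_mul _,
        integral_finsetSum _ fun (i : I) _ => ((hY2 i).integrable one_le_two).const_mul _]
      simp only [integral_const_mul, hmean]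
    have h2 : variance (fun ω => ∑ i : I, b i * X i ω) P
        = variance (fun ω => ∑ i : I, b i * Y i ω) P' := by
      rw [← covariance_self (Measurable.aemeasurable (by fun_prop)),
        ← covariance_self (Measurable.aemeasurable (by fun_prop)),
        covariance_fun_sum_fun_sum (fun i : I => (hX2 i).const_mul _)
          (fun i : I => (hX2 i).const_mul _),
        covariance_fun_sum_fun_sum (fun i : I => (hY2 i).const_mul _)
          (fun i : I => (hY2 i).const_mul _)]
      simp only [covariance_const_mul_left, covariance_const_mul_right, hcov]
    rw [h1, h2]
  refine IsProjectiveLimit.unique (P := fun I => P.map (fun ω => I.restrict (X · ω)))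
    (fun I => ?_) (fun I => ?_)
  · rw [Measure.map_map (by fun_prop) (by fun_prop)]
    rfl
  · rw [Measure.map_map (by fun_prop) (by fun_prop)]
    exact (hfin I).symm

/-! ### The canonical field -/

/-- The variances of the increments of the field at the root and at the children of `v`. -/
def markVar (g : ℝ → ℝ) {k : ℕ} (q : Fin (k + 1) → ℝ) : Option (Vertex k × ℕ) → ℝ≥0
  | none => (g (q 0) - g 0).toNNReal
  | some p => (g (q p.1.1.succ) - g (q p.1.1.castSucc)).toNNReal

/-- The law of the increments of the field. -/
abbrev markLaw (g : ℝ → ℝ) {k : ℕ} (q : Fin (k + 1) → ℝ) :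
    Measure (Option (Vertex k × ℕ) → ℝ) :=
  Measure.infinitePi fun o => gaussianReal 0 (markVar g q o)

/-- The edges from the root to the leaf `α`. -/
def path {k : ℕ} (α : Fin k → ℕ) : Option (Fin k) → Option (Vertex k × ℕ) :=
  Option.map fun l => (trunc α l, α l)

/-- The field with given increments. -/
def canonicalField {k : ℕ} (α : Fin k → ℕ) (M : Option (Vertex k × ℕ) → ℝ) : ℝ :=
  ∑ o, M (path α o)

@[fun_prop]
theorem measurable_canonicalField {k : ℕ} (α : Fin k → ℕ) : Measurable (canonicalField α) := by
  unfold canonicalField; fun_prop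

theorem hasGaussianLaw_mark (g : ℝ → ℝ) {k : ℕ} (q : Fin (k + 1) → ℝ)
    (o : Option (Vertex k × ℕ)) : HasGaussianLaw (fun M => M o) (markLaw g q) := by
  refine ⟨?_⟩
  rw [Measure.infinitePi_map_eval]
  infer_instance

theorem isGaussianProcess_mark (g : ℝ → ℝ) {k : ℕ} (q : Fin (k + 1) → ℝ) :
    IsGaussianProcess (fun o (M : Option (Vertex k × ℕ) → ℝ) => M o) (markLaw g q) := by
  refine ⟨fun I => ?_⟩
  have h : iIndepFun (fun o (M : Option (Vertex k × ℕ) → ℝ) => M o) (markLaw g q) :=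
    iIndepFun_infinitePi (X := fun _ x => x) fun _ => measurable_id
  exact (h.precomp (g := fun o : I => (o : Option (Vertex k × ℕ)))
    Subtype.val_injective).hasGaussianLaw fun o => hasGaussianLaw_mark g q o

theorem isGaussianProcess_canonicalField (g : ℝ → ℝ) {k : ℕ} (q : Fin (k + 1) → ℝ) :
    IsGaussianProcess (canonicalField (k := k)) (markLaw g q) := by
  classical
  refine ⟨fun I => ?_⟩
  set J := I.biUnion fun α => Finset.univ.image (path α) with hJ
  have hmem : ∀ (α : I) o, path (α : Fin k → ℕ) o ∈ J := fun α o =>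
    Finset.mem_biUnion.2 ⟨α, α.2, Finset.mem_image_of_mem _ (Finset.mem_univ o)⟩
  let K : (J → ℝ) →L[ℝ] I → ℝ := ContinuousLinearMap.pi fun α =>
    ∑ o, ContinuousLinearMap.proj ⟨path (α : Fin k → ℕ) o, hmem α o⟩
  have h := ((isGaussianProcess_mark g q).hasGaussianLaw J).map_fun K
  have e : (fun M => I.restrict fun α => canonicalField α M)
      = fun M : Option (Vertex k × ℕ) → ℝ => K (J.restrict fun o => M o) := by
    funext M α
    simp [K, canonicalField, Finset.restrict]
  rw [e]
  exact h

theorem integral_mark (g : ℝ → ℝ) {k : ℕ} (q : Fin (k + 1) → ℝ) (o : Option (Vertex k × ℕ)) :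
    ∫ M, M o ∂markLaw g q = 0 := by
  have h := integral_map (μ := markLaw g q) (φ := fun M => M o) (f := fun x : ℝ => x)
    (Measurable.aemeasurable (by fun_prop)) (by fun_prop)
  rw [Measure.infinitePi_map_eval, integral_id_gaussianReal] at h
  exact h.symm

theorem integral_canonicalField (g : ℝ → ℝ) {k : ℕ} (q : Fin (k + 1) → ℝ) (α : Fin k → ℕ) :
    ∫ M, canonicalField α M ∂markLaw g q = 0 := by
  unfold canonicalField
  rw [integral_finsetSum _ fun o _ =>
    ((hasGaussianLaw_mark g q (path α o)).memLp_two.integrable one_le_two)]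
  simp [integral_mark]

open Classical in
theorem covariance_mark (g : ℝ → ℝ) {k : ℕ} (q : Fin (k + 1) → ℝ) (o o' : Option (Vertex k × ℕ)) :
    covariance (fun M => M o) (fun M => M o') (markLaw g q)
      = if o = o' then (markVar g q o : ℝ) else 0 := by
  split_ifs with h
  · subst h
    rw [covariance_self (Measurable.aemeasurable (by fun_prop))]
    have h := variance_map (μ := markLaw g q) (Y := fun M => M o) (X := fun x : ℝ => x)
      (by fun_prop) (Measurable.aemeasurable (by fun_prop))
    rw [Measure.infinitePi_map_eval, variance_fun_id_gaussianReal] at h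
    exact h.symm
  · have hi : iIndepFun (fun o (M : Option (Vertex k × ℕ) → ℝ) => M o) (markLaw g q) :=
      iIndepFun_infinitePi (X := fun _ x => x) fun _ => measurable_id
    exact (hi.indepFun h).covariance_eq_zero (hasGaussianLaw_mark g q o).memLp_two
      (hasGaussianLaw_mark g q o').memLp_two

/-- Two branches share an edge only at the same level, and only if the leaves agree up to and
including it. -/
theorem path_eq_path_iff {k : ℕ} (α β : Fin k → ℕ) (o o' : Option (Fin k)) :
    path α o = path β o' ↔ o = o' ∧ ∀ l ∈ o, ∀ i ≤ l, α i = β i := by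
  cases o with
  | none => cases o' <;> simp [path]
  | some l =>
    cases o' with
    | none => simp [path]
    | some l' =>
      simp only [path, Option.map_some, Option.some.injEq, Prod.mk.injEq, trunc, Sigma.mk.injEq,
        Option.mem_def, forall_eq']
      constructor
      · rintro ⟨⟨rfl, h⟩, h2⟩
        refine ⟨rfl, fun i hi => ?_⟩
        rcases hi.lt_or_eq with hi | rfl
        · exact congrFun (eq_of_heq h) ⟨i, hi⟩
        · exact h2
      · rintro ⟨rfl, h⟩
        refine ⟨⟨rfl, heq_of_eq (funext fun i => h _ ?_)⟩, h l le_rfl⟩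
        exact Fin.le_def.2 i.2.le

open Classical in
theorem sum_telescope {k : ℕ} (G : Fin (k + 1) → ℝ) (L : Fin (k + 1)) :
    ∑ l : Fin k, (if l.succ ≤ L then G l.succ - G l.castSucc else 0) = G L - G 0 := by
  induction L using Fin.induction with
  | zero => simp [Fin.succ_ne_zero]
  | succ i ih =>
    have h : ∀ l : Fin k, (if l.succ ≤ i.succ then G l.succ - G l.castSucc else 0)
        = (if l.succ ≤ i.castSucc then G l.succ - G l.castSucc else 0)
          + if l = i then G i.succ - G i.castSucc else 0 := by
      intro l
      simp only [Fin.succ_le_succ_iff, Fin.succ_le_castSucc_iff]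
      rcases lt_trichotomy l i with h | h | h
      · simp [h, h.le, h.ne]
      · simp [h]
      · simp [h.not_ge, h.not_gt, h.ne']
    simp only [h, Finset.sum_add_distrib, ih, Finset.sum_ite_eq', Finset.mem_univ, if_true]
    ring

/-- Only the increments on the common initial part of the two branches contribute. Their variances
telescope from g(0) = 0 to g at the position of the last common level, which is the overlap. -/
theorem covariance_canonicalField {g : ℝ → ℝ} (a : Atomic) (hg : MonotoneOn g (Icc 0 1))
    (hg0 : g 0 = 0) (α β : Fin a.k → ℕ) :
    covariance (canonicalField α) (canonicalField β) (markLaw g a.q) = g (a.overlap α β) := by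
  classical
  have hG : Monotone fun i => g (a.q i) := fun i j h =>
    hg (a.q_mem i) (a.q_mem j) (a.q_mono.monotone h)
  have hG0 : 0 ≤ g (a.q 0) := by
    rw [← hg0]
    exact hg ⟨le_rfl, zero_le_one⟩ (a.q_mem 0) a.q_nonneg
  unfold canonicalField
  rw [covariance_fun_sum_fun_sum (fun o => (hasGaussianLaw_mark g a.q (path α o)).memLp_two)
    fun o => (hasGaussianLaw_mark g a.q (path β o)).memLp_two]
  simp only [covariance_mark, path_eq_path_iff, ite_and, Finset.sum_ite_eq, Finset.mem_univ,
    if_true]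
  set S := Finset.univ.filter fun l : Fin (a.k + 1) =>
      ∀ i : Fin a.k, (i : ℕ) < (l : ℕ) → α i = β i with hS
  have hSne : S.Nonempty := ⟨0, by simp [hS]⟩
  obtain ⟨L, hL, hmax⟩ := S.exists_max_image id hSne
  have hoverlap : a.overlap α β = a.q L := by
    refine le_antisymm (Finset.sup'_le _ _ fun l hl => a.q_mono.monotone (hmax l ?_))
      (Finset.le_sup' a.q ?_)
    · convert hl
    · convert hL
  have hmem : ∀ l : Fin a.k, (∀ i ≤ l, α i = β i) ↔ l.succ ≤ L := by
    intro l
    constructor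
    · intro h
      refine hmax l.succ ?_
      simp only [hS, Finset.mem_filter, Finset.mem_univ, true_and, Fin.val_succ]
      exact fun i hi => h i (Nat.lt_succ_iff.1 hi)
    · intro h i hi
      simp only [hS, Finset.mem_filter, Finset.mem_univ, true_and] at hL
      exact hL i (lt_of_lt_of_le (Nat.lt_succ_iff.2 hi) h)
  rw [Fintype.sum_option, hoverlap]
  simp only [Option.mem_def, Option.some.injEq, forall_eq', hmem, reduceCtorEq, false_implies,
    implies_true, if_true]
  have h1 : ∀ l : Fin a.k, (markVar g a.q (path α (some l)) : ℝ)
      = g (a.q l.succ) - g (a.q l.castSucc) := fun l =>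
    Real.coe_toNNReal _ (sub_nonneg.2 (hG l.castSucc_lt_succ.le))
  have h0 : (markVar g a.q (path α none) : ℝ) = g (a.q 0) := by
    have : (markVar g a.q (path α none) : ℝ) = g (a.q 0) - g 0 :=
      Real.coe_toNNReal _ (by linarith)
    rw [this, hg0, sub_zero]
  simp only [h1, h0]
  rw [sum_telescope (fun i => g (a.q i))]
  ring


/-! ### The tree sum as a sum over the leaves -/

theorem trunc_cons_zero {k : ℕ} (j : ℕ) (α : Fin k → ℕ) :
    trunc (Fin.cons j α : Fin (k + 1) → ℕ) 0 = root k := by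
  unfold trunc root
  congr 1
  funext i
  exact Fin.elim0 i

theorem trunc_cons_succ {k : ℕ} (j : ℕ) (α : Fin k → ℕ) (l : Fin k) :
    trunc (Fin.cons j α : Fin (k + 1) → ℕ) l.succ = child j (trunc α l) := by
  unfold trunc child
  congr 1
  funext i
  refine Fin.cases ?_ (fun i => ?_) i <;> rfl

/-- The sum over the leaves `α` of `ξ_α e^{ψ(u_α)}`, where `ξ` is the cascade with points `Z`. -/
def leafSum (ψ : ℝ → ℝ) {k : ℕ} (Z : Vertex k → ℕ → ℝ) (u : (Fin k → ℕ) → ℝ) : ℝ≥0∞ :=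
  ∑' α, (∏ l, ENNReal.ofReal (Z (trunc α l) (α l))) * ENNReal.ofReal (Real.exp (ψ (u α)))

theorem measurable_leafSum {ψ : ℝ → ℝ} (hψ : Measurable ψ) (k : ℕ) :
    Measurable fun p : (Vertex k → ℕ → ℝ) × ((Fin k → ℕ) → ℝ) => leafSum ψ p.1 p.2 := by
  unfold leafSum
  exact Measurable.tsum fun α => by fun_prop

theorem treeSum_eq_leafSum (ψ : ℝ → ℝ) (k : ℕ) : ∀ (ω : Vertex k → (ℕ → ℝ) × (ℕ → ℝ)) (y : ℝ),
    treeSum ψ k ω y = leafSum ψ (fun v => (ω v).1)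
      fun α => y + ∑ l, (ω (trunc α l)).2 (α l) := by
  induction k with
  | zero =>
    intro ω y
    rw [leafSum, tsum_fintype, Fintype.sum_unique]
    simp [treeSum]
  | succ k ih =>
    intro ω y
    simp only [treeSum, ih]
    rw [leafSum, ← (Fin.consEquiv fun _ : Fin (k + 1) => ℕ).tsum_eq,
      ENNReal.summable.tsum_prod' fun _ => ENNReal.summable]
    refine tsum_congr fun j => ?_
    rw [leafSum, ← ENNReal.tsum_mul_left]
    refine tsum_congr fun α => ?_
    change _ = (∏ l, ENNReal.ofReal ((ω (trunc (Fin.cons j α : Fin (k + 1) → ℕ) l)).1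
        ((Fin.cons j α : Fin (k + 1) → ℕ) l))) * ENNReal.ofReal (Real.exp (ψ (y + ∑ l,
          (ω (trunc (Fin.cons j α : Fin (k + 1) → ℕ) l)).2 ((Fin.cons j α : Fin (k + 1) → ℕ) l))))
    simp only [Fin.prod_univ_succ, Fin.sum_univ_succ, trunc_cons_zero,
      trunc_cons_succ, Fin.cons_zero, Fin.cons_succ, add_assoc, mul_assoc]

theorem leafSum_canonicalField (ψ : ℝ → ℝ) {k : ℕ} (Z : Vertex k → ℕ → ℝ)
    (M : Option (Vertex k × ℕ) → ℝ) :
    leafSum ψ Z (fun α => canonicalField α M)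
      = treeSum ψ k (fun v => (Z v, fun j => M (some (v, j)))) (M none) := by
  rw [treeSum_eq_leafSum]
  simp only [canonicalField, Fintype.sum_option, path, Option.map_none, Option.map_some]

/-! ### The law of the cascade with its field -/

section
variable {Ω : Type} [MeasurableSpace Ω] {P : Measure Ω} {a : Atomic} {g : ℝ → ℝ}
  {ζ : Vertex a.k → ℕ → Ω → ℝ} {κ : (Fin a.k → ℕ) → Ω → ℝ}

theorem IsGREM.measurable_points (h : IsGREM P a g ζ κ) : Measurable fun ω v j => ζ v j ω :=
  measurable_pi_lambda _ fun v => measurable_pi_lambda _ fun j => (h.rem v).ppp.measurable j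

theorem IsGREM.measurable_field (h : IsGREM P a g ζ κ) : Measurable fun ω α => κ α ω :=
  measurable_pi_lambda _ fun α => h.field_measurable α

/-- Any realization may be computed with the canonical field, because independence and the
covariance fix the joint law; hence the functional depends only on the atomic measure. -/
theorem IsGREM.map_eq (h : IsGREM P a g ζ κ) (hg : MonotoneOn g (Icc 0 1)) (hg0 : g 0 = 0) :
    P.map (fun ω => ((fun v j => ζ v j ω), fun α => κ α ω))
      = (Measure.infinitePi fun v => P.map fun ω j => ζ v j ω).prod
        ((markLaw g a.q).map fun M α => canonicalField α M) := by
  have := h.isProb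
  have hζ : ∀ v, Measurable fun ω j => ζ v j ω := fun v =>
    measurable_pi_lambda _ fun j => (h.rem v).ppp.measurable j
  rw [(indepFun_iff_map_prod_eq_prod_map_map h.measurable_points.aemeasurable
    h.measurable_field.aemeasurable).1 h.field_indep,
    (iIndepFun_iff_map_fun_eq_infinitePi_map hζ).1 h.rem_indep]
  congr 1
  refine isGaussianProcess_map_eq h.field_measurable (fun α => by fun_prop) h.field_gaussian
    (isGaussianProcess_canonicalField g a.q) (fun α => ?_) fun α β => ?_
  · rw [h.field_mean, integral_canonicalField]
  · rw [h.field_cov, covariance_canonicalField a hg hg0]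

theorem lintegral_markLaw (g : ℝ → ℝ) {k : ℕ} (q : Fin (k + 1) → ℝ)
    {F : ℝ → (Vertex k → ℕ → ℝ) → ℝ≥0∞} (hF : Measurable (Function.uncurry F)) :
    ∫⁻ M, F (M none) (fun v j => M (some (v, j))) ∂markLaw g q
      = ∫⁻ η, ∫⁻ N, F η N ∂(Measure.infinitePi fun v : Vertex k => Measure.infinitePi fun _ : ℕ =>
          gaussianReal 0 (g (q v.1.succ) - g (q v.1.castSucc)).toNNReal)
        ∂gaussianReal 0 (g (q 0) - g 0).toNNReal := by
  have h1 := infinitePi_map_prodMk_eval (fun o => gaussianReal 0 (markVar g q o)) none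
    (Option.some_injective _) fun p => (Option.some_ne_none p).symm
  have h2 := Measure.infinitePi_map_curry (fun (v : Vertex k) (_ : ℕ) =>
    gaussianReal 0 (g (q v.1.succ) - g (q v.1.castSucc)).toNNReal)
  have h0 := lintegral_prod (μ := gaussianReal 0 (g (q 0) - g 0).toNNReal)
    (ν := Measure.infinitePi fun v : Vertex k => Measure.infinitePi fun _ : ℕ =>
          gaussianReal 0 (g (q v.1.succ) - g (q v.1.castSucc)).toNNReal) _ hF.aemeasurable
  rw [← h2] at h0 ⊢
  have h3 := congrArg (Measure.map (Prod.map (id : ℝ → ℝ)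
    (MeasurableEquiv.curry (Vertex k) ℕ ℝ))) h1
  rw [← Measure.map_prod_map _ _ (by fun_prop) (by fun_prop), Measure.map_id,
    Measure.map_map (by fun_prop) (by fun_prop)] at h3
  change _ = (gaussianReal 0 (g (q 0) - g 0).toNNReal).prod (Measure.map _ (Measure.infinitePi
    fun p : Vertex k × ℕ =>
      gaussianReal 0 (g (q p.1.1.succ) - g (q p.1.1.castSucc)).toNNReal)) at h3
  rw [← h3, lintegral_map hF (by fun_prop)] at h0
  exact h0

theorem IsGREM.lintegral_expNeg_leafSum (h : IsGREM P a g ζ κ) (hg : MonotoneOn g (Icc 0 1))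
    (hg0 : g 0 = 0) {ψ : ℝ → ℝ} {C : ℝ≥0} (hψ : LipschitzWith C ψ) (r : ℝ≥0) :
    ∫⁻ ω, expNeg (r * leafSum ψ (fun v j => ζ v j ω) fun α => κ α ω) ∂P
      = ∫⁻ η, expNeg (cascadeConst a.k a.x
          * (r * ENNReal.ofReal (Real.exp (recursion ψ g a.k a.q a.x η))) ^ a.x 0)
        ∂gaussianReal 0 (g (a.q 0) - g 0).toNNReal := by
  have := h.isProb
  have hζ : ∀ v, Measurable fun ω j => ζ v j ω := fun v =>
    measurable_pi_lambda _ fun j => (h.rem v).ppp.measurable j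
  have hψm := hψ.continuous.measurable
  have hL := measurable_leafSum hψm a.k
  have hT := measurable_treeSum hψm a.k
  have hm : Measurable fun p : (Vertex a.k → ℕ → ℝ) × ((Fin a.k → ℕ) → ℝ) =>
    expNeg (r * leafSum ψ p.1 p.2) := measurable_expNeg.comp (hL.const_mul _)
  set μ : Vertex a.k → Measure (ℕ → ℝ) := fun v => P.map fun ω j => ζ v j ω with hμ
  have : ∀ v, IsProbabilityMeasure (μ v) := fun v =>
    Measure.isProbabilityMeasure_map (hζ v).aemeasurable
  set ρ : Measure (Vertex a.k → ℕ → ℝ) := Measure.infinitePi fun v : Vertex a.k =>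
    Measure.infinitePi fun _ : ℕ =>
      gaussianReal 0 (g (a.q v.1.succ) - g (a.q v.1.castSucc)).toNNReal with hρ
  have hcf : Measurable fun (M : Option (Vertex a.k × ℕ) → ℝ) α => canonicalField α M :=
    measurable_pi_lambda _ fun α => by fun_prop
  have htree : Measurable fun p : ((Vertex a.k → ℕ → ℝ) × ℝ) × (Vertex a.k → ℕ → ℝ) =>
      expNeg (r * treeSum ψ a.k (fun v => (p.1.1 v, p.2 v)) p.1.2) :=
    measurable_expNeg.comp (Measurable.const_mul (hT.comp
      (f := fun p : ((Vertex a.k → ℕ → ℝ) × ℝ) × (Vertex a.k → ℕ → ℝ) =>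
        ((fun v => (p.1.1 v, p.2 v)), p.1.2)) (by fun_prop)) _)
  have s1 : ∫⁻ ω, expNeg (r * leafSum ψ (fun v j => ζ v j ω) fun α => κ α ω) ∂P
      = ∫⁻ Z, ∫⁻ M, expNeg (r * leafSum ψ Z fun α => canonicalField α M) ∂markLaw g a.q
          ∂Measure.infinitePi μ := by
    rw [← lintegral_map (μ := P) (f := fun p : (Vertex a.k → ℕ → ℝ) × ((Fin a.k → ℕ) → ℝ) =>
      expNeg (r * leafSum ψ p.1 p.2)) hm (h.measurable_points.prodMk h.measurable_field),
      h.map_eq hg hg0, lintegral_prod _ hm.aemeasurable]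
    refine lintegral_congr fun Z => ?_
    exact lintegral_map (hm.comp measurable_prodMk_left) hcf
  have s2 : ∀ Z : Vertex a.k → ℕ → ℝ,
      ∫⁻ M, expNeg (r * leafSum ψ Z fun α => canonicalField α M) ∂markLaw g a.q
      = ∫⁻ η, ∫⁻ N, expNeg (r * treeSum ψ a.k (fun v => (Z v, N v)) η) ∂ρ
          ∂gaussianReal 0 (g (a.q 0) - g 0).toNNReal := fun Z => by
    simp only [leafSum_canonicalField]
    exact lintegral_markLaw g a.q
      (F := fun η N => expNeg (r * treeSum ψ a.k (fun v => (Z v, N v)) η))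
      (htree.comp (f := fun p : ℝ × (Vertex a.k → ℕ → ℝ) => ((Z, p.1), p.2)) (by fun_prop))
  have s3 : ∀ η : ℝ, ∫⁻ Z, ∫⁻ N, expNeg (r * treeSum ψ a.k (fun v => (Z v, N v)) η) ∂ρ
        ∂Measure.infinitePi μ
      = ∫⁻ ω, expNeg (r * treeSum ψ a.k ω η) ∂Measure.infinitePi (vertexLaw g a.q μ) := fun η => by
    rw [← lintegral_prod (μ := Measure.infinitePi μ) (ν := ρ)
      (fun p => expNeg (r * treeSum ψ a.k (fun v => (p.1 v, p.2 v)) η))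
      (htree.comp (f := fun p : (Vertex a.k → ℕ → ℝ) × (Vertex a.k → ℕ → ℝ) =>
        ((p.1, η), p.2)) (by fun_prop)).aemeasurable, ← infinitePi_prod_map_zip μ]
    exact (lintegral_map (measurable_expNeg.comp ((hT.comp
      (measurable_id.prodMk measurable_const)).const_mul _)) (by fun_prop)).symm
  rw [s1]
  simp only [s2]
  -- The root increment η is integrated last: it is common to all leaves and produces the final
  -- average of order 0.
  rw [lintegral_lintegral_swap htree.lintegral_prod_right'.aemeasurable]
  simp only [s3]
  refine lintegral_congr fun η => ?_
  refine RPC.lintegral_expNeg_treeSum hψ g a.k a.q a.x a.x_pos a.x_mono a.x_last μ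
    (fun v f hf => ?_) η r
  have hfm : Measurable fun z : ℕ → ℝ => expNeg (∑' j, f (z j)) :=
    measurable_expNeg.comp (Measurable.tsum fun j => by fun_prop)
  exact (lintegral_map hfm (hζ v)).trans (lintegral_expNeg_tsum (h.rem v).ppp hf)

theorem recursion_zero (g : ℝ → ℝ) : ∀ (k : ℕ) (q x : Fin (k + 1) → ℝ),
    recursion (fun _ => 0) g k q x = fun _ => 0
  | 0, _, _ => rfl
  | k + 1, q, x => by
    rw [recursion, recursion_zero g k]
    funext y
    simp [gaussOp]

theorem IsGREM.lintegral_expNeg_mass (h : IsGREM P a g ζ κ) (hg : MonotoneOn g (Icc 0 1))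
    (hg0 : g 0 = 0) (r : ℝ≥0) :
    ∫⁻ ω, expNeg (r * leafSum (fun _ => 0) (fun v j => ζ v j ω) fun α => κ α ω) ∂P
      = expNeg (cascadeConst a.k a.x * (r : ℝ≥0∞) ^ a.x 0) := by
  rw [h.lintegral_expNeg_leafSum hg hg0 (C := 0) (LipschitzWith.const 0)]
  simp [recursion_zero]

end

/-! ### Integrability of the logarithm -/

theorem ofReal_abs_le_tsum (L : ℝ) :
    ENNReal.ofReal |L| ≤ ∑' n : ℕ, if (n : ℝ) ≤ |L| then 1 else 0 := by
  refine le_trans ?_ (ENNReal.sum_le_tsum (Finset.range (⌊|L|⌋₊ + 1)))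
  rw [Finset.sum_congr rfl fun n hn => if_pos ?_]
  · simp only [Finset.sum_const, Finset.card_range, nsmul_eq_mul, mul_one]
    rw [← ENNReal.ofReal_natCast]
    exact ENNReal.ofReal_le_ofReal (by push_cast; exact (Nat.lt_floor_add_one _).le)
  · exact (Nat.le_floor_iff (abs_nonneg L)).1 (Nat.lt_succ_iff.1 (Finset.mem_range.1 hn))

/-- Tails of the logarithm are read off the Laplace transform: log w ≥ n means e^{-n} w ≥ 1, and log
w ≤ -n means e^n w ≤ 1. The factor 3 suffices as 1/3 ≤ e^{-1} ≤ 2/3. -/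
theorem ite_le_abs_log {w : ℝ} (hw : 0 < w) (n : ℕ) :
    (if (n : ℝ) ≤ |Real.log w| then (1 : ℝ≥0∞) else 0)
      ≤ 3 * (1 - expNeg (ENNReal.ofReal (Real.exp (-n)) * ENNReal.ofReal w))
        + 3 * expNeg (ENNReal.ofReal (Real.exp n) * ENNReal.ofReal w) := by
  have he1 : Real.exp (-1) ≤ 2 / 3 ∧ 1 / 3 ≤ Real.exp (-1) := by
    rw [Real.exp_neg]
    constructor
    · rw [inv_le_comm₀ (Real.exp_pos _) (by norm_num)]
      linarith [Real.exp_one_gt_d9]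
    · rw [le_inv_comm₀ (by norm_num) (Real.exp_pos _)]
      linarith [Real.exp_one_lt_d9]
  split_ifs with h
  swap
  · exact zero_le
  rw [← ENNReal.ofReal_mul (Real.exp_pos _).le, ← ENNReal.ofReal_mul (Real.exp_pos _).le,
    expNeg_ofReal (by positivity), expNeg_ofReal (by positivity), ← ENNReal.ofReal_one,
    ← ENNReal.ofReal_sub _ (Real.exp_pos _).le, ← ENNReal.ofReal_ofNat 3,
    ← ENNReal.ofReal_mul (by norm_num), ← ENNReal.ofReal_mul (by norm_num)]
  rcases le_abs.1 h with h | h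
  · refine le_add_right (ENNReal.ofReal_le_ofReal ?_)
    have h1 : 1 ≤ Real.exp (-n) * w := by
      rw [← Real.exp_log hw, ← Real.exp_add]
      exact Real.one_le_exp (by linarith)
    have h2 : Real.exp (-(Real.exp (-n) * w)) ≤ Real.exp (-1) := Real.exp_le_exp.2 (by linarith)
    linarith [he1.1]
  · refine le_add_left (ENNReal.ofReal_le_ofReal ?_)
    have h1 : Real.exp n * w ≤ 1 := by
      rw [← Real.exp_log hw, ← Real.exp_add]
      exact Real.exp_le_one_iff.2 (by linarith)
    have h2 : Real.exp (-1) ≤ Real.exp (-(Real.exp n * w)) := Real.exp_le_exp.2 (by linarith)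
    linarith [he1.2]

theorem expNeg_le_inv (t : ℝ≥0∞) : expNeg t ≤ t⁻¹ := by
  induction t with
  | top => simp
  | coe t =>
    rcases eq_or_ne t 0 with rfl | ht
    · simp
    · have ht' : 0 < (t : ℝ) := NNReal.coe_pos.2 (pos_iff_ne_zero.2 ht)
      rw [← ENNReal.ofReal_coe_nnreal, expNeg_ofReal t.coe_nonneg,
        ← ENNReal.ofReal_inv_of_pos ht', Real.exp_neg]
      refine ENNReal.ofReal_le_ofReal (inv_anti₀ ht' ?_)
      linarith [Real.add_one_le_exp (t : ℝ)]

/-- A Laplace transform of stable form makes both tails of log w geometric, with ratio e^{-m}. The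
dominating series diverges where w is 0 or ∞, so its finite mean also excludes these values. -/
theorem log_of_laplace {Ω : Type*} [MeasurableSpace Ω] {P : Measure Ω} [IsProbabilityMeasure P]
    {w : Ω → ℝ≥0∞} (hw : Measurable w) {c : ℝ≥0∞} (hc0 : c ≠ 0) (hc : c ≠ ∞) {m : ℝ} (hm : 0 < m)
    (h : ∀ r : ℝ≥0, ∫⁻ ω, expNeg (r * w ω) ∂P = expNeg (c * (r : ℝ≥0∞) ^ m)) :
    (∀ᵐ ω ∂P, w ω ≠ 0 ∧ w ω ≠ ∞) ∧ Integrable (fun ω => Real.log (w ω).toReal) P := by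
  set S : Ω → ℝ≥0∞ := fun ω => ∑' n : ℕ,
    (3 * (1 - expNeg (ENNReal.ofReal (Real.exp (-n)) * w ω))
      + 3 * expNeg (ENNReal.ofReal (Real.exp n) * w ω)) with hS
  have hSm : Measurable S := Measurable.tsum fun n => by fun_prop
  set ρ := ENNReal.ofReal (Real.exp (-m)) with hρ
  have hρ1 : ρ < 1 := by
    rw [hρ, ENNReal.ofReal_lt_one]
    exact Real.exp_zero ▸ Real.exp_lt_exp.2 (neg_lt_zero.2 hm)
  have hpow : ∀ n : ℕ, ENNReal.ofReal (Real.exp (-n)) ^ m = ρ ^ n := fun n => by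
    rw [ENNReal.ofReal_rpow_of_pos (Real.exp_pos _), ← Real.exp_mul, hρ,
      ← ENNReal.ofReal_pow (Real.exp_pos _).le, ← Real.exp_nat_mul]
    ring_nf
  have hpow' : ∀ n : ℕ, ENNReal.ofReal (Real.exp n) ^ m = (ρ ^ n)⁻¹ := fun n => by
    rw [← hpow, ← ENNReal.inv_rpow, ← ENNReal.ofReal_inv_of_pos (Real.exp_pos _), Real.exp_neg,
      inv_inv]
  have hSint : ∫⁻ ω, S ω ∂P ≠ ∞ := by
    rw [hS, lintegral_tsum fun n => by fun_prop]
    have hn : ∀ n : ℕ, ∫⁻ ω, (3 * (1 - expNeg (ENNReal.ofReal (Real.exp (-n)) * w ω))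
        + 3 * expNeg (ENNReal.ofReal (Real.exp n) * w ω)) ∂P ≤ (3 * c + 3 * c⁻¹) * ρ ^ n := by
      intro n
      rw [lintegral_add_left (by fun_prop), lintegral_const_mul _ (by fun_prop),
        lintegral_const_mul _ (by fun_prop), lintegral_sub (by fun_prop) ?_
        (ae_of_all _ fun ω => expNeg_le_one _)]
      · have h1 : ∫⁻ ω, expNeg (ENNReal.ofReal (Real.exp (-n)) * w ω) ∂P
            = expNeg (c * ENNReal.ofReal (Real.exp (-n)) ^ m) := h _
        have h2 : ∫⁻ ω, expNeg (ENNReal.ofReal (Real.exp n) * w ω) ∂P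
            = expNeg (c * ENNReal.ofReal (Real.exp n) ^ m) := h _
        rw [h1, h2, hpow, hpow', lintegral_const, measure_univ, mul_one, add_mul, mul_assoc,
          mul_assoc]
        refine add_le_add (mul_le_mul_right (one_sub_expNeg_le _) 3)
          (mul_le_mul_right ((expNeg_le_inv _).trans_eq ?_) 3)
        rw [ENNReal.mul_inv (Or.inl hc0) (Or.inl hc), inv_inv]
      · exact ((lintegral_mono fun ω => expNeg_le_one _).trans_lt (by simp)).ne
    refine ne_top_of_le_ne_top ?_ (ENNReal.tsum_le_tsum hn)
    rw [ENNReal.tsum_mul_left, ENNReal.tsum_geometric]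
    refine ENNReal.mul_ne_top (ENNReal.add_ne_top.2 ⟨ENNReal.mul_ne_top (by simp) hc,
      ENNReal.mul_ne_top (by simp) (ENNReal.inv_ne_top.2 hc0)⟩) ?_
    rw [ENNReal.inv_ne_top]
    exact (tsub_pos_of_lt hρ1).ne'
  have hne : ∀ᵐ ω ∂P, w ω ≠ 0 ∧ w ω ≠ ∞ := by
    filter_upwards [ae_lt_top hSm hSint] with ω hω
    constructor
    · intro h0
      simp [hS, h0] at hω
    · intro h0
      have h1 : ∀ x : ℝ, ENNReal.ofReal (Real.exp x) * ∞ = ∞ := fun x =>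
        ENNReal.mul_top (by simpa using Real.exp_pos x)
      simp [hS, h0, h1] at hω
  refine ⟨hne, ?_, ?_⟩
  · exact (Real.measurable_log.comp hw.ennreal_toReal).aestronglyMeasurable
  · rw [hasFiniteIntegral_iff_norm]
    refine lt_of_le_of_lt (lintegral_mono_ae ?_) hSint.lt_top
    filter_upwards [hne] with ω hω
    have hpos := ENNReal.toReal_pos hω.1 hω.2
    rw [Real.norm_eq_abs]
    refine (ofReal_abs_le_tsum _).trans (ENNReal.tsum_le_tsum fun n => ?_)
    have := ite_le_abs_log hpos n
    rwa [ENNReal.ofReal_toReal hω.2] at this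


/-! ### The value of the functional -/

section
variable {Ω : Type} [MeasurableSpace Ω] {P : Measure Ω} {a : Atomic} {g : ℝ → ℝ}
  {ζ : Vertex a.k → ℕ → Ω → ℝ} {κ : (Fin a.k → ℕ) → Ω → ℝ}

theorem IsGREM.measurable_leafSum (h : IsGREM P a g ζ κ) {ψ : ℝ → ℝ} (hψ : Measurable ψ) :
    Measurable fun ω => leafSum ψ (fun v j => ζ v j ω) fun α => κ α ω :=
  (RPC.measurable_leafSum hψ a.k).comp (h.measurable_points.prodMk h.measurable_field)

theorem IsGREM.log_mass (h : IsGREM P a g ζ κ) (hg : MonotoneOn g (Icc 0 1)) (hg0 : g 0 = 0) :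
    (∀ᵐ ω ∂P, leafSum (fun _ => 0) (fun v j => ζ v j ω) (fun α => κ α ω) ≠ 0 ∧
      leafSum (fun _ => 0) (fun v j => ζ v j ω) (fun α => κ α ω) ≠ ∞) ∧
    Integrable (fun ω => Real.log
      (leafSum (fun _ => 0) (fun v j => ζ v j ω) fun α => κ α ω).toReal) P := by
  have := h.isProb
  exact log_of_laplace (h.measurable_leafSum measurable_const)
    (cascadeConst_ne_zero a.k a.x a.x_pos a.x_mono) (cascadeConst_ne_top a.k a.x a.x_pos a.x_mono)
    a.x_pos (h.lintegral_expNeg_mass hg hg0)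

/-- The law of the sum over the leaves is that of the total mass times an independent factor. -/
theorem IsGREM.map_leafSum (h : IsGREM P a g ζ κ) (hg : MonotoneOn g (Icc 0 1)) (hg0 : g 0 = 0)
    {ψ : ℝ → ℝ} {C : ℝ≥0} (hψ : LipschitzWith C ψ) :
    P.map (fun ω => leafSum ψ (fun v j => ζ v j ω) fun α => κ α ω)
      = ((gaussianReal 0 (g (a.q 0) - g 0).toNNReal).prod P).map fun p =>
        ENNReal.ofReal (Real.exp (recursion ψ g a.k a.q a.x p.1))
          * leafSum (fun _ => 0) (fun v j => ζ v j p.2) fun α => κ α p.2 := by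
  have := h.isProb
  have hT := h.measurable_leafSum hψ.continuous.measurable
  have hW := h.measurable_leafSum (ψ := fun _ => 0) measurable_const
  have hφ := (recursion_lipschitz hψ g a.k a.q a.x a.x_nonneg).continuous.measurable
  have hm : Measurable fun p : ℝ × Ω => ENNReal.ofReal (Real.exp (recursion ψ g a.k a.q a.x p.1))
      * leafSum (fun _ => 0) (fun v j => ζ v j p.2) fun α => κ α p.2 :=
    Measurable.mul (by fun_prop) (hW.comp measurable_snd)
  refine ext_of_lintegral_expNeg fun n => ?_
  rw [lintegral_map (by fun_prop) hT, lintegral_map (by fun_prop) hm,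
    lintegral_prod _ (Measurable.aemeasurable (by fun_prop))]
  have := h.lintegral_expNeg_leafSum hg hg0 hψ n
  rw [ENNReal.coe_natCast] at this
  rw [this]
  refine lintegral_congr fun η => ?_
  -- The transform of the sum, for fixed root increment η, is that of the total mass at the argument
  -- n e^{φ(η)}; this identifies the random factor.
  have h2 := h.lintegral_expNeg_mass hg hg0
    (n * (Real.exp (recursion ψ g a.k a.q a.x η)).toNNReal)
  rw [ENNReal.coe_mul, ENNReal.coe_natCast] at h2
  simp only [← mul_assoc]
  exact h2.symm

theorem IsGREM.log_leafSum (h : IsGREM P a g ζ κ) (hg : MonotoneOn g (Icc 0 1)) (hg0 : g 0 = 0)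
    {ψ : ℝ → ℝ} {C : ℝ≥0} (hψ : LipschitzWith C ψ) :
    (∀ᵐ ω ∂P, leafSum ψ (fun v j => ζ v j ω) (fun α => κ α ω) ≠ 0 ∧
      leafSum ψ (fun v j => ζ v j ω) (fun α => κ α ω) ≠ ∞) ∧
    Integrable (fun ω => Real.log (leafSum ψ (fun v j => ζ v j ω) fun α => κ α ω).toReal) P ∧
    ∫ ω, Real.log (leafSum ψ (fun v j => ζ v j ω) fun α => κ α ω).toReal ∂P
      = parisi ψ g a
        + ∫ ω, Real.log (leafSum (fun _ => 0) (fun v j => ζ v j ω) fun α => κ α ω).toReal ∂P := by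
  have := h.isProb
  set γ := gaussianReal 0 (g (a.q 0) - g 0).toNNReal with hγ
  have hT := h.measurable_leafSum hψ.continuous.measurable
  have hW := h.measurable_leafSum (ψ := fun _ => 0) measurable_const
  have hφL := recursion_lipschitz hψ g a.k a.q a.x a.x_nonneg
  have hφ := hφL.continuous.measurable
  have hm : Measurable fun p : ℝ × Ω => ENNReal.ofReal (Real.exp (recursion ψ g a.k a.q a.x p.1))
      * leafSum (fun _ => 0) (fun v j => ζ v j p.2) fun α => κ α p.2 :=
    Measurable.mul (by fun_prop) (hW.comp measurable_snd)
  have hlaw := h.map_leafSum hg hg0 hψ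
  obtain ⟨hW0, hWi⟩ := h.log_mass hg hg0
  have hW0' := Measure.quasiMeasurePreserving_snd (μ := γ) (ν := P) |>.ae hW0
  have hlog : Measurable fun t : ℝ≥0∞ => Real.log t.toReal :=
    Real.measurable_log.comp measurable_id.ennreal_toReal
  have hφi : Integrable (recursion ψ g a.k a.q a.x) γ := by
    simpa using integrable_shift hφL (g (a.q 0) - g 0).toNNReal 0
  have hsum : Integrable (fun p : ℝ × Ω => recursion ψ g a.k a.q a.x p.1 + Real.log
      (leafSum (fun _ => 0) (fun v j => ζ v j p.2) fun α => κ α p.2).toReal) (γ.prod P) :=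
    (hφi.comp_fst P).add (hWi.comp_snd γ)
  have hae : (fun p : ℝ × Ω => Real.log (ENNReal.ofReal (Real.exp (recursion ψ g a.k a.q a.x p.1))
      * leafSum (fun _ => 0) (fun v j => ζ v j p.2) fun α => κ α p.2).toReal) =ᵐ[γ.prod P]
      fun p => recursion ψ g a.k a.q a.x p.1 + Real.log
      (leafSum (fun _ => 0) (fun v j => ζ v j p.2) fun α => κ α p.2).toReal := by
    filter_upwards [hW0'] with p hp
    rw [ENNReal.toReal_mul, ENNReal.toReal_ofReal (Real.exp_pos _).le,
      Real.log_mul (Real.exp_pos _).ne' (ENNReal.toReal_pos hp.1 hp.2).ne', Real.log_exp]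
  refine ⟨?_, ?_, ?_⟩
  · refine ae_of_ae_map (p := fun t => t ≠ 0 ∧ t ≠ ∞) hT.aemeasurable ?_
    rw [hlaw, ae_map_iff hm.aemeasurable (by measurability)]
    filter_upwards [hW0'] with p hp
    exact ⟨mul_ne_zero (by simpa using Real.exp_pos _) hp.1,
      ENNReal.mul_ne_top ENNReal.ofReal_ne_top hp.2⟩
  · have h1 := integrable_map_measure (μ := P) hlog.aestronglyMeasurable hT.aemeasurable
    rw [hlaw, integrable_map_measure hlog.aestronglyMeasurable hm.aemeasurable] at h1
    exact h1.1 (hsum.congr hae.symm)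
  · have h1 := integral_map (μ := P) hT.aemeasurable hlog.aestronglyMeasurable
    rw [hlaw, integral_map hm.aemeasurable hlog.aestronglyMeasurable] at h1
    rw [← h1, integral_congr_ae hae, integral_add (hφi.comp_fst P) (hWi.comp_snd γ),
      integral_fun_fst, integral_fun_snd (μ := γ) (fun ω => Real.log
        (leafSum (fun _ => 0) (fun v j => ζ v j ω) fun α => κ α ω).toReal)]
    simp [parisi, gaussOp, hγ]

theorem leafSum_eq_tsum_cascade {Ω : Type} {ψ : ℝ → ℝ} {k : ℕ} {Z : Vertex k → ℕ → Ω → ℝ}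
    {u : (Fin k → ℕ) → Ω → ℝ} {ω : Ω} (hZ : ∀ v j, 0 < Z v j ω) :
    leafSum ψ (fun v j => Z v j ω) (fun α => u α ω)
      = ∑' α, ENNReal.ofReal (cascade Z α ω * Real.exp (ψ (u α ω))) := by
  refine tsum_congr fun α => ?_
  rw [cascade, ENNReal.ofReal_mul (Finset.prod_nonneg fun l _ => (hZ _ _).le),
    ENNReal.ofReal_prod_of_nonneg fun l _ => (hZ _ _).le]

theorem summable_and_tsum_eq {ι : Type*} {f : ι → ℝ} (hf : ∀ i, 0 ≤ f i)
    (h : ∑' i, ENNReal.ofReal (f i) ≠ ∞) :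
    Summable f ∧ ∑' i, f i = (∑' i, ENNReal.ofReal (f i)).toReal := by
  have h1 := ENNReal.summable_toReal h
  have h2 := ENNReal.tsum_toReal_eq (f := fun i => ENNReal.ofReal (f i))
    fun _ => ENNReal.ofReal_ne_top
  simp only [ENNReal.toReal_ofReal (hf _)] at h1 h2
  exact ⟨h1, h2.symm⟩

theorem IsGREM.value (h : IsGREM P a g ζ κ) (hg : MonotoneOn g (Icc 0 1)) (hg0 : g 0 = 0)
    {ψ : ℝ → ℝ} {C : ℝ≥0} (hψ : LipschitzWith C ψ) :
    (∀ᵐ ω ∂P, Summable fun α => cascade ζ α ω) ∧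
    (∀ᵐ ω ∂P, Summable fun α => cascade ζ α ω * Real.exp (ψ (κ α ω))) ∧
    Integrable (logRatio ψ ζ κ) P ∧ ∫ ω, logRatio ψ ζ κ ω ∂P = parisi ψ g a := by
  have := h.isProb
  obtain ⟨hW0, hWi⟩ := h.log_mass hg hg0
  obtain ⟨hT0, hTi, hTe⟩ := h.log_leafSum hg hg0 hψ
  have hpos : ∀ᵐ ω ∂P, ∀ v j, 0 < ζ v j ω := ae_all_iff.2 fun v => (h.rem v).pos
  have hc : ∀ ω, (∀ v j, 0 < ζ v j ω) → ∀ α, 0 ≤ cascade ζ α ω := fun ω hω α =>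
    Finset.prod_nonneg fun l _ => (hω _ _).le
  have hW : ∀ᵐ ω ∂P, (Summable fun α => cascade ζ α ω) ∧ ∑' α, cascade ζ α ω
      = (leafSum (fun _ => 0) (fun v j => ζ v j ω) fun α => κ α ω).toReal := by
    filter_upwards [hpos, hW0] with ω hω hω0
    have e := leafSum_eq_tsum_cascade (ψ := fun _ => 0) (u := κ) hω
    simp only [Real.exp_zero, mul_one] at e
    rw [e] at hω0 ⊢
    exact summable_and_tsum_eq (hc ω hω) hω0.2
  have hT : ∀ᵐ ω ∂P, (Summable fun α => cascade ζ α ω * Real.exp (ψ (κ α ω))) ∧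
      ∑' α, cascade ζ α ω * Real.exp (ψ (κ α ω))
      = (leafSum ψ (fun v j => ζ v j ω) fun α => κ α ω).toReal := by
    filter_upwards [hpos, hT0] with ω hω hω0
    have e := leafSum_eq_tsum_cascade (ψ := ψ) (u := κ) hω
    rw [e] at hω0 ⊢
    exact summable_and_tsum_eq (fun α => mul_nonneg (hc ω hω α) (Real.exp_pos _).le) hω0.2
  have hae : logRatio ψ ζ κ =ᵐ[P] fun ω =>
      Real.log (leafSum ψ (fun v j => ζ v j ω) fun α => κ α ω).toReal
      - Real.log (leafSum (fun _ => 0) (fun v j => ζ v j ω) fun α => κ α ω).toReal := by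
    filter_upwards [hW, hT, hW0, hT0] with ω h1 h2 h3 h4
    rw [logRatio, h1.2, h2.2, Real.log_div (ENNReal.toReal_pos h4.1 h4.2).ne'
      (ENNReal.toReal_pos h3.1 h3.2).ne']
  refine ⟨hW.mono fun ω h => h.1, hT.mono fun ω h => h.1, (hTi.sub hWi).congr hae.symm, ?_⟩
  -- The mean logarithm of the total mass cancels, leaving only the value of the recursion.
  rw [integral_congr_ae hae, integral_sub hTi hWi, hTe]
  ring

end

/-! ### Existence of the cascade and its field -/

/-- The Laplace functional is invariant under measure-preserving maps, and it characterizes the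
Poisson process. -/
theorem IsREM.comp_measurePreserving {Ω Ω' : Type} [MeasurableSpace Ω] [MeasurableSpace Ω']
    {P : Measure Ω} {P' : Measure Ω'} [IsProbabilityMeasure P] [IsProbabilityMeasure P'] {m : ℝ}
    {ζ : ℕ → Ω → ℝ} (h : IsREM P m ζ) {φ : Ω' → Ω} (hφ : MeasurePreserving φ P' P) :
    IsREM P' m fun j ω => ζ j (φ ω) := by
  refine ⟨isPoissonPointProcess_of_lintegral_expNeg
    (fun j => (h.ppp.measurable j).comp hφ.measurable) fun f hf _ => ?_,
    hφ.quasiMeasurePreserving.ae h.pos, hφ.quasiMeasurePreserving.ae h.anti⟩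
  rw [← lintegral_expNeg_tsum h.ppp hf]
  exact hφ.lintegral_comp (measurable_expNeg.comp
    (Measurable.tsum fun j => hf.comp (h.ppp.measurable j)))

theorem exists_isGREM {g : ℝ → ℝ} (a : Atomic) (hg : MonotoneOn g (Icc 0 1)) (hg0 : g 0 = 0) :
    IsGREM ((Measure.infinitePi fun _ : Vertex a.k => expSeq).prod (markLaw g a.q)) a g
      (fun v j ω => arrival (j + 1) (ω.1 v) ^ (-(a.x v.1.castSucc)⁻¹))
      (fun α ω => canonicalField α ω.2) := by
  set Q := (Measure.infinitePi fun _ : Vertex a.k => expSeq).prod (markLaw g a.q) with hQ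
  have h1 : MeasurePreserving Prod.fst Q (Measure.infinitePi fun _ : Vertex a.k => expSeq) :=
    measurePreserving_fst
  have h2 : MeasurePreserving Prod.snd Q (markLaw g a.q) := measurePreserving_snd
  have hZ : ∀ v : Vertex a.k, Measurable fun (z : ℕ → ℝ) j =>
      arrival (j + 1) z ^ (-(a.x v.1.castSucc)⁻¹) := fun v =>
    measurable_pi_lambda _ fun j => by fun_prop
  refine ⟨inferInstance, fun v => ?_, ?_, fun α => by fun_prop, ⟨fun I => ⟨?_⟩⟩, fun α => ?_,
    fun α β => ?_, ?_⟩
  · have hx : 0 < a.x v.1.castSucc := a.x_pos.trans_le (a.x_mono.monotone (Fin.zero_le _))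
    exact (exists_isREM hx).comp_measurePreserving
      ((measurePreserving_eval_infinitePi (fun _ : Vertex a.k => expSeq) v).comp h1)
  · rw [iIndepFun_iff_map_fun_eq_infinitePi_map fun v => by have := hZ v; fun_prop]
    have e1 : Q.map (fun ω v j => arrival (j + 1) (ω.1 v) ^ (-(a.x v.1.castSucc)⁻¹))
        = (Q.map Prod.fst).map fun z v j =>
          arrival (j + 1) (z v) ^ (-(a.x v.1.castSucc)⁻¹) := by
      rw [Measure.map_map (by fun_prop) (by fun_prop)]
      rfl
    rw [e1, h1.map_eq, Measure.infinitePi_map_pi (fun _ : Vertex a.k => expSeq)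
      (f := fun v z j => arrival (j + 1) z ^ (-(a.x v.1.castSucc)⁻¹)) hZ]
    congr 1
    funext v
    rw [← ((measurePreserving_eval_infinitePi (fun _ : Vertex a.k => expSeq) v).comp h1).map_eq,
      Measure.map_map (hZ v) (by fun_prop)]
    rfl
  · have := ((isGaussianProcess_canonicalField g a.q).hasGaussianLaw I).isGaussian_map
    have hI : Measurable fun M : Option (Vertex a.k × ℕ) → ℝ => I.restrict (canonicalField · M) :=
      measurable_pi_lambda _ fun α => measurable_canonicalField _
    rw [← h2.map_eq, Measure.map_map hI measurable_snd] at this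
    exact this
  · have := integral_canonicalField g a.q α
    rwa [← h2.map_eq, integral_map (by fun_prop) (by fun_prop)] at this
  · have := covariance_canonicalField a hg hg0 α β
    rwa [← h2.map_eq, covariance_map (by fun_prop) (by fun_prop) (by fun_prop)] at this
  · exact indepFun_prod (X := fun (z : Vertex a.k → ℕ → ℝ) v j =>
      arrival (j + 1) (z v) ^ (-(a.x v.1.castSucc)⁻¹))
      (Y := fun (M : Option (Vertex a.k × ℕ) → ℝ) α => canonicalField α M) (by fun_prop)
      (by fun_prop)

theorem isValue_parisi {ψ g : ℝ → ℝ} {C : ℝ≥0} (hψ : LipschitzWith C ψ)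
    (hg : MonotoneOn g (Icc 0 1)) (hg0 : g 0 = 0) (a : Atomic) :
    IsValue ψ g a (parisi ψ g a) :=
  ⟨⟨_, _, _, _, _, exists_isGREM a hg hg0⟩, fun _ _ _ _ _ h => h.value hg hg0 hψ⟩

end RPC
end

/-! ### Continuity and monotonicity of the functional -/

theorem mainTheorem3 (ψ : ℝ → ℝ) (hψ : RPC.ClassC ψ) (C : ℝ) (hC : ∀ t, |deriv ψ t| ≤ C)
    (g : ℝ → ℝ) (hg : ContDiffOn ℝ 1 g (Icc 0 1)) (hg_mono : StrictMonoOn g (Icc 0 1))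
    (hg0 : g 0 = 0) :
    ∃ F : RPC.Atomic → ℝ,
      (∀ a, RPC.IsValue ψ g a (F a)) ∧
      (∀ a b, |F a - F b| ≤ C ^ 2 / 2 * (RPC.l1Dist g a.toProbI b.toProbI).toReal) ∧
      RPC.l1Topology g = (inferInstance : TopologicalSpace (ProbabilityMeasure unitInterval)) ∧
      ∃ Φ : ProbabilityMeasure unitInterval → ℝ,
        Continuous[RPC.l1Topology g, inferInstance] Φ ∧
        Continuous Φ ∧
        (∀ a : RPC.Atomic, Φ a.toProbI = F a) ∧
        (∀ Φ' : ProbabilityMeasure unitInterval → ℝ, Continuous Φ' →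
          (∀ a : RPC.Atomic, Φ' a.toProbI = F a) → Φ' = Φ) ∧
        ∀ x y, RPC.Dominates x y → Φ y ≤ Φ x := by

  have hC0 : 0 ≤ C := (abs_nonneg _).trans (hC 0)
  have hL : LipschitzWith C.toNNReal ψ := by
    refine lipschitzWith_of_nnnorm_deriv_le (hψ.contDiff.differentiable (by norm_num)) fun t => ?_
    rw [← NNReal.coe_le_coe, coe_nnnorm, Real.norm_eq_abs, Real.coe_toNNReal C hC0]
    exact hC t
  have hlip : ∀ a b, |RPC.parisi ψ g a - RPC.parisi ψ g b|
      ≤ C ^ 2 / 2 * (RPC.l1Dist g a.toProbI b.toProbI).toReal := fun a b => by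
    have := RPC.parisi_lipschitz hL hg hg_mono a b
    rwa [Real.coe_toNNReal C hC0] at this
  have htop := RPC.l1Topology_eq hg hg_mono
  obtain ⟨Φ, hΦ, hΦF, huniq, hmono⟩ := RPC.exists_extension hg hg_mono hlip
    fun a b h => RPC.parisi_mono hL hg_mono h
  refine ⟨RPC.parisi ψ g, RPC.isValue_parisi hL hg_mono.monotoneOn hg0, hlip, htop, Φ, ?_, hΦ, hΦF,
    huniq, hmono⟩
  rw [htop]
  exact hΦ
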